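/- **Setting.** For a real matrix $M\neq 0$ let $\|M\|$ be its operator norm, $\|M\|_F$ its Frobenius norm, $\sigma_{\min}(M)$ its smallest nonzero singular value and $\kappa(M)=\|M\|/\sigma_{\min}(M)$. Let $X_\star\in\mathbb R^{n_1\times n_2}$ have rank $r\ge 1$, with compact singular value decomposition $X_\star=V_\star\Sigma_\star W_\star^\top$, put $\kappa=\kappa(X_\star)$, $L_\star=V_\star\Sigma_\star^{1/2}$, $R_\star=W_\star\Sigma_\star^{1/2}$. Let $A_1,\dots,A_m\in\mathbb R^{n_1\times n_2}$ be random matrices whose entries are all independent $\mathcal N(0,1)$ variables, let $\mathcal A:\mathbb R^{n_1\times n_2}\to\mathbb R^m$, $[\mathcal A(X)]_i=\frac1{\sqrt m}\operatorname{tr}(A_i^\top X)$, with adjoint $\mathcal A^*(v)=\frac1{\sqrt m}\sum_{i=1}^m v_iA_i$, and let $y=\mathcal A(X_\star)$. ScaledGD with spectral initialization and step size $\mu$ takes a top-$r$ singular value decomposition $\widetilde V\widetilde\Sigma\widetilde W^\top$ of $\mathcal A^*(y)$ (any choice), sets $L_0=\widetilde V\widetilde\Sigma^{1/2}$, $R_0=\widetilde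 W\widetilde\Sigma^{1/2}$, and iterates, with $X_t=L_tR_t^\top$, $$L_{t+1}=L_t+\mu\,\mathcal A^*(y-\mathcal A(X_t))\,R_t\,(R_t^\top R_t)^{-1},\qquad R_{t+1}=R_t+\mu\,\mathcal A^*(y-\mathcal A(X_t))^\top L_t\,(L_t^\top L_t)^{-1}.$$ The error is measured by $$\mathrm{dist}^2(X_t,X_\star)=\inf_{Q\in GL(r)}\ \|(L_tQ-L_\star)\Sigma_\star^{1/2}\|_F^2+\|(R_tQ^{-\top}-R_\star)\Sigma_\star^{1/2}\|_F^2 .$$ **Theorem.** For every constant $c_0\in(0,1/1080]$ and every constant $c_\mu>0$ there is a constant $C>0$, depending only on $c_0$ and $c_\mu$ (in particular not on $n_1,n_2,r,m,X_\star,\mu$), such that the following holds. If $c_\mu\le\mu\le 1/32$ and $m\ge C(n_1+n_2)\,r\,\kappa^2$, then with probability at least $1-7e^{-(n_1+n_2)}$ the matrices $L_t^\top L_t$ and $R_t^\top R_t$ are invertible for all $t\ge 0$ (so that the iterates are well defined), and for all $t\ge0$ $$\mathrm{dist}(X_t,X_\star)\le 8\sqrt r\,(1-\mu/10)^t\,c_0\,\sigma_{\min}(X_\star),\qquad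 \|X_t-X_\star\|_F\le 12\sqrt r\,(1-\mu/10)^t\,c_0\,\sigma_{\min}(X_\star).$$ On the same event, for every $\epsilon>0$ and every integer $t\ge\max\{0,\frac{10}{\mu}\log(\sqrt r/\epsilon)\}$, both $\mathrm{dist}(X_t,X_\star)\le\epsilon\,\sigma_{\min}(X_\star)$ and $\|X_t-X_\star\|_F\le\epsilon\,\sigma_{\min}(X_\star)$; so the number of iterations that suffices for accuracy $\epsilon$ does not depend on $\kappa$. -/

import Mathlib

open MeasureTheory ProbabilityTheory

namespace MatrixSensing

section Norms

open scoped Matrix.Norms.Frobenius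

/-- The Frobenius norm of a real matrix. -/
noncomputable def frobNorm {p q : ℕ} (M : Matrix (Fin p) (Fin q) ℝ) : ℝ := ‖M‖

end Norms

section Norms

open scoped Matrix.Norms.L2Operator

/-- The operator norm of a real matrix between Euclidean spaces. -/
noncomputable def specNorm {p q : ℕ} (M : Matrix (Fin p) (Fin q) ℝ) : ℝ := ‖M‖

end Norms

/-- The singular values of a real matrix, in non-increasing order and with multiplicity,
indexed from `0`. -/
noncomputable def singVal {p q : ℕ} (M : Matrix (Fin p) (Fin q) ℝ) (k : ℕ) : ℝ :=
  (Matrix.toEuclideanLin M).singularValues k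

/-- The smallest nonzero singular value of a (nonzero) matrix. -/
noncomputable def sigmaMin {p q : ℕ} (M : Matrix (Fin p) (Fin q) ℝ) : ℝ :=
  sInf {s : ℝ | s ≠ 0 ∧ ∃ k : ℕ, singVal M k = s}

/-- The condition number: operator norm over smallest nonzero singular value. -/
noncomputable def condNumber {p q : ℕ} (M : Matrix (Fin p) (Fin q) ℝ) : ℝ :=
  specNorm M / sigmaMin M

/-- The diagonal matrix `Σ^{1/2}`, where `Σ` has diagonal `σ`. -/
noncomputable def sqrtDiag {r : ℕ} (σ : Fin r → ℝ) : Matrix (Fin r) (Fin r) ℝ :=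
  Matrix.diagonal fun k => Real.sqrt (σ k)

/-- `M = V diag(σ) Wᵀ` is a compact singular value decomposition: orthonormal columns, and
positive singular values in non-increasing order. -/
structure IsCompactSVD {p q r : ℕ} (M : Matrix (Fin p) (Fin q) ℝ)
    (V : Matrix (Fin p) (Fin r) ℝ) (σ : Fin r → ℝ) (W : Matrix (Fin q) (Fin r) ℝ) : Prop where
  left_orthonormal : V.transpose * V = 1
  right_orthonormal : W.transpose * W = 1
  pos : ∀ k, 0 < σ k
  antitone : Antitone σ
  eq_mul : M = V * Matrix.diagonal σ * W.transpose

/-- `V diag(σ) Wᵀ` is a top-`r` singular value decomposition of `M`: `σ` lists the `r` largest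
singular values of `M` in non-increasing order, and the columns of `V` and `W` are
corresponding orthonormal left and right singular vectors. -/
structure IsTopSVD {p q r : ℕ} (M : Matrix (Fin p) (Fin q) ℝ)
    (V : Matrix (Fin p) (Fin r) ℝ) (σ : Fin r → ℝ) (W : Matrix (Fin q) (Fin r) ℝ) : Prop where
  left_orthonormal : V.transpose * V = 1
  right_orthonormal : W.transpose * W = 1
  singVal_eq : ∀ k : Fin r, σ k = singVal M k
  mul_right : M * W = V * Matrix.diagonal σ
  mul_left : M.transpose * V = W * Matrix.diagonal σ

/-- The measurement operator `[𝒜(X)]ᵢ = m^{-1/2} ⟨Aᵢ, X⟩`, with `⟨A, X⟩ = tr(Aᵀ X)`. -/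
noncomputable def measOp {p q m : ℕ} (A : Fin m → Matrix (Fin p) (Fin q) ℝ)
    (X : Matrix (Fin p) (Fin q) ℝ) : Fin m → ℝ :=
  fun i => (Real.sqrt m)⁻¹ * Matrix.trace ((A i).transpose * X)

/-- The adjoint `𝒜*(v) = m^{-1/2} ∑ᵢ vᵢ Aᵢ` of the measurement operator. -/
noncomputable def measAdj {p q m : ℕ} (A : Fin m → Matrix (Fin p) (Fin q) ℝ)
    (v : Fin m → ℝ) : Matrix (Fin p) (Fin q) ℝ :=
  (Real.sqrt m)⁻¹ • ∑ i, v i • A i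

/-- `(L t, R t)` is a sequence generated by scaled gradient descent with spectral
initialization, from the measurement matrices `A`, the data `y` and the step size `μ`
(for some choice of the top-`r` singular value decomposition of `𝒜*(y)`). -/
structure IsScaledGD {p q m r : ℕ} (A : Fin m → Matrix (Fin p) (Fin q) ℝ) (y : Fin m → ℝ)
    (μ : ℝ) (L : ℕ → Matrix (Fin p) (Fin r) ℝ) (R : ℕ → Matrix (Fin q) (Fin r) ℝ) : Prop where
  init : ∃ (V : Matrix (Fin p) (Fin r) ℝ) (σ : Fin r → ℝ) (W : Matrix (Fin q) (Fin r) ℝ),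
    IsTopSVD (measAdj A y) V σ W ∧ L 0 = V * sqrtDiag σ ∧ R 0 = W * sqrtDiag σ
  step_left : ∀ t, L (t + 1) = L t +
    μ • (measAdj A (y - measOp A (L t * (R t).transpose)) * R t *
      ((R t).transpose * R t)⁻¹)
  step_right : ∀ t, R (t + 1) = R t +
    μ • ((measAdj A (y - measOp A (L t * (R t).transpose))).transpose * L t *
      ((L t).transpose * L t)⁻¹)

/-- The distance between a pair of factors `(L, R)` and the balanced factors
`L⋆ = V Σ^{1/2}`, `R⋆ = W Σ^{1/2}` with `Σ = diag(σ)`: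
the square root of
`inf_Q ‖(L Q - L⋆) Σ^{1/2}‖_F² + ‖(R Q^{-⊤} - R⋆) Σ^{1/2}‖_F²` over invertible `Q`. -/
noncomputable def factorDist {p q r : ℕ} (L : Matrix (Fin p) (Fin r) ℝ)
    (R : Matrix (Fin q) (Fin r) ℝ) (V : Matrix (Fin p) (Fin r) ℝ) (σ : Fin r → ℝ)
    (W : Matrix (Fin q) (Fin r) ℝ) : ℝ :=
  Real.sqrt (⨅ Q : GL (Fin r) ℝ,
    (frobNorm ((L * (Q : Matrix (Fin r) (Fin r) ℝ) - V * sqrtDiag σ) * sqrtDiag σ) ^ 2 +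
      frobNorm ((R * ((Q⁻¹ : GL (Fin r) ℝ) : Matrix (Fin r) (Fin r) ℝ).transpose
        - W * sqrtDiag σ) * sqrtDiag σ) ^ 2))

/-- `A₁, …, Aₘ` are random matrices all of whose entries are independent standard Gaussians. -/
structure IsGaussianDesign {Ω : Type*} [MeasurableSpace Ω] (P : Measure Ω) {p q m : ℕ}
    (A : Ω → Fin m → Matrix (Fin p) (Fin q) ℝ) : Prop where
  law : ∀ (i : Fin m) (j : Fin p) (k : Fin q),
    HasLaw (fun ω => A ω i j k) (gaussianReal 0 1) P
  indep : iIndepFun (fun (e : Fin m × Fin p × Fin q) (ω : Ω) => A ω e.1 e.2.1 e.2.2) P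

end MatrixSensing

/-! Write n = n₁ + n₂, σ = σ_min(X⋆), and E = 𝒜*𝒜 − id. Multiplying the two factor updates shows
that the product X = L Rᵀ evolves by itself: X ↦ (1 + μGZ) X (1 + μZG) with Z the pseudo-inverse of
X and G = −((X − X⋆) + E(X − X⋆)) (`stepMap_factor`). So neither the balance of the factors nor κ
enters the dynamics. The first-order part of the step is PG + GR, with P and R the projections onto
the column and row spaces of X. Along it any ideal norm of the error contracts by 1 − μ, up to the
normal component of the error, which is quadratic (`IsIdealNorm.tangent_step`,
`IsIdealNorm.normal_le`). Linear convergence in Frobenius norm follows once the spectral error is at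
most a small multiple of σ and E is small on low-rank matrices.

The difficulty is to keep the spectral error small. For m of order n r κ² the restricted isometry
constant is δ of order c₀/κ, and restricted isometry alone bounds ‖E X⋆‖ only by δ‖X⋆‖_F, of order
√r c₀ σ; the factor √r must go. It is removed by decoupling. Take a finite net of unit rank-one
matrices B that determines the spectral norm up to a factor 4, and for each B run an auxiliary
sequence Y_B whose operator is ΠEΠ, with Π the projection onto the complement of B. That sequence is
a function of the projected matrices ΠAᵢ (`decoupled_designError`), which are independent of the
Gaussians ⟨Aᵢ, B⟩ (`indepFun_probeCoord`). Conditionally on it, ⟨E Π(Y_B − X⋆), B⟩ is a Gaussian of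
variance about ‖Y_B − X⋆‖_F²/m, hence at most of order c₀σ simultaneously over the net
(`gaussianProd_decoupled_union_le`).

The induction `IsTarget.convergence` carries together the spectral bound on X_t − X⋆, the linear
decay of the Frobenius errors of X_t and of every Y_B, and the closeness of X_t to Y_B in Frobenius
norm. Closeness at time 0 is a stability estimate for truncated singular value decompositions
(`IsTrunc.frobNorm_trunc_sub_le`) and propagates through `IsPinv.stepMap_sub_le`. All times are
handled on one event: the Gaussian threshold grows linearly in t, which makes the union bound
summable, while the Frobenius error decays geometrically; this trade-off is where the lower bound on
μ is used. Finally the Frobenius error of the product controls the factor distance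
(`IsTarget.factorDist_le`). -/

namespace MatrixSensing

/-! ### Frobenius and operator norms, the trace inner product, ideal norms. -/

section NormBasics

variable {p q s : ℕ}

section
open scoped Matrix.Norms.Frobenius

theorem frobNorm_nonneg (M : Matrix (Fin p) (Fin q) ℝ) : 0 ≤ frobNorm M := norm_nonneg M

theorem frobNorm_add_le (M N : Matrix (Fin p) (Fin q) ℝ) :
    frobNorm (M + N) ≤ frobNorm M + frobNorm N := norm_add_le M N

theorem frobNorm_sub_le (M N : Matrix (Fin p) (Fin q) ℝ) :
    frobNorm (M - N) ≤ frobNorm M + frobNorm N := norm_sub_le M N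

theorem frobNorm_neg (M : Matrix (Fin p) (Fin q) ℝ) : frobNorm (-M) = frobNorm M := norm_neg M

theorem frobNorm_smul (c : ℝ) (M : Matrix (Fin p) (Fin q) ℝ) :
    frobNorm (c • M) = |c| * frobNorm M := norm_smul c M

theorem frobNorm_transpose (M : Matrix (Fin p) (Fin q) ℝ) :
    frobNorm M.transpose = frobNorm M := Matrix.frobenius_norm_transpose M

theorem frobNorm_eq_zero {M : Matrix (Fin p) (Fin q) ℝ} : frobNorm M = 0 ↔ M = 0 := norm_eq_zero

theorem frobNorm_sq (M : Matrix (Fin p) (Fin q) ℝ) :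
    frobNorm M ^ 2 = ∑ i, ∑ j, M i j ^ 2 := by
  have h : frobNorm M = (∑ i, ∑ j, ‖M i j‖ ^ (2 : ℝ)) ^ (1 / 2 : ℝ) :=
    Matrix.frobenius_norm_def M
  rw [h, ← Real.sqrt_eq_rpow, Real.sq_sqrt (by positivity)]
  simp

end

section
open scoped Matrix.Norms.L2Operator

theorem specNorm_nonneg (M : Matrix (Fin p) (Fin q) ℝ) : 0 ≤ specNorm M := norm_nonneg M

theorem specNorm_add_le (M N : Matrix (Fin p) (Fin q) ℝ) :
    specNorm (M + N) ≤ specNorm M + specNorm N := norm_add_le M N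

theorem specNorm_sub_le (M N : Matrix (Fin p) (Fin q) ℝ) :
    specNorm (M - N) ≤ specNorm M + specNorm N := norm_sub_le M N

theorem specNorm_neg (M : Matrix (Fin p) (Fin q) ℝ) : specNorm (-M) = specNorm M := norm_neg M

theorem specNorm_smul (c : ℝ) (M : Matrix (Fin p) (Fin q) ℝ) :
    specNorm (c • M) = |c| * specNorm M := norm_smul c M

theorem specNorm_transpose (M : Matrix (Fin p) (Fin q) ℝ) :
    specNorm M.transpose = specNorm M := by
  rw [← Matrix.conjTranspose_eq_transpose_of_trivial]
  exact Matrix.l2_opNorm_conjTranspose M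

theorem specNorm_eq_zero {M : Matrix (Fin p) (Fin q) ℝ} : specNorm M = 0 ↔ M = 0 := norm_eq_zero

theorem specNorm_mul_le (M : Matrix (Fin p) (Fin q) ℝ) (N : Matrix (Fin q) (Fin s) ℝ) :
    specNorm (M * N) ≤ specNorm M * specNorm N := Matrix.l2_opNorm_mul M N

theorem norm_toLp_sq (v : Fin q → ℝ) : ‖(WithLp.toLp 2 v : EuclideanSpace ℝ (Fin q))‖ ^ 2
    = v ⬝ᵥ v := by
  rw [EuclideanSpace.norm_sq_eq]
  simp [dotProduct, sq]

theorem mulVec_dot_self_le (M : Matrix (Fin p) (Fin q) ℝ) (v : Fin q → ℝ) :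
    (M.mulVec v) ⬝ᵥ (M.mulVec v) ≤ specNorm M ^ 2 * (v ⬝ᵥ v) := by
  have h := Matrix.l2_opNorm_mulVec M (WithLp.toLp 2 v)
  rw [← norm_toLp_sq, ← norm_toLp_sq, ← mul_pow]
  exact pow_le_pow_left₀ (norm_nonneg _) h 2

theorem specNorm_le_of_mulVec {M : Matrix (Fin p) (Fin q) ℝ} {c : ℝ} (hc : 0 ≤ c)
    (h : ∀ v, (M.mulVec v) ⬝ᵥ (M.mulVec v) ≤ c ^ 2 * (v ⬝ᵥ v)) : specNorm M ≤ c := by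
  have e : specNorm M = ‖(Matrix.toEuclideanLin M).toContinuousLinearMap‖ := Matrix.l2_opNorm_def M
  rw [e]
  refine ContinuousLinearMap.opNorm_le_bound _ hc fun x => ?_
  have := h x.ofLp
  rw [← norm_toLp_sq, ← norm_toLp_sq, ← mul_pow] at this
  exact le_of_sq_le_sq this (by positivity)

end

theorem specNorm_one_le : specNorm (1 : Matrix (Fin p) (Fin p) ℝ) ≤ 1 :=
  specNorm_le_of_mulVec zero_le_one fun v => by simp

theorem frobNorm_sq_eq_sum_col (M : Matrix (Fin p) (Fin q) ℝ) :
    frobNorm M ^ 2 = ∑ j, (M.col j) ⬝ᵥ (M.col j) := by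
  rw [frobNorm_sq, Finset.sum_comm]
  simp [dotProduct, sq, Matrix.col]

theorem frobNorm_mul_le_left (M : Matrix (Fin p) (Fin q) ℝ) (N : Matrix (Fin q) (Fin s) ℝ) :
    frobNorm (M * N) ≤ specNorm M * frobNorm N := by
  refine le_of_sq_le_sq ?_ (mul_nonneg (specNorm_nonneg _) (frobNorm_nonneg _))
  rw [mul_pow, frobNorm_sq_eq_sum_col, frobNorm_sq_eq_sum_col, Finset.mul_sum]
  refine Finset.sum_le_sum fun j _ => ?_
  have : (M * N).col j = M.mulVec (N.col j) := by
    ext i; simp [Matrix.col, Matrix.mulVec, Matrix.mul_apply, dotProduct]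
  rw [this]
  exact mulVec_dot_self_le M _

theorem frobNorm_mul_le_right (M : Matrix (Fin p) (Fin q) ℝ) (N : Matrix (Fin q) (Fin s) ℝ) :
    frobNorm (M * N) ≤ frobNorm M * specNorm N := by
  rw [← frobNorm_transpose, Matrix.transpose_mul, mul_comm, ← specNorm_transpose N,
    ← frobNorm_transpose M]
  exact frobNorm_mul_le_left _ _

/-- The trace inner product `⟨X, Y⟩ = tr(Xᵀ Y)`. -/
def ip (X Y : Matrix (Fin p) (Fin q) ℝ) : ℝ := Matrix.trace (X.transpose * Y)

theorem ip_eq_sum (X Y : Matrix (Fin p) (Fin q) ℝ) : ip X Y = ∑ i, ∑ j, X i j * Y i j := by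
  rw [Finset.sum_comm]
  simp [ip, Matrix.trace, Matrix.mul_apply]

theorem ip_comm (X Y : Matrix (Fin p) (Fin q) ℝ) : ip X Y = ip Y X := by
  simp only [ip_eq_sum, mul_comm]

theorem ip_self (X : Matrix (Fin p) (Fin q) ℝ) : ip X X = frobNorm X ^ 2 := by
  rw [ip_eq_sum, frobNorm_sq]; simp only [sq]

theorem ip_add_left (X Y Z : Matrix (Fin p) (Fin q) ℝ) : ip (X + Y) Z = ip X Z + ip Y Z := by
  simp [ip, Matrix.add_mul]

theorem ip_add_right (X Y Z : Matrix (Fin p) (Fin q) ℝ) : ip X (Y + Z) = ip X Y + ip X Z := by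
  simp [ip, Matrix.mul_add]

theorem ip_sub_left (X Y Z : Matrix (Fin p) (Fin q) ℝ) : ip (X - Y) Z = ip X Z - ip Y Z := by
  simp [ip, Matrix.sub_mul]

theorem ip_sub_right (X Y Z : Matrix (Fin p) (Fin q) ℝ) : ip X (Y - Z) = ip X Y - ip X Z := by
  simp [ip, Matrix.mul_sub]

theorem ip_smul_left (c : ℝ) (X Y : Matrix (Fin p) (Fin q) ℝ) : ip (c • X) Y = c * ip X Y := by
  simp [ip]

theorem ip_smul_right (c : ℝ) (X Y : Matrix (Fin p) (Fin q) ℝ) : ip X (c • Y) = c * ip X Y := by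
  simp [ip]

theorem ip_zero_left (Y : Matrix (Fin p) (Fin q) ℝ) : ip 0 Y = 0 := by simp [ip]

theorem ip_zero_right (Y : Matrix (Fin p) (Fin q) ℝ) : ip Y 0 = 0 := by simp [ip]

theorem ip_mul_left (A : Matrix (Fin p) (Fin s) ℝ) (X : Matrix (Fin s) (Fin q) ℝ)
    (Y : Matrix (Fin p) (Fin q) ℝ) : ip (A * X) Y = ip X (A.transpose * Y) := by
  simp [ip, Matrix.mul_assoc]

theorem ip_mul_right (X : Matrix (Fin p) (Fin s) ℝ) (B : Matrix (Fin s) (Fin q) ℝ)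
    (Y : Matrix (Fin p) (Fin q) ℝ) : ip (X * B) Y = ip X (Y * B.transpose) := by
  simp only [ip, Matrix.transpose_mul]
  rw [Matrix.mul_assoc, Matrix.trace_mul_comm, Matrix.mul_assoc]

theorem abs_ip_le (X Y : Matrix (Fin p) (Fin q) ℝ) : |ip X Y| ≤ frobNorm X * frobNorm Y := by
  refine abs_le_of_sq_le_sq ?_ (mul_nonneg (frobNorm_nonneg _) (frobNorm_nonneg _))
  rw [mul_pow, frobNorm_sq, frobNorm_sq, ip_eq_sum]
  simp only [← Finset.sum_product']
  exact Finset.sum_mul_sq_le_sq_mul_sq _ _ _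

/-- The rank-one matrix `w zᵀ`. -/
def outer (w : Fin p → ℝ) (z : Fin q → ℝ) : Matrix (Fin p) (Fin q) ℝ := Matrix.vecMulVec w z

theorem ip_outer (w : Fin p → ℝ) (z : Fin q → ℝ) (X : Matrix (Fin p) (Fin q) ℝ) :
    ip (outer w z) X = w ⬝ᵥ X.mulVec z := by
  simp only [ip_eq_sum, outer, Matrix.vecMulVec_apply, dotProduct, Matrix.mulVec, Finset.mul_sum]
  exact Finset.sum_congr rfl fun i _ => Finset.sum_congr rfl fun j _ => by ring

theorem frobNorm_outer (w : Fin p → ℝ) (z : Fin q → ℝ) :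
    frobNorm (outer w z) ^ 2 = (w ⬝ᵥ w) * (z ⬝ᵥ z) := by
  simp only [frobNorm_sq, outer, Matrix.vecMulVec_apply, dotProduct, Finset.sum_mul_sum]
  exact Finset.sum_congr rfl fun i _ => Finset.sum_congr rfl fun j _ => by ring

theorem rank_outer_le (w : Fin p → ℝ) (z : Fin q → ℝ) : (outer w z).rank ≤ 1 :=
  Matrix.rank_vecMulVec_le w z

theorem dot_self_nonneg (v : Fin p → ℝ) : 0 ≤ v ⬝ᵥ v := by
  simpa using dotProduct_star_self_nonneg v

theorem dot_sq_le (v w : Fin p → ℝ) : (v ⬝ᵥ w) ^ 2 ≤ (v ⬝ᵥ v) * (w ⬝ᵥ w) := by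
  simp only [dotProduct, ← sq]
  exact Finset.sum_mul_sq_le_sq_mul_sq _ _ _

/-- The operator norm is controlled by the bilinear form on unit vectors. -/
theorem specNorm_le_of_forall_outer {M : Matrix (Fin p) (Fin q) ℝ} {c : ℝ} (hc : 0 ≤ c)
    (h : ∀ w z, w ⬝ᵥ w = 1 → z ⬝ᵥ z = 1 → |ip (outer w z) M| ≤ c) : specNorm M ≤ c := by
  refine specNorm_le_of_mulVec hc fun v => ?_
  set u := M.mulVec v with hu
  rcases (dot_self_nonneg u).eq_or_lt with h0 | hu0
  · rw [← h0]; exact mul_nonneg (sq_nonneg c) (dot_self_nonneg v)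
  rcases (dot_self_nonneg v).eq_or_lt with h0 | hv0
  · have := mulVec_dot_self_le M v
    rw [← h0] at this ⊢
    simpa [hu] using this
  have key := h ((Real.sqrt (u ⬝ᵥ u))⁻¹ • u) ((Real.sqrt (v ⬝ᵥ v))⁻¹ • v)
    (by
      rw [smul_dotProduct, dotProduct_smul, smul_eq_mul, smul_eq_mul, ← mul_assoc, ← mul_inv,
        Real.mul_self_sqrt hu0.le, inv_mul_cancel₀ hu0.ne'])
    (by
      rw [smul_dotProduct, dotProduct_smul, smul_eq_mul, smul_eq_mul, ← mul_assoc, ← mul_inv,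
        Real.mul_self_sqrt hv0.le, inv_mul_cancel₀ hv0.ne'])
  rw [ip_outer, Matrix.mulVec_smul, smul_dotProduct, dotProduct_smul, smul_eq_mul, smul_eq_mul,
    ← hu, abs_of_nonneg (by positivity)] at key
  have hsu := Real.sqrt_pos.2 hu0
  have hsv := Real.sqrt_pos.2 hv0
  have e1 := Real.mul_self_sqrt hu0.le
  have e2 := Real.mul_self_sqrt hv0.le
  have : Real.sqrt (u ⬝ᵥ u) ≤ c * Real.sqrt (v ⬝ᵥ v) := by
    have : (Real.sqrt (u ⬝ᵥ u))⁻¹ * ((Real.sqrt (v ⬝ᵥ v))⁻¹ * (u ⬝ᵥ u))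
        = Real.sqrt (u ⬝ᵥ u) / Real.sqrt (v ⬝ᵥ v) := by
      field_simp; linarith
    rw [this, div_le_iff₀ hsv] at key
    exact key
  calc u ⬝ᵥ u = Real.sqrt (u ⬝ᵥ u) ^ 2 := by rw [sq, e1]
    _ ≤ (c * Real.sqrt (v ⬝ᵥ v)) ^ 2 := pow_le_pow_left₀ hsu.le this 2
    _ = c ^ 2 * (v ⬝ᵥ v) := by rw [mul_pow, sq (Real.sqrt _), e2]

theorem abs_ip_outer_le (M : Matrix (Fin p) (Fin q) ℝ) {w : Fin p → ℝ} {z : Fin q → ℝ}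
    (hw : w ⬝ᵥ w = 1) (hz : z ⬝ᵥ z = 1) : |ip (outer w z) M| ≤ specNorm M := by
  refine abs_le_of_sq_le_sq ?_ (specNorm_nonneg M)
  rw [ip_outer]
  refine (dot_sq_le _ _).trans ?_
  have := mulVec_dot_self_le M z
  rw [hw, one_mul]
  rwa [hz, mul_one] at this

theorem frobNorm_outer_unit {w : Fin p → ℝ} {z : Fin q → ℝ}
    (hw : w ⬝ᵥ w = 1) (hz : z ⬝ᵥ z = 1) : frobNorm (outer w z) = 1 := by
  have := frobNorm_outer w z
  rw [hw, hz, mul_one] at this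
  exact (pow_eq_one_iff_of_nonneg (frobNorm_nonneg _) two_ne_zero).1 this

theorem specNorm_le_frobNorm (M : Matrix (Fin p) (Fin q) ℝ) : specNorm M ≤ frobNorm M := by
  refine specNorm_le_of_forall_outer (frobNorm_nonneg _) fun w z hw hz => ?_
  have := abs_ip_le (outer w z) M
  rwa [frobNorm_outer_unit hw hz, one_mul] at this

/-- A norm on matrices that is monotone under multiplication by contractions. -/
structure IsIdealNorm (N : Matrix (Fin p) (Fin q) ℝ → ℝ) : Prop where
  add_le : ∀ X Y, N (X + Y) ≤ N X + N Y
  smul : ∀ (c : ℝ) X, N (c • X) = |c| * N X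
  mul_left : ∀ (A : Matrix (Fin p) (Fin p) ℝ) X, N (A * X) ≤ specNorm A * N X
  mul_right : ∀ X (B : Matrix (Fin q) (Fin q) ℝ), N (X * B) ≤ N X * specNorm B

theorem isIdealNorm_frobNorm : IsIdealNorm (frobNorm : Matrix (Fin p) (Fin q) ℝ → ℝ) :=
  ⟨frobNorm_add_le, frobNorm_smul, frobNorm_mul_le_left, frobNorm_mul_le_right⟩

theorem isIdealNorm_specNorm : IsIdealNorm (specNorm : Matrix (Fin p) (Fin q) ℝ → ℝ) :=
  ⟨specNorm_add_le, specNorm_smul, specNorm_mul_le, specNorm_mul_le⟩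

namespace IsIdealNorm
variable {N : Matrix (Fin p) (Fin q) ℝ → ℝ}

theorem neg (hN : IsIdealNorm N) (X : Matrix (Fin p) (Fin q) ℝ) : N (-X) = N X := by
  have := hN.smul (-1) X
  simpa using this

theorem sub_le (hN : IsIdealNorm N) (X Y : Matrix (Fin p) (Fin q) ℝ) : N (X - Y) ≤ N X + N Y := by
  rw [sub_eq_add_neg, ← hN.neg Y]; exact hN.add_le _ _

theorem nonneg (hN : IsIdealNorm N) (X : Matrix (Fin p) (Fin q) ℝ) : 0 ≤ N X := by
  have h0 : N (0 : Matrix (Fin p) (Fin q) ℝ) = 0 := by simpa using hN.smul 0 0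
  have := hN.sub_le X X
  rw [sub_self, h0] at this
  linarith

end IsIdealNorm

end NormBasics

/-! ### Orthogonal projections. -/

section Projections

variable {p : ℕ}

/-- Orthogonal projection matrices. -/
structure IsProj (P : Matrix (Fin p) (Fin p) ℝ) : Prop where
  symm : P.transpose = P
  idem : P * P = P

theorem IsProj.compl {P : Matrix (Fin p) (Fin p) ℝ} (h : IsProj P) : IsProj (1 - P) :=
  ⟨by simp [h.symm], by simp [Matrix.mul_sub, Matrix.sub_mul, h.idem]⟩

theorem specNorm_le_one_of_transpose_mul_self {q : ℕ} {U : Matrix (Fin p) (Fin q) ℝ}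
    (h : U.transpose * U = 1) : specNorm U ≤ 1 := by
  refine specNorm_le_of_mulVec zero_le_one fun v => ?_
  have : U.mulVec v ⬝ᵥ U.mulVec v = v ⬝ᵥ v := by
    rw [Matrix.dotProduct_mulVec, Matrix.vecMul_mulVec, h, Matrix.vecMul_one]
  rw [this]; simp

/-- A reflection is orthogonal. The contraction of the tangent step rests on this bound, since a
bound on P alone would lose a constant. -/
theorem IsProj.specNorm_reflection_le {P : Matrix (Fin p) (Fin p) ℝ} (h : IsProj P) :
    specNorm (2 • P - 1) ≤ 1 := by
  refine specNorm_le_one_of_transpose_mul_self ?_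
  simp [Matrix.mul_sub, Matrix.sub_mul, h.idem, h.symm, two_smul, Matrix.mul_add, Matrix.add_mul]

theorem IsProj.specNorm_le_one {P : Matrix (Fin p) (Fin p) ℝ} (h : IsProj P) :
    specNorm P ≤ 1 := by
  have e : P = (1 / 2 : ℝ) • ((2 • P - 1) + 1) := by
    simp [← Nat.cast_smul_eq_nsmul ℝ, smul_smul]
  rw [e, specNorm_smul, abs_of_pos (by norm_num)]
  have := specNorm_add_le (2 • P - 1) 1
  have := h.specNorm_reflection_le
  have := specNorm_one_le (p := p)
  linarith

end Projections

/-! ### Moore–Penrose pseudo-inverses as a predicate. -/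

section PseudoInverse

variable {p q : ℕ}

/-- `Z` is the Moore–Penrose pseudo-inverse of `X`. -/
structure IsPinv (X : Matrix (Fin p) (Fin q) ℝ) (Z : Matrix (Fin q) (Fin p) ℝ) : Prop where
  mul_mul_self : X * Z * X = X
  self_mul_mul : Z * X * Z = Z
  left_symm : (X * Z).transpose = X * Z
  right_symm : (Z * X).transpose = Z * X

variable {X Y : Matrix (Fin p) (Fin q) ℝ} {Z Z' : Matrix (Fin q) (Fin p) ℝ}

theorem IsPinv.transpose (h : IsPinv X Z) : IsPinv X.transpose Z.transpose where
  mul_mul_self := by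
    rw [← Matrix.transpose_mul, ← Matrix.transpose_mul, ← Matrix.mul_assoc, h.mul_mul_self]
  self_mul_mul := by
    rw [← Matrix.transpose_mul, ← Matrix.transpose_mul, ← Matrix.mul_assoc, h.self_mul_mul]
  left_symm := by rw [← Matrix.transpose_mul, h.right_symm, h.right_symm]
  right_symm := by rw [← Matrix.transpose_mul, h.left_symm, h.left_symm]

theorem IsPinv.projL (h : IsPinv X Z) : IsProj (X * Z) :=
  ⟨h.left_symm, by rw [← Matrix.mul_assoc, h.mul_mul_self]⟩

theorem IsPinv.projR (h : IsPinv X Z) : IsProj (Z * X) :=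
  ⟨h.right_symm, by rw [← Matrix.mul_assoc, h.self_mul_mul]⟩

theorem IsPinv.unique (h : IsPinv X Z) (h' : IsPinv X Z') : Z = Z' := by
  have e1 : X * Z = X * Z' := by
    have a : X * Z = (X * Z') * (X * Z) := by rw [← Matrix.mul_assoc, h'.mul_mul_self]
    have b := congrArg Matrix.transpose a
    rw [Matrix.transpose_mul (X * Z'), h.left_symm, h'.left_symm, ← Matrix.mul_assoc, h.mul_mul_self] at b
    exact b
  have e2 : Z * X = Z' * X := by
    have a : Z * X = (Z * X) * (Z' * X) := by
      rw [Matrix.mul_assoc, ← Matrix.mul_assoc X, h'.mul_mul_self]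
    have b := congrArg Matrix.transpose a
    rw [Matrix.transpose_mul (Z * X), h.right_symm, h'.right_symm, Matrix.mul_assoc, ← Matrix.mul_assoc X,
      h.mul_mul_self] at b
    exact b
  calc Z = Z * X * Z := h.self_mul_mul.symm
    _ = Z' * X * Z' := by rw [e2, Matrix.mul_assoc, e1, Matrix.mul_assoc]
    _ = Z' := h'.self_mul_mul

theorem IsPinv.compl_mul (h : IsPinv X Z) : (1 - X * Z) * X = 0 := by
  rw [Matrix.sub_mul, Matrix.one_mul, h.mul_mul_self, sub_self]

theorem IsPinv.mul_compl (h : IsPinv X Z) : X * (1 - Z * X) = 0 := by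
  rw [Matrix.mul_sub, Matrix.mul_one, ← Matrix.mul_assoc, h.mul_mul_self, sub_self]

end PseudoInverse

/-! ### One step of the product recursion and its error in an ideal norm. -/

section Steps

variable {p q : ℕ}

/-- Removing from `D` a step along the tangent space contracts every ideal norm, up to the
component of `D` that is normal to the tangent space. -/
theorem IsIdealNorm.tangent_step {N : Matrix (Fin p) (Fin q) ℝ → ℝ} (hN : IsIdealNorm N)
    {P : Matrix (Fin p) (Fin p) ℝ} {R : Matrix (Fin q) (Fin q) ℝ} (hP : IsProj P) (hR : IsProj R)
    (D : Matrix (Fin p) (Fin q) ℝ) {μ : ℝ} (h0 : 0 ≤ μ) (h1 : μ ≤ 1 / 2) :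
    N (D - μ • (P * D + D * R)) ≤ (1 - μ) * N D + 2 * μ * N ((1 - P) * D * (1 - R)) := by
  -- Expanding (2P − 1)D(2R − 1) isolates the normal part of D. The first two terms together have
  -- norm at most (1 − 2μ) + (μ/2)·2 = 1 − μ times that of D.
  have e : D - μ • (P * D + D * R) = (1 - 2 * μ) • D +
      (μ / 2) • (D - (2 • P - 1) * D * (2 • R - 1)) + (2 * μ) • ((1 - P) * D * (1 - R)) := by
    simp only [two_smul, Matrix.mul_add, Matrix.add_mul, Matrix.mul_sub, Matrix.sub_mul,
      Matrix.mul_one, Matrix.one_mul]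
    module
  have s1 : N ((2 • P - 1) * D * (2 • R - 1)) ≤ N D := by
    have a := hN.mul_right ((2 • P - 1) * D) (2 • R - 1)
    have b := hN.mul_left (2 • P - 1) D
    have c : N ((2 • P - 1) * D) ≤ N D :=
      b.trans (mul_le_of_le_one_left (hN.nonneg _) hP.specNorm_reflection_le)
    exact (a.trans (mul_le_of_le_one_right (hN.nonneg _) hR.specNorm_reflection_le)).trans c
  have s2 := hN.sub_le D ((2 • P - 1) * D * (2 • R - 1))
  rw [e]
  refine (hN.add_le _ _).trans ((add_le_add_left (hN.add_le _ _) _).trans ?_)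
  rw [hN.smul, hN.smul, hN.smul, abs_of_nonneg (by linarith), abs_of_nonneg (by linarith),
    abs_of_nonneg (by linarith)]
  nlinarith [hN.nonneg D]

/-- The normal component of a difference of matrices is of second order. -/
theorem IsIdealNorm.normal_le {N : Matrix (Fin p) (Fin q) ℝ → ℝ} (hN : IsIdealNorm N)
    {X Y : Matrix (Fin p) (Fin q) ℝ} {Z Zy : Matrix (Fin q) (Fin p) ℝ}
    (hX : IsPinv X Z) (hY : Y * Zy * Y = Y) :
    N ((1 - X * Z) * (X - Y) * (1 - Z * X)) ≤
      N (X - Y) * (specNorm Zy * specNorm (X - Y)) := by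
  -- The outer projections kill X, so only Y = Y Zy Y is seen, and each of its two outer copies of Y
  -- may be replaced by −(X − Y). This produces the quadratic order.
  have e : (1 - X * Z) * (X - Y) * (1 - Z * X)
      = -((1 - X * Z) * ((X - Y) * (Zy * (X - Y) * (1 - Z * X)))) := by
    have a : (1 - X * Z) * (X - Y) = - ((1 - X * Z) * Y) := by
      rw [Matrix.mul_sub, hX.compl_mul, zero_sub]
    have b : (X - Y) * (1 - Z * X) = - (Y * (1 - Z * X)) := by
      rw [Matrix.sub_mul, hX.mul_compl, zero_sub]
    calc (1 - X * Z) * (X - Y) * (1 - Z * X)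
        = -((1 - X * Z) * (Y * Zy * Y) * (1 - Z * X)) := by rw [a, hY, Matrix.neg_mul]
      _ = -(-((1 - X * Z) * Y) * Zy * -(Y * (1 - Z * X))) := by
          simp only [Matrix.neg_mul, Matrix.mul_neg, Matrix.mul_assoc, neg_neg]
      _ = _ := by rw [← a, ← b]; simp only [Matrix.mul_assoc]
  rw [e, hN.neg]
  have h1 := hN.mul_left (1 - X * Z) ((X - Y) * (Zy * (X - Y) * (1 - Z * X)))
  have h2 := hN.mul_right (X - Y) (Zy * (X - Y) * (1 - Z * X))
  have h3 : specNorm (Zy * (X - Y) * (1 - Z * X)) ≤ specNorm Zy * specNorm (X - Y) := by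
    refine (specNorm_mul_le _ _).trans ?_
    exact (mul_le_of_le_one_right (specNorm_nonneg _) hX.projR.compl.specNorm_le_one).trans
      (specNorm_mul_le _ _)
  refine h1.trans ((mul_le_of_le_one_left (hN.nonneg _)
    hX.projL.compl.specNorm_le_one).trans (h2.trans ?_))
  exact mul_le_mul_of_nonneg_left h3 (hN.nonneg _)

/-- One step of scaled gradient descent on the product `X`, where `Z` is the pseudo-inverse of `X`
and `G` the negative gradient. -/
def stepMap (μ : ℝ) (X : Matrix (Fin p) (Fin q) ℝ) (Z : Matrix (Fin q) (Fin p) ℝ)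
    (G : Matrix (Fin p) (Fin q) ℝ) : Matrix (Fin p) (Fin q) ℝ :=
  (1 + μ • (G * Z)) * X * (1 + μ • (Z * G))

/-- Because Z X Z = Z, the cubic-looking product collapses: the linear term consists of projections
of G, and the remainder is G Z G. -/
theorem IsPinv.stepMap_eq {X : Matrix (Fin p) (Fin q) ℝ} {Z : Matrix (Fin q) (Fin p) ℝ}
    (h : IsPinv X Z) (μ : ℝ) (G : Matrix (Fin p) (Fin q) ℝ) :
    stepMap μ X Z G = X + μ • (X * Z * G + G * (Z * X)) + μ ^ 2 • (G * Z * G) := by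
  have e : G * (Z * (X * (Z * G))) = G * (Z * G) := by
    rw [← Matrix.mul_assoc X, ← Matrix.mul_assoc Z, ← Matrix.mul_assoc Z, h.self_mul_mul]
  simp only [stepMap, Matrix.mul_add, Matrix.add_mul, Matrix.mul_one, Matrix.one_mul,
    Matrix.smul_mul, Matrix.mul_smul, Matrix.mul_assoc, e]
  module

/-- Inserting Z = Z X Z puts the low-rank projection Z X next to G, so that the perturbation inside
G need only be estimated after projection, where restricted isometry applies. -/
theorem IsPinv.mul_Z_mul {X G G' : Matrix (Fin p) (Fin q) ℝ} {Z : Matrix (Fin q) (Fin p) ℝ}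
    (h : IsPinv X Z) : G * Z * G' = G * (Z * X) * (Z * G') := by
  calc G * Z * G' = G * (Z * X * Z) * G' := by rw [h.self_mul_mul]
    _ = _ := by simp only [Matrix.mul_assoc]

/-- One-step error bound for scaled gradient descent in an ideal norm. -/
theorem IsIdealNorm.error_step {N : Matrix (Fin p) (Fin q) ℝ → ℝ} (hN : IsIdealNorm N)
    {X Xs H : Matrix (Fin p) (Fin q) ℝ} {Z Zs : Matrix (Fin q) (Fin p) ℝ} {μ : ℝ}
    (hX : IsPinv X Z) (hXs : Xs * Zs * Xs = Xs) (h0 : 0 ≤ μ) (h1 : μ ≤ 1 / 2) :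
    N (stepMap μ X Z (-((X - Xs) + H)) - Xs) ≤
      (1 - μ) * N (X - Xs) + 2 * μ * (N (X - Xs) * (specNorm Zs * specNorm (X - Xs)))
      + μ * (N (X * Z * H) + N (H * (Z * X)))
      + μ ^ 2 * ((N (X - Xs) + N (H * (Z * X))) *
          (specNorm Z * (specNorm (X - Xs) + specNorm H))) := by
  set D := X - Xs with hD
  set G := -(D + H) with hG
  have e : stepMap μ X Z G - Xs = (D - μ • (X * Z * D + D * (Z * X)))
      + (-μ) • (X * Z * H + H * (Z * X)) + μ ^ 2 • (G * (Z * X) * (Z * G)) := by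
    rw [hX.stepMap_eq, hX.mul_Z_mul (G := G)]
    have : X = D + Xs := by rw [hD]; abel
    have e1 : X * Z * G + G * (Z * X) = - (X * Z * D + D * (Z * X)) - (X * Z * H + H * (Z * X)) := by
      rw [hG]; simp only [Matrix.mul_neg, Matrix.neg_mul, Matrix.mul_add, Matrix.add_mul]; abel
    rw [e1, hD]
    module
  have t1 := hN.tangent_step hX.projL hX.projR D h0 h1
  have t2 := hN.normal_le hX hXs
  rw [← hD] at t2
  have t3 := hN.add_le (X * Z * H) (H * (Z * X))
  have t4 : N (G * (Z * X)) ≤ N D + N (H * (Z * X)) := by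
    have : G * (Z * X) = -(D * (Z * X) + H * (Z * X)) := by rw [hG, Matrix.neg_mul, Matrix.add_mul]
    rw [this, hN.neg]
    refine (hN.add_le _ _).trans (add_le_add_left ?_ _)
    exact (hN.mul_right _ _).trans
      (mul_le_of_le_one_right (hN.nonneg _) hX.projR.specNorm_le_one)
  have t5 : specNorm (Z * G) ≤ specNorm Z * (specNorm D + specNorm H) := by
    refine (specNorm_mul_le _ _).trans (mul_le_mul_of_nonneg_left ?_ (specNorm_nonneg _))
    rw [hG, specNorm_neg]; exact specNorm_add_le _ _
  have t6 : N (G * (Z * X) * (Z * G)) ≤ (N D + N (H * (Z * X))) *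
      (specNorm Z * (specNorm D + specNorm H)) :=
    (hN.mul_right _ _).trans (mul_le_mul t4 t5 (specNorm_nonneg _)
      (add_nonneg (hN.nonneg _) (hN.nonneg _)))
  rw [e]
  refine (hN.add_le _ _).trans ((add_le_add_left (hN.add_le _ _) _).trans ?_)
  rw [hN.smul, hN.smul, abs_neg, abs_of_nonneg h0, abs_of_nonneg (sq_nonneg μ)]
  have := mul_le_mul_of_nonneg_left t2 (by linarith : 0 ≤ 2 * μ)
  have := mul_le_mul_of_nonneg_left t3 h0
  have := mul_le_mul_of_nonneg_left t6 (sq_nonneg μ)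
  linarith

end Steps

/-! ### Perturbation of projections, pseudo-inverses and of the step. -/

section Perturbation

variable {p q : ℕ} {X Y : Matrix (Fin p) (Fin q) ℝ} {Z Zy : Matrix (Fin q) (Fin p) ℝ}

/-- The two products are transposes of each other; this lets the roles of X and Y be exchanged in
the perturbation bounds. -/
theorem frobNorm_compl_mul_le {P P' : Matrix (Fin p) (Fin p) ℝ} (hP : IsProj P) (hP' : IsProj P') :
    frobNorm (P * (1 - P')) = frobNorm ((1 - P') * P) := by
  rw [← frobNorm_transpose, Matrix.transpose_mul, hP.symm, hP'.compl.symm]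

theorem frobNorm_transpose_mul_proj {P : Matrix (Fin p) (Fin p) ℝ} (hP : IsProj P)
    (M : Matrix (Fin p) (Fin q) ℝ) : frobNorm (M.transpose * P) = frobNorm (P * M) := by
  rw [← frobNorm_transpose, Matrix.transpose_mul, hP.symm, Matrix.transpose_transpose]

theorem IsPinv.frobNorm_compl_mul_proj_le (hX : IsPinv X Z) (Y : Matrix (Fin p) (Fin q) ℝ)
    (Zy : Matrix (Fin q) (Fin p) ℝ) :
    frobNorm ((1 - X * Z) * (Y * Zy)) ≤ frobNorm (X - Y) * specNorm Zy := by
  have e : (1 - X * Z) * (Y * Zy) = -((1 - X * Z) * ((X - Y) * Zy)) := by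
    rw [Matrix.sub_mul X Y, Matrix.mul_sub, ← Matrix.mul_assoc _ X, hX.compl_mul, Matrix.zero_mul,
      zero_sub, neg_neg]
  rw [e, frobNorm_neg]
  refine (frobNorm_mul_le_left _ _).trans ?_
  exact (mul_le_of_le_one_left (frobNorm_nonneg _) hX.projL.compl.specNorm_le_one).trans
    (frobNorm_mul_le_right _ _)

theorem frobNorm_sub_comm (X Y : Matrix (Fin p) (Fin q) ℝ) :
    frobNorm (X - Y) = frobNorm (Y - X) := by
  rw [← frobNorm_neg, neg_sub]

theorem IsPinv.frobNorm_projL_sub_le (hX : IsPinv X Z) (hY : IsPinv Y Zy) {ζ : ℝ}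
    (hZ : specNorm Z ≤ ζ) (hZy : specNorm Zy ≤ ζ) :
    frobNorm (X * Z - Y * Zy) ≤ 2 * ζ * frobNorm (X - Y) := by
  have e : X * Z - Y * Zy = X * Z * (1 - Y * Zy) - (1 - X * Z) * (Y * Zy) := by
    simp only [Matrix.mul_sub, Matrix.sub_mul, Matrix.mul_one, Matrix.one_mul]; abel
  have a := hX.frobNorm_compl_mul_proj_le Y Zy
  have b := hY.frobNorm_compl_mul_proj_le X Z
  rw [← frobNorm_compl_mul_le hX.projL hY.projL, frobNorm_sub_comm] at b
  rw [e]
  refine (frobNorm_sub_le _ _).trans ?_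
  nlinarith [frobNorm_nonneg (X - Y)]

theorem IsPinv.frobNorm_projR_sub_le (hX : IsPinv X Z) (hY : IsPinv Y Zy) {ζ : ℝ}
    (hZ : specNorm Z ≤ ζ) (hZy : specNorm Zy ≤ ζ) :
    frobNorm (Z * X - Zy * Y) ≤ 2 * ζ * frobNorm (X - Y) := by
  have := hX.transpose.frobNorm_projL_sub_le hY.transpose (ζ := ζ)
    (by rwa [specNorm_transpose]) (by rwa [specNorm_transpose])
  rwa [← Matrix.transpose_mul, ← Matrix.transpose_mul, ← Matrix.transpose_sub,
    ← Matrix.transpose_sub, frobNorm_transpose, frobNorm_transpose] at this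

theorem IsPinv.frobNorm_pinv_sub_le (hX : IsPinv X Z) (hY : IsPinv Y Zy) {ζ : ℝ}
    (hZ : specNorm Z ≤ ζ) (hZy : specNorm Zy ≤ ζ) :
    frobNorm (Z - Zy) ≤ 3 * ζ ^ 2 * frobNorm (X - Y) := by
  have hζ : 0 ≤ ζ := (specNorm_nonneg _).trans hZ
  -- Wedin's three-term decomposition of a difference of pseudo-inverses; each term contains X − Y
  -- or a difference of projections, and costs ζ² times the distance.
  have e : Z - Zy = -(Z * ((X - Y) * Zy)) + Z * (X * Z * (1 - Y * Zy))
      - (1 - Z * X) * (Zy * Y) * Zy := by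
    have e1 : Z * (X * Z * (1 - Y * Zy)) = Z - Z * (Y * Zy) := by
      rw [← Matrix.mul_assoc, ← Matrix.mul_assoc, hX.self_mul_mul, Matrix.mul_sub, Matrix.mul_one]
    have e2 : (1 - Z * X) * (Zy * Y) * Zy = Zy - Z * (X * Zy) := by
      rw [Matrix.mul_assoc, hY.self_mul_mul, Matrix.sub_mul, Matrix.one_mul, Matrix.mul_assoc]
    rw [e1, e2, Matrix.sub_mul, Matrix.mul_sub]
    abel
  have a := hX.transpose.frobNorm_compl_mul_proj_le Y.transpose Zy.transpose
  have b := hY.frobNorm_compl_mul_proj_le X Z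
  rw [← frobNorm_compl_mul_le hX.projL hY.projL, frobNorm_sub_comm] at b
  rw [← Matrix.transpose_mul, ← Matrix.transpose_mul, ← Matrix.transpose_sub, frobNorm_transpose,
    specNorm_transpose, hX.right_symm, hY.right_symm] at a
  have d0 := frobNorm_nonneg (X - Y)
  have t1 : frobNorm (Z * ((X - Y) * Zy)) ≤ ζ * (frobNorm (X - Y) * ζ) :=
    (frobNorm_mul_le_left _ _).trans (mul_le_mul hZ ((frobNorm_mul_le_right _ _).trans
      (mul_le_mul_of_nonneg_left hZy d0)) (frobNorm_nonneg _) hζ)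
  have t2 : frobNorm (Z * (X * Z * (1 - Y * Zy))) ≤ ζ * (frobNorm (X - Y) * ζ) :=
    (frobNorm_mul_le_left _ _).trans (mul_le_mul hZ (b.trans
      (mul_le_mul_of_nonneg_left hZ d0)) (frobNorm_nonneg _) hζ)
  have t3 : frobNorm ((1 - Z * X) * (Zy * Y) * Zy) ≤ (frobNorm (X - Y) * ζ) * ζ :=
    (frobNorm_mul_le_right _ _).trans (mul_le_mul (a.trans
      (mul_le_mul_of_nonneg_left hZy d0)) hZy (specNorm_nonneg _) (mul_nonneg d0 hζ))
  rw [e]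
  refine (frobNorm_sub_le _ _).trans ((add_le_add_left (frobNorm_add_le _ _) _).trans ?_)
  rw [frobNorm_neg]
  nlinarith

/-- Stability of one step of scaled gradient descent in the Frobenius norm. -/
theorem IsPinv.stepMap_sub_le (hX : IsPinv X Z) (hY : IsPinv Y Zy)
    {K Gx Gy : Matrix (Fin p) (Fin q) ℝ} (hG : Gx - Gy = -((X - Y) + K)) {μ ζ g k : ℝ}
    (h0 : 0 ≤ μ) (h1 : μ ≤ 1 / 2) (hZ : specNorm Z ≤ ζ) (hZy : specNorm Zy ≤ ζ)
    (hGx : specNorm Gx ≤ g) (hGy : specNorm Gy ≤ g)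
    (hk1 : frobNorm (X * Z * K) ≤ k) (hk2 : frobNorm (K * (Z * X)) ≤ k)
    (hk3 : frobNorm (Y * Zy * K) ≤ k) :
    frobNorm (stepMap μ X Z Gx - stepMap μ Y Zy Gy) ≤
      (1 - μ) * frobNorm (X - Y) + 2 * μ * (frobNorm (X - Y) * (ζ * frobNorm (X - Y)))
      + μ * (2 * k) + μ * (4 * ζ * frobNorm (X - Y) * g)
      + μ ^ 2 * (2 * ((frobNorm (X - Y) + k) * (ζ * g)) +
          3 * ζ ^ 2 * frobNorm (X - Y) * g ^ 2) := by
  set D := X - Y with hD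
  have hζ : 0 ≤ ζ := (specNorm_nonneg _).trans hZ
  have hg : 0 ≤ g := (specNorm_nonneg _).trans hGx
  have hk : 0 ≤ k := (frobNorm_nonneg _).trans hk1
  have d0 := frobNorm_nonneg D
  have hGx' : Gx = Gy - (D + K) := by rw [sub_eq_add_neg, ← hG]; abel
  -- The difference is sorted into a contracting tangent step on D, the mismatch K of the operators,
  -- the change of the projections acting on Gy, and the telescoped quadratic terms. K always occurs
  -- next to a projection of X or Y.
  have e : stepMap μ X Z Gx - stepMap μ Y Zy Gy = (D - μ • (X * Z * D + D * (Z * X)))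
      + (-μ) • (X * Z * K + K * (Z * X))
      + μ • ((X * Z - Y * Zy) * Gy + Gy * (Z * X - Zy * Y))
      + μ ^ 2 • (-((D + K) * (Z * X) * (Z * Gx)) + Gy * (Z - Zy) * Gx
        - Gy * (Zy * (Y * Zy * (D + K)))) := by
    rw [hX.stepMap_eq, hY.stepMap_eq]
    have a1 : X * Z * Gx + Gx * (Z * X) - (Y * Zy * Gy + Gy * (Zy * Y)) =
        -(X * Z * D + D * (Z * X)) - (X * Z * K + K * (Z * X)) +
        ((X * Z - Y * Zy) * Gy + Gy * (Z * X - Zy * Y)) := by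
      rw [hGx']
      simp only [Matrix.mul_sub, Matrix.sub_mul, Matrix.mul_add, Matrix.add_mul]; abel
    have a2 : Gx * Z * Gx - Gy * Zy * Gy = -((D + K) * (Z * X) * (Z * Gx)) + Gy * (Z - Zy) * Gx
        - Gy * (Zy * (Y * Zy * (D + K))) := by
      rw [← hX.mul_Z_mul, ← Matrix.mul_assoc Zy, ← Matrix.mul_assoc Zy, hY.self_mul_mul]
      have : D + K = Gy - Gx := by rw [hGx']; abel
      rw [this]
      simp only [Matrix.mul_sub, Matrix.sub_mul, ← Matrix.mul_assoc]; abel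
    rw [← a2]
    have : X + μ • (X * Z * Gx + Gx * (Z * X)) + μ ^ 2 • (Gx * Z * Gx) -
        (Y + μ • (Y * Zy * Gy + Gy * (Zy * Y)) + μ ^ 2 • (Gy * Zy * Gy)) =
        D + μ • (X * Z * Gx + Gx * (Z * X) - (Y * Zy * Gy + Gy * (Zy * Y)))
        + μ ^ 2 • (Gx * Z * Gx - Gy * Zy * Gy) := by rw [hD]; module
    rw [this, a1]
    module
  have t1 := isIdealNorm_frobNorm.tangent_step hX.projL hX.projR D h0 h1
  have t2 := isIdealNorm_frobNorm.normal_le hX hY.mul_mul_self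
  rw [← hD] at t2
  have t2' : frobNorm ((1 - X * Z) * D * (1 - Z * X)) ≤ frobNorm D * (ζ * frobNorm D) :=
    t2.trans (mul_le_mul_of_nonneg_left (mul_le_mul hZy (specNorm_le_frobNorm _)
      (specNorm_nonneg _) hζ) d0)
  have t3 : frobNorm (X * Z * K + K * (Z * X)) ≤ 2 * k := by
    linarith [frobNorm_add_le (X * Z * K) (K * (Z * X))]
  have t4 : frobNorm ((X * Z - Y * Zy) * Gy + Gy * (Z * X - Zy * Y)) ≤ 4 * ζ * frobNorm D * g := by
    have a := hX.frobNorm_projL_sub_le hY hZ hZy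
    have b := hX.frobNorm_projR_sub_le hY hZ hZy
    have a' : frobNorm ((X * Z - Y * Zy) * Gy) ≤ (2 * ζ * frobNorm D) * g :=
      (frobNorm_mul_le_right _ _).trans (mul_le_mul a hGy (specNorm_nonneg _) (by positivity))
    have b' : frobNorm (Gy * (Z * X - Zy * Y)) ≤ g * (2 * ζ * frobNorm D) :=
      (frobNorm_mul_le_left _ _).trans (mul_le_mul hGy b (frobNorm_nonneg _) hg)
    refine (frobNorm_add_le _ _).trans ?_
    linarith
  have s1 : frobNorm ((D + K) * (Z * X)) ≤ frobNorm D + k := by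
    rw [Matrix.add_mul]
    refine (frobNorm_add_le _ _).trans (add_le_add ?_ hk2)
    exact (frobNorm_mul_le_right _ _).trans
      (mul_le_of_le_one_right d0 hX.projR.specNorm_le_one)
  have s2 : frobNorm (Y * Zy * (D + K)) ≤ frobNorm D + k := by
    rw [Matrix.mul_add]
    refine (frobNorm_add_le _ _).trans (add_le_add ?_ hk3)
    exact (frobNorm_mul_le_left _ _).trans
      (mul_le_of_le_one_left d0 hY.projL.specNorm_le_one)
  have s1' : frobNorm ((D + K) * (Z * X) * (Z * Gx)) ≤ (frobNorm D + k) * (ζ * g) :=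
    (frobNorm_mul_le_right _ _).trans (mul_le_mul s1 ((specNorm_mul_le _ _).trans
      (mul_le_mul hZ hGx (specNorm_nonneg _) hζ)) (specNorm_nonneg _) (by positivity))
  have s2' : frobNorm (Gy * (Zy * (Y * Zy * (D + K)))) ≤ g * (ζ * (frobNorm D + k)) :=
    (frobNorm_mul_le_left _ _).trans (mul_le_mul hGy ((frobNorm_mul_le_left _ _).trans
      (mul_le_mul hZy s2 (frobNorm_nonneg _) hζ)) (frobNorm_nonneg _) hg)
  have s3 : frobNorm (Gy * (Z - Zy) * Gx) ≤ g * (3 * ζ ^ 2 * frobNorm D) * g :=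
    (frobNorm_mul_le_right _ _).trans (mul_le_mul ((frobNorm_mul_le_left _ _).trans
      (mul_le_mul hGy (hX.frobNorm_pinv_sub_le hY hZ hZy) (frobNorm_nonneg _) hg)) hGx
      (specNorm_nonneg _) (by positivity))
  have t5 : frobNorm (-((D + K) * (Z * X) * (Z * Gx)) + Gy * (Z - Zy) * Gx
        - Gy * (Zy * (Y * Zy * (D + K)))) ≤ 2 * ((frobNorm D + k) * (ζ * g)) +
          3 * ζ ^ 2 * frobNorm D * g ^ 2 := by
    refine (frobNorm_sub_le _ _).trans ((add_le_add_left (frobNorm_add_le _ _) _).trans ?_)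
    rw [frobNorm_neg]
    linarith
  rw [e]
  refine (frobNorm_add_le _ _).trans ((add_le_add_left ((frobNorm_add_le _ _).trans
    (add_le_add_left (frobNorm_add_le _ _) _)) _).trans ?_)
  rw [frobNorm_smul, frobNorm_smul, frobNorm_smul, abs_neg, abs_of_nonneg h0,
    abs_of_nonneg (sq_nonneg μ)]
  have := mul_le_mul_of_nonneg_left t2' (by linarith : 0 ≤ 2 * μ)
  have := mul_le_mul_of_nonneg_left t3 h0
  have := mul_le_mul_of_nonneg_left t4 h0
  have := mul_le_mul_of_nonneg_left t5 (sq_nonneg μ)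
  linarith

end Perturbation

/-! ### Stability of truncated singular value decompositions. -/

section Truncation

variable {p q : ℕ}

/-- `X`, with pseudo-inverse `Z`, is a truncated singular value decomposition of `M`: the row and
column spaces of `X` are spanned by singular vectors of `M`. -/
structure IsTrunc (M X : Matrix (Fin p) (Fin q) ℝ) (Z : Matrix (Fin q) (Fin p) ℝ) : Prop where
  pinv : IsPinv X Z
  projL_mul : X * Z * M = X
  mul_projR : M * (Z * X) = X

variable {M M' X Y : Matrix (Fin p) (Fin q) ℝ} {Z Zy : Matrix (Fin q) (Fin p) ℝ}

theorem IsTrunc.transpose (h : IsTrunc M X Z) :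
    IsTrunc M.transpose X.transpose Z.transpose where
  pinv := h.pinv.transpose
  projL_mul := by
    rw [← Matrix.transpose_mul, h.pinv.right_symm, ← h.pinv.right_symm, ← Matrix.transpose_mul,
      h.mul_projR]
  mul_projR := by
    rw [← Matrix.transpose_mul, h.pinv.left_symm, ← h.pinv.left_symm, ← Matrix.transpose_mul,
      h.projL_mul]

theorem IsTrunc.compl_mul (h : IsTrunc M X Z) : (1 - X * Z) * M = M - X := by
  rw [Matrix.sub_mul, Matrix.one_mul, h.projL_mul]

theorem IsTrunc.mul_compl (h : IsTrunc M X Z) : M * (1 - Z * X) = M - X := by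
  rw [Matrix.mul_sub, Matrix.mul_one, h.mul_projR]

theorem IsTrunc.residual_mul_compl (h : IsTrunc M X Z) : (M - X) * (1 - Z * X) = M - X := by
  rw [Matrix.sub_mul, h.mul_compl, h.pinv.mul_compl, sub_zero]

theorem IsTrunc.compl_mul_residual (h : IsTrunc M X Z) : (1 - X * Z) * (M - X) = M - X := by
  rw [Matrix.mul_sub, h.compl_mul, h.pinv.compl_mul, sub_zero]

/-- Write Y = M'(Zy Y) and M' = M − (M − M'). Since (1 − XZ)M is the residual M − X, which vanishes
on the row space of X, one column-space angle is bounded by a row-space angle times the residual,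
plus the projected perturbation. -/
theorem IsTrunc.compl_mul_le (h : IsTrunc M X Z) (h' : IsTrunc M' Y Zy) :
    frobNorm ((1 - X * Z) * Y) ≤ specNorm (M - X) * frobNorm ((1 - Z * X) * (Zy * Y))
      + frobNorm ((M - M') * (Zy * Y)) := by
  have e : (1 - X * Z) * Y = (M - X) * ((1 - Z * X) * (Zy * Y))
      - (1 - X * Z) * ((M - M') * (Zy * Y)) := by
    rw [← Matrix.mul_assoc, h.residual_mul_compl, Matrix.sub_mul M M', Matrix.mul_sub,
      ← Matrix.mul_assoc _ M, h.compl_mul, h'.mul_projR]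
    abel
  rw [e]
  refine (frobNorm_sub_le _ _).trans (add_le_add (frobNorm_mul_le_left _ _) ?_)
  exact (frobNorm_mul_le_left _ _).trans
    (mul_le_of_le_one_left (frobNorm_nonneg _) h.pinv.projL.compl.specNorm_le_one)

theorem IsTrunc.compl_mul_proj_le (h : IsTrunc M X Z) (h' : IsTrunc M' Y Zy) :
    frobNorm ((1 - X * Z) * (Y * Zy)) ≤ specNorm Zy * (specNorm (M - X) *
      frobNorm ((1 - Z * X) * (Zy * Y)) + frobNorm ((M - M') * (Zy * Y))) := by
  rw [← Matrix.mul_assoc, mul_comm]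
  exact (frobNorm_mul_le_right _ _).trans
    (mul_le_mul_of_nonneg_right (h.compl_mul_le h') (specNorm_nonneg _))

/-- The left and right angles a and d bound each other: a ≤ ζ(ed + b) and d ≤ ζ(ea + b). With ζe ≤
1/4 this linear system closes in the unknowns ea and ed. Only projected perturbations enter b, so no
full Frobenius norm of M − M' is needed. -/
theorem IsTrunc.compl_proj_bounds (h : IsTrunc M X Z) (h' : IsTrunc M' Y Zy) {ζ e b : ℝ}
    (hZy : specNorm Zy ≤ ζ) (he : specNorm (M - X) ≤ e) (hζe : ζ * e ≤ 1 / 4)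
    (hb1 : frobNorm ((M - M') * (Zy * Y)) ≤ b) (hb2 : frobNorm (Y * Zy * (M - M')) ≤ b) :
    e * frobNorm ((1 - X * Z) * (Y * Zy)) ≤ b ∧ e * frobNorm ((1 - Z * X) * (Zy * Y)) ≤ b := by
  have hζ : 0 ≤ ζ := (specNorm_nonneg _).trans hZy
  have he0 : 0 ≤ e := (specNorm_nonneg _).trans he
  have h1 := h.compl_mul_proj_le h'
  have h2 := h.transpose.compl_mul_proj_le h'.transpose
  rw [← Matrix.transpose_mul, ← Matrix.transpose_mul, ← Matrix.transpose_mul,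
    ← Matrix.transpose_mul, h.pinv.right_symm, h.pinv.left_symm, h'.pinv.right_symm,
    h'.pinv.left_symm, specNorm_transpose, ← Matrix.transpose_sub, ← Matrix.transpose_sub,
    specNorm_transpose, frobNorm_transpose_mul_proj h'.pinv.projL] at h2
  set a := frobNorm ((1 - X * Z) * (Y * Zy))
  set d := frobNorm ((1 - Z * X) * (Zy * Y))
  have a0 : 0 ≤ a := frobNorm_nonneg _
  have d0 : 0 ≤ d := frobNorm_nonneg _
  have b0 : 0 ≤ b := (frobNorm_nonneg _).trans hb1
  have h1' : a ≤ ζ * (e * d + b) :=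
    h1.trans (mul_le_mul hZy (add_le_add (mul_le_mul_of_nonneg_right he d0) hb1)
      (add_nonneg (mul_nonneg (specNorm_nonneg _) d0) (frobNorm_nonneg _)) hζ)
  have h2'' : d ≤ ζ * (e * a + b) :=
    h2.trans (mul_le_mul hZy (add_le_add (mul_le_mul_of_nonneg_right he a0) hb2)
      (add_nonneg (mul_nonneg (specNorm_nonneg _) a0) (frobNorm_nonneg _)) hζ)
  have f1 : e * a ≤ ζ * e * (e * d + b) := by nlinarith
  have f2 : e * d ≤ ζ * e * (e * a + b) := by nlinarith
  have g1 : e * a ≤ 1 / 4 * (e * d + b) := f1.trans (by gcongr)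
  have g2 : e * d ≤ 1 / 4 * (e * a + b) := f2.trans (by gcongr)
  constructor <;> linarith

/-- Stability of truncated singular value decompositions. -/
theorem IsTrunc.frobNorm_trunc_sub_le (h : IsTrunc M X Z) (h' : IsTrunc M' Y Zy) {ζ e b : ℝ}
    (hZ : specNorm Z ≤ ζ) (hZy : specNorm Zy ≤ ζ) (he : specNorm (M - X) ≤ e)
    (he' : specNorm (M' - Y) ≤ e) (hζe : ζ * e ≤ 1 / 4)
    (hb1 : frobNorm ((M - M') * (Zy * Y)) ≤ b) (hb2 : frobNorm (Y * Zy * (M - M')) ≤ b)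
    (hb3 : frobNorm ((M - M') * (Z * X)) ≤ b) (hb4 : frobNorm (X * Z * (M - M')) ≤ b) :
    frobNorm (X - Y) ≤ 5 * b := by
  have he0 : 0 ≤ e := (specNorm_nonneg _).trans he
  obtain ⟨-, k1⟩ := h.compl_proj_bounds h' hZy he hζe hb1 hb2
  have hs : M' - M = -(M - M') := by abel
  obtain ⟨k2, -⟩ := h'.compl_proj_bounds h (b := b) hZ he' hζe
    (by rwa [hs, Matrix.neg_mul, frobNorm_neg]) (by rwa [hs, Matrix.mul_neg, frobNorm_neg])
  have e1 : X - Y = -((1 - X * Z) * Y) + (X * Z * (1 - Y * Zy)) * (M' - Y)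
      + (X * Z * (M - M')) * (1 - Zy * Y) + X * Z * (M - M') * (Zy * Y) := by
    have s1 : (X * Z * (1 - Y * Zy)) * (M' - Y) = X * Z * (M' - Y) := by
      rw [Matrix.mul_assoc, h'.compl_mul_residual]
    rw [s1, Matrix.mul_sub (X * Z * (M - M')), Matrix.mul_one, Matrix.mul_sub _ M, h.projL_mul]
    simp only [Matrix.mul_sub, Matrix.sub_mul, Matrix.one_mul]
    abel
  have t1 : frobNorm ((1 - X * Z) * Y) ≤ 2 * b := by
    have := h.compl_mul_le h'
    have := mul_le_mul_of_nonneg_right he (frobNorm_nonneg ((1 - Z * X) * (Zy * Y)))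
    linarith
  have t2 : frobNorm ((X * Z * (1 - Y * Zy)) * (M' - Y)) ≤ b := by
    refine (frobNorm_mul_le_right _ _).trans ?_
    rw [frobNorm_compl_mul_le h.pinv.projL h'.pinv.projL, mul_comm]
    exact (mul_le_mul_of_nonneg_right he' (frobNorm_nonneg _)).trans k2
  have t3 : frobNorm ((X * Z * (M - M')) * (1 - Zy * Y)) ≤ b :=
    (frobNorm_mul_le_right _ _).trans ((mul_le_of_le_one_right (frobNorm_nonneg _)
      h'.pinv.projR.compl.specNorm_le_one).trans hb4)
  have t4 : frobNorm ((X * Z * (M - M')) * (Zy * Y)) ≤ b :=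
    (frobNorm_mul_le_right _ _).trans ((mul_le_of_le_one_right (frobNorm_nonneg _)
      h'.pinv.projR.specNorm_le_one).trans hb4)
  rw [e1]
  refine (frobNorm_add_le _ _).trans ((add_le_add_left ((frobNorm_add_le _ _).trans
    (add_le_add_left (frobNorm_add_le _ _) _)) _).trans ?_)
  rw [frobNorm_neg]
  linarith

end Truncation

/-! ### Euclidean norms of vectors and invertibility criteria. -/

section VecNorm

variable {p q : ℕ}

/-- The Euclidean norm of a vector. -/
noncomputable def vnorm (v : Fin q → ℝ) : ℝ := ‖(WithLp.toLp 2 v : EuclideanSpace ℝ (Fin q))‖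

theorem vnorm_nonneg (v : Fin q → ℝ) : 0 ≤ vnorm v := norm_nonneg _

theorem vnorm_sq (v : Fin q → ℝ) : vnorm v ^ 2 = v ⬝ᵥ v := norm_toLp_sq v

theorem vnorm_eq_zero {v : Fin q → ℝ} : vnorm v = 0 ↔ v = 0 := by
  simp [vnorm]

theorem vnorm_sub_le (v w : Fin q → ℝ) : vnorm (v - w) ≤ vnorm v + vnorm w := by
  simpa [vnorm] using norm_sub_le (WithLp.toLp 2 v : EuclideanSpace ℝ (Fin q)) (WithLp.toLp 2 w)

theorem vnorm_mulVec_le (M : Matrix (Fin p) (Fin q) ℝ) (v : Fin q → ℝ) :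
    vnorm (M.mulVec v) ≤ specNorm M * vnorm v := by
  refine le_of_sq_le_sq ?_ (mul_nonneg (specNorm_nonneg _) (vnorm_nonneg _))
  rw [mul_pow, vnorm_sq, vnorm_sq]
  exact mulVec_dot_self_le M v

theorem specNorm_le_of_vnorm {M : Matrix (Fin p) (Fin q) ℝ} {c : ℝ} (hc : 0 ≤ c)
    (h : ∀ v, vnorm (M.mulVec v) ≤ c * vnorm v) : specNorm M ≤ c := by
  refine specNorm_le_of_mulVec hc fun v => ?_
  rw [← vnorm_sq, ← vnorm_sq, ← mul_pow]
  exact pow_le_pow_left₀ (vnorm_nonneg _) (h v) 2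

theorem vnorm_mulVec_of_orthonormal {U : Matrix (Fin p) (Fin q) ℝ} (h : U.transpose * U = 1)
    (v : Fin q → ℝ) : vnorm (U.mulVec v) = vnorm v := by
  refine (pow_left_inj₀ (vnorm_nonneg _) (vnorm_nonneg _) two_ne_zero).1 ?_
  rw [vnorm_sq, vnorm_sq, Matrix.dotProduct_mulVec, Matrix.vecMul_mulVec, h, Matrix.vecMul_one]

theorem le_vnorm_diagonal_mulVec {d : Fin q → ℝ} {τ : ℝ} (hτ : 0 ≤ τ) (h : ∀ k, τ ≤ d k)
    (a : Fin q → ℝ) : τ * vnorm a ≤ vnorm ((Matrix.diagonal d).mulVec a) := by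
  refine le_of_sq_le_sq ?_ (vnorm_nonneg _)
  rw [mul_pow, vnorm_sq, vnorm_sq]
  simp only [dotProduct, Matrix.mulVec_diagonal, Finset.mul_sum]
  refine Finset.sum_le_sum fun k _ => ?_
  have := pow_le_pow_left₀ hτ (h k) 2
  nlinarith [mul_self_nonneg (a k)]

theorem specNorm_diagonal_inv_le {d : Fin q → ℝ} {τ : ℝ} (hτ : 0 < τ) (h : ∀ k, τ ≤ d k) :
    specNorm (Matrix.diagonal fun k => (d k)⁻¹) ≤ τ⁻¹ := by
  refine specNorm_le_of_mulVec (by positivity) fun v => ?_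
  simp only [dotProduct, Matrix.mulVec_diagonal, Finset.mul_sum]
  refine Finset.sum_le_sum fun k _ => ?_
  have hd : 0 < d k := hτ.trans_le (h k)
  have := pow_le_pow_left₀ (by positivity) (inv_anti₀ hτ (h k)) 2
  nlinarith [mul_self_nonneg (v k)]

theorem isUnit_of_mulVec_eq_zero {C : Matrix (Fin q) (Fin q) ℝ}
    (h : ∀ a, C.mulVec a = 0 → a = 0) : IsUnit C := by
  rw [← Matrix.mulVec_injective_iff_isUnit]
  intro a b hab
  have hab' : C.mulVec a = C.mulVec b := hab
  exact sub_eq_zero.1 (h _ (by rw [Matrix.mulVec_sub, hab', sub_self]))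

theorem isUnit_transpose_mul_self {N : Matrix (Fin p) (Fin q) ℝ}
    (h : ∀ a, N.mulVec a = 0 → a = 0) : IsUnit (N.transpose * N) := by
  refine isUnit_of_mulVec_eq_zero fun a ha => h a ?_
  rw [← vnorm_eq_zero, ← sq_eq_zero_iff, vnorm_sq, Matrix.dotProduct_mulVec, Matrix.vecMul_mulVec,
    ← Matrix.dotProduct_mulVec, ha, dotProduct_zero]

end VecNorm

/-! ### Right singular bases and a dimension count. -/

section SingularVectors

variable {p q r : ℕ}

theorem singVal_nonneg (M : Matrix (Fin p) (Fin q) ℝ) (k : ℕ) : 0 ≤ singVal M k :=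
  LinearMap.singularValues_nonneg _ _

theorem singVal_antitone (M : Matrix (Fin p) (Fin q) ℝ) : Antitone (singVal M) :=
  LinearMap.singularValues_antitone _

/-- An orthonormal basis of right singular vectors. -/
theorem exists_right_singular_basis (M : Matrix (Fin p) (Fin q) ℝ) :
    ∃ U : Matrix (Fin q) (Fin q) ℝ, U.transpose * U = 1 ∧ U * U.transpose = 1 ∧
      (M * U).transpose * (M * U) = Matrix.diagonal fun k : Fin q => singVal M k ^ 2 := by
  set T := Matrix.toEuclideanLin M with hT
  have hn : Module.finrank ℝ (EuclideanSpace ℝ (Fin q)) = q := by simp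
  set b := T.isSymmetric_adjoint_comp_self.eigenvectorBasis hn with hb
  set U : Matrix (Fin q) (Fin q) ℝ := Matrix.of fun i k => b k i with hU
  have hUU : U.transpose * U = 1 := by
    ext j k
    have := orthonormal_iff_ite.1 b.orthonormal j k
    rw [PiLp.inner_apply] at this
    simp only [RCLike.inner_apply, conj_trivial] at this
    rw [Matrix.mul_apply, Matrix.one_apply, ← this]
    exact Finset.sum_congr rfl fun i _ => by simp [hU, mul_comm]
  refine ⟨U, hUU, mul_eq_one_comm.1 hUU, ?_⟩
  ext j k
  have h1 : inner ℝ (T (b j)) (T (b k)) = if j = k then singVal M k ^ 2 else 0 := by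
    rw [← LinearMap.adjoint_inner_right]
    have h2 := T.isSymmetric_adjoint_comp_self.apply_eigenvectorBasis hn k
    rw [LinearMap.comp_apply, ← hb] at h2
    rw [h2, inner_smul_right, orthonormal_iff_ite.1 b.orthonormal j k]
    have h3 := T.sq_singularValues_fin hn k
    simp only [singVal, ← hT, h3]
    simp
  rw [PiLp.inner_apply] at h1
  simp only [RCLike.inner_apply, conj_trivial] at h1
  have h4 : ∀ i l, (T (b l)) i = (M * U) i l := fun i l => by
    rw [hT, Matrix.toLpLin_apply]
    simp [Matrix.mulVec, dotProduct, Matrix.mul_apply, hU]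
  rw [Matrix.mul_apply, Matrix.diagonal_apply]
  simp only [h4] at h1
  have : (if j = k then singVal M j ^ 2 else 0) = if j = k then singVal M k ^ 2 else 0 := by
    split_ifs with h
    · rw [h]
    · rfl
  rw [this, ← h1]
  exact Finset.sum_congr rfl fun i _ => by simp [mul_comm]

theorem exists_ne_zero_mulVec_eq_zero {k l : ℕ} (h : k < l) (B : Matrix (Fin k) (Fin l) ℝ) :
    ∃ a, a ≠ 0 ∧ B.mulVec a = 0 := by
  have h1 := LinearMap.ker_ne_bot_of_finrank_lt (f := B.mulVecLin) (by simpa using h)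
  obtain ⟨a, ha, ha0⟩ := (Submodule.ne_bot_iff _).1 h1
  exact ⟨a, ha0, ha⟩

end SingularVectors

/-! ### Matrices near a well-conditioned rank-r target. -/

section Target

variable {p q r : ℕ}

/-- A rank-`r` matrix `V diag(s) Wᵀ` whose nonzero singular values are at least `σ`. -/
structure IsTarget (Xs : Matrix (Fin p) (Fin q) ℝ) (V : Matrix (Fin p) (Fin r) ℝ)
    (s : Fin r → ℝ) (W : Matrix (Fin q) (Fin r) ℝ) (σ : ℝ) : Prop where
  left_orthonormal : V.transpose * V = 1
  right_orthonormal : W.transpose * W = 1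
  eq_mul : Xs = V * Matrix.diagonal s * W.transpose
  pos : 0 < σ
  le : ∀ k, σ ≤ s k

variable {Xs M : Matrix (Fin p) (Fin q) ℝ} {V : Matrix (Fin p) (Fin r) ℝ} {s : Fin r → ℝ}
  {W : Matrix (Fin q) (Fin r) ℝ} {σ : ℝ}

theorem IsTarget.mul_W (h : IsTarget Xs V s W σ) : Xs * W = V * Matrix.diagonal s := by
  rw [h.eq_mul, Matrix.mul_assoc, h.right_orthonormal, Matrix.mul_one]

theorem IsTarget.le_vnorm (h : IsTarget Xs V s W σ) (a : Fin r → ℝ) :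
    σ * vnorm a ≤ vnorm (Xs.mulVec (W.mulVec a)) := by
  rw [Matrix.mulVec_mulVec, h.mul_W, ← Matrix.mulVec_mulVec,
    vnorm_mulVec_of_orthonormal h.left_orthonormal]
  exact le_vnorm_diagonal_mulVec h.pos.le h.le a

theorem IsTarget.le_vnorm_of_near (h : IsTarget Xs V s W σ) (M : Matrix (Fin p) (Fin q) ℝ)
    (a : Fin r → ℝ) : (σ - specNorm (M - Xs)) * vnorm a ≤ vnorm (M.mulVec (W.mulVec a)) := by
  have h1 := h.le_vnorm a
  have h2 := vnorm_mulVec_le (M - Xs) (W.mulVec a)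
  rw [vnorm_mulVec_of_orthonormal h.right_orthonormal] at h2
  have h3 : Xs.mulVec (W.mulVec a) = M.mulVec (W.mulVec a) - (M - Xs).mulVec (W.mulVec a) := by
    rw [Matrix.sub_mulVec]; abel
  have h4 := vnorm_sub_le (M.mulVec (W.mulVec a)) ((M - Xs).mulVec (W.mulVec a))
  rw [← h3] at h4
  linarith

/-- Weyl's inequality for the leading singular values. -/
theorem IsTarget.sub_le_singVal (h : IsTarget Xs V s W σ) (M : Matrix (Fin p) (Fin q) ℝ) {k : ℕ}
    (hk : k < r) : σ - specNorm (M - Xs) ≤ singVal M k := by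
  obtain ⟨U, hU, hU', hM⟩ := exists_right_singular_basis M
  by_cases hkq : k < q
  -- Courant–Fischer by dimension count: the r-dimensional range of W contains a nonzero vector
  -- orthogonal to the first k < r right singular vectors of M. There M stretches by at most its
  -- singular value k, and by at least σ − ‖M − X⋆‖.
  · obtain ⟨a, ha, hB⟩ := exists_ne_zero_mulVec_eq_zero hk
      ((U.transpose * W).submatrix (Fin.castLE hkq.le) id)
    set c := U.transpose.mulVec (W.mulVec a) with hc
    have hc0 : ∀ j : Fin q, (j : ℕ) < k → c j = 0 := by
      intro j hj
      have := congrFun hB ⟨j, hj⟩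
      rw [hc, Matrix.mulVec_mulVec]
      simpa [Matrix.mulVec, dotProduct] using this
    have hWa : W.mulVec a = U.mulVec c := by
      rw [hc, Matrix.mulVec_mulVec, hU', Matrix.one_mulVec]
    have hcn : vnorm c = vnorm a := by
      rw [← vnorm_mulVec_of_orthonormal hU, ← hWa,
        vnorm_mulVec_of_orthonormal h.right_orthonormal]
    have h1 : vnorm (M.mulVec (W.mulVec a)) ≤ singVal M k * vnorm a := by
      refine le_of_sq_le_sq ?_ (mul_nonneg (singVal_nonneg _ _) (vnorm_nonneg _))
      rw [hWa, mul_pow, ← hcn, vnorm_sq, vnorm_sq, Matrix.mulVec_mulVec, Matrix.dotProduct_mulVec,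
        Matrix.vecMul_mulVec, hM, ← Matrix.dotProduct_mulVec]
      simp only [dotProduct, Matrix.mulVec_diagonal, Finset.mul_sum]
      refine Finset.sum_le_sum fun j _ => ?_
      rcases lt_or_ge (j : ℕ) k with hj | hj
      · simp [hc0 j hj]
      · have := pow_le_pow_left₀ (singVal_nonneg _ _) (singVal_antitone M hj) 2
        nlinarith [mul_self_nonneg (c j)]
    have h2 := h.le_vnorm_of_near M a
    have ha0 : 0 < vnorm a := (vnorm_nonneg a).lt_of_ne fun h0 => ha (vnorm_eq_zero.1 h0.symm)
    exact le_of_mul_le_mul_right (h2.trans h1) ha0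
  · exfalso
    obtain ⟨a, ha, hB⟩ := exists_ne_zero_mulVec_eq_zero ((not_lt.1 hkq).trans_lt hk) W
    apply ha
    rw [← vnorm_eq_zero, ← vnorm_mulVec_of_orthonormal h.right_orthonormal, hB]
    exact vnorm_eq_zero.2 rfl

/-! ### Top-r singular value decompositions as truncations. -/

section TopSVD

variable {V' : Matrix (Fin p) (Fin r) ℝ} {s' : Fin r → ℝ} {W' : Matrix (Fin q) (Fin r) ℝ}

theorem IsTopSVD.isTrunc (hM : IsTopSVD M V' s' W') (hs : ∀ k, 0 < s' k) :
    IsTrunc M (V' * Matrix.diagonal s' * W'.transpose)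
      (W' * Matrix.diagonal (fun k => (s' k)⁻¹) * V'.transpose) := by
  have e1 : Matrix.diagonal s' * Matrix.diagonal (fun k => (s' k)⁻¹) = 1 := by
    rw [Matrix.diagonal_mul_diagonal, ← Matrix.diagonal_one]
    congr 1; ext k; exact mul_inv_cancel₀ (hs k).ne'
  have e2 : Matrix.diagonal (fun k => (s' k)⁻¹) * Matrix.diagonal s' = 1 := by
    rw [Matrix.diagonal_mul_diagonal, ← Matrix.diagonal_one]
    congr 1; ext k; exact inv_mul_cancel₀ (hs k).ne'
  have hL : V' * Matrix.diagonal s' * W'.transpose *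
      (W' * Matrix.diagonal (fun k => (s' k)⁻¹) * V'.transpose) = V' * V'.transpose := by
    calc _ = V' * (Matrix.diagonal s' * ((W'.transpose * W') *
          Matrix.diagonal (fun k => (s' k)⁻¹))) * V'.transpose := by simp only [Matrix.mul_assoc]
      _ = _ := by rw [hM.right_orthonormal, Matrix.one_mul, e1, Matrix.mul_one]
  have hR : W' * Matrix.diagonal (fun k => (s' k)⁻¹) * V'.transpose *
      (V' * Matrix.diagonal s' * W'.transpose) = W' * W'.transpose := by
    calc _ = W' * (Matrix.diagonal (fun k => (s' k)⁻¹) * ((V'.transpose * V') *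
          Matrix.diagonal s')) * W'.transpose := by simp only [Matrix.mul_assoc]
      _ = _ := by rw [hM.left_orthonormal, Matrix.one_mul, e2, Matrix.mul_one]
  have hl : V'.transpose * M = Matrix.diagonal s' * W'.transpose := by
    have := congrArg Matrix.transpose hM.mul_left
    simpa using this
  refine ⟨⟨?_, ?_, ?_, ?_⟩, ?_, ?_⟩
  · rw [hL, ← Matrix.mul_assoc, ← Matrix.mul_assoc, Matrix.mul_assoc V' V'.transpose,
      hM.left_orthonormal, Matrix.mul_one]
  · rw [hR, ← Matrix.mul_assoc, ← Matrix.mul_assoc, Matrix.mul_assoc W' W'.transpose,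
      hM.right_orthonormal, Matrix.mul_one]
  · rw [hL, Matrix.transpose_mul, Matrix.transpose_transpose]
  · rw [hR, Matrix.transpose_mul, Matrix.transpose_transpose]
  · rw [hL, Matrix.mul_assoc, hl, Matrix.mul_assoc]
  · rw [hR, ← Matrix.mul_assoc, hM.mul_right]

theorem IsTopSVD.specNorm_pinv_le (hM : IsTopSVD M V' s' W') {τ : ℝ} (hτ : 0 < τ)
    (hs : ∀ k, τ ≤ s' k) :
    specNorm (W' * Matrix.diagonal (fun k => (s' k)⁻¹) * V'.transpose) ≤ τ⁻¹ := by
  have h1 := specNorm_le_one_of_transpose_mul_self hM.left_orthonormal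
  have h2 := specNorm_le_one_of_transpose_mul_self hM.right_orthonormal
  have h3 := specNorm_diagonal_inv_le hτ hs
  refine (specNorm_mul_le _ _).trans ?_
  rw [specNorm_transpose]
  refine (mul_le_of_le_one_right (specNorm_nonneg _) h1).trans ?_
  exact (specNorm_mul_le _ _).trans ((mul_le_of_le_one_left (specNorm_nonneg _) h2).trans h3)

/-- The residual of the top-`r` singular value decomposition of a perturbation of a rank-`r` matrix
is at most the size of the perturbation. -/
theorem IsTopSVD.specNorm_residual_le (hM : IsTopSVD M V' s' W') (h : IsTarget Xs V s W σ)
    (hε : 2 * specNorm (M - Xs) < σ) :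
    specNorm (M - V' * Matrix.diagonal s' * W'.transpose) ≤ specNorm (M - Xs) := by
  set ε := specNorm (M - Xs) with hεdef
  have hε0 : 0 ≤ ε := specNorm_nonneg _
  have hs : ∀ k, σ - ε ≤ s' k := fun k => by
    rw [hM.singVal_eq]; exact h.sub_le_singVal M k.2
  -- The residual acts as M on the complement of the columns of W'. If M stretched some such y by
  -- more than ε, the (r+1)-dimensional span of y and these columns would meet the kernel of Wᵀ in a
  -- nonzero x. There X⋆x = 0, so ‖Mx‖ ≤ ε‖x‖, whereas orthogonality of both the pieces and their
  -- images under M forces the strict opposite.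
  have key : ∀ y : Fin q → ℝ, W'.transpose.mulVec y = 0 → vnorm (M.mulVec y) ≤ ε * vnorm y := by
    intro y hy
    by_contra! hlt
    set B : Matrix (Fin r) (Fin (r + 1)) ℝ := Matrix.of fun k =>
      Fin.snoc (fun j => (W.transpose * W') k j) ((W.transpose.mulVec y) k) with hB
    obtain ⟨c, hc, hBc⟩ := exists_ne_zero_mulVec_eq_zero (Nat.lt_succ_self r) B
    set a : Fin r → ℝ := fun j => c j.castSucc with ha
    set b := c (Fin.last r) with hb
    set x := W'.mulVec a + b • y with hx
    have hWx : W.transpose.mulVec x = 0 := by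
      have hBk : ∀ k, B.mulVec c k
          = ∑ j, (W.transpose * W') k j * a j + (W.transpose.mulVec y) k * b := fun k => by
        simp [hB, ha, hb, Matrix.mulVec, dotProduct, Fin.sum_univ_castSucc]
      rw [← hBc]
      ext k
      rw [hBk, hx, Matrix.mulVec_add, Matrix.mulVec_smul, Matrix.mulVec_mulVec, Pi.add_apply,
        Pi.smul_apply, smul_eq_mul, mul_comm b]
      rfl
    have hXx : Xs.mulVec x = 0 := by
      rw [h.eq_mul, ← Matrix.mulVec_mulVec, hWx, Matrix.mulVec_zero]
    have hMx : vnorm (M.mulVec x) ≤ ε * vnorm x := by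
      have := vnorm_mulVec_le (M - Xs) x
      rwa [Matrix.sub_mulVec, hXx, sub_zero] at this
    have hsq := pow_le_pow_left₀ (vnorm_nonneg _) hMx 2
    have o1 : (M.mulVec (W'.mulVec a)) ⬝ᵥ (M.mulVec y) = 0 := by
      rw [Matrix.mulVec_mulVec, hM.mul_right, ← Matrix.mulVec_mulVec, Matrix.dotProduct_mulVec,
        ← Matrix.mulVec_transpose, Matrix.mulVec_mulVec, hM.mul_left, ← Matrix.mulVec_mulVec,
        dotProduct_comm, Matrix.dotProduct_mulVec, ← Matrix.mulVec_transpose, hy, zero_dotProduct]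
    have o2 : (W'.mulVec a) ⬝ᵥ y = 0 := by
      rw [dotProduct_comm, Matrix.dotProduct_mulVec, ← Matrix.mulVec_transpose, hy,
        zero_dotProduct]
    have e1 : vnorm (M.mulVec x) ^ 2 = vnorm (M.mulVec (W'.mulVec a)) ^ 2
        + b ^ 2 * vnorm (M.mulVec y) ^ 2 := by
      simp only [vnorm_sq, hx, Matrix.mulVec_add, Matrix.mulVec_smul, add_dotProduct,
        dotProduct_add, smul_dotProduct, dotProduct_smul, smul_eq_mul, o1,
        dotProduct_comm (M.mulVec y)]
      ring
    have e2 : vnorm x ^ 2 = vnorm a ^ 2 + b ^ 2 * vnorm y ^ 2 := by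
      rw [← vnorm_mulVec_of_orthonormal hM.right_orthonormal a]
      simp only [vnorm_sq, hx, add_dotProduct,
        dotProduct_add, smul_dotProduct, dotProduct_smul, smul_eq_mul, o2,
        dotProduct_comm y]
      ring
    have e3 : (σ - ε) * vnorm a ≤ vnorm (M.mulVec (W'.mulVec a)) := by
      rw [Matrix.mulVec_mulVec, hM.mul_right, ← Matrix.mulVec_mulVec,
        vnorm_mulVec_of_orthonormal hM.left_orthonormal]
      exact le_vnorm_diagonal_mulVec (by linarith) hs a
    have e3' := pow_le_pow_left₀ (mul_nonneg (by linarith) (vnorm_nonneg _)) e3 2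
    rw [mul_pow, e1, e2] at hsq
    have hyl := pow_lt_pow_left₀ hlt (mul_nonneg hε0 (vnorm_nonneg _)) two_ne_zero
    rw [mul_pow] at hyl e3'
    -- The place where 2ε < σ is needed: the retained directions are stretched by strictly more than
    -- ε.
    have hgap : ε ^ 2 < (σ - ε) ^ 2 := by nlinarith
    have ha0 : vnorm a ^ 2 = 0 := by
      by_contra hne
      have : 0 < vnorm a ^ 2 := lt_of_le_of_ne (sq_nonneg _) (Ne.symm hne)
      nlinarith [mul_lt_mul_of_pos_right hgap this, mul_le_mul_of_nonneg_left hyl.le (sq_nonneg b)]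
    have hb0 : b ^ 2 = 0 := by
      by_contra hne
      have : 0 < b ^ 2 := lt_of_le_of_ne (sq_nonneg _) (Ne.symm hne)
      nlinarith [mul_lt_mul_of_pos_left hyl this]
    apply hc
    have a0 : a = 0 := vnorm_eq_zero.1 (pow_eq_zero_iff two_ne_zero |>.1 ha0)
    have b0 : b = 0 := pow_eq_zero_iff two_ne_zero |>.1 hb0
    ext j
    refine Fin.lastCases ?_ (fun i => ?_) j
    · exact b0
    · exact congrFun a0 i
  refine specNorm_le_of_vnorm hε0 fun v => ?_
  set y := (1 - W' * W'.transpose).mulVec v with hy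
  have hproj : IsProj (W' * W'.transpose) :=
    ⟨by rw [Matrix.transpose_mul, Matrix.transpose_transpose],
      by rw [← Matrix.mul_assoc, Matrix.mul_assoc W', hM.right_orthonormal, Matrix.mul_one]⟩
  have e : (M - V' * Matrix.diagonal s' * W'.transpose).mulVec v = M.mulVec y := by
    rw [hy, Matrix.mulVec_mulVec, Matrix.mul_sub, Matrix.mul_one, ← Matrix.mul_assoc, hM.mul_right]
  have hWy : W'.transpose.mulVec y = 0 := by
    rw [hy, Matrix.mulVec_mulVec, Matrix.mul_sub, Matrix.mul_one, ← Matrix.mul_assoc,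
      hM.right_orthonormal, Matrix.one_mul, sub_self, Matrix.zero_mulVec]
  rw [e]
  refine (key y hWy).trans (mul_le_mul_of_nonneg_left ?_ hε0)
  exact (vnorm_mulVec_le _ _).trans
    (mul_le_of_le_one_left (vnorm_nonneg _) hproj.compl.specNorm_le_one)

end TopSVD

/-- Left singular vectors are obtained as M w / s from the right ones, which is why the leading
singular values are assumed positive. -/
theorem exists_isTopSVD (M : Matrix (Fin p) (Fin q) ℝ) (hr : ∀ k < r, 0 < singVal M k)
    (hrq : r ≤ q) : ∃ (V : Matrix (Fin p) (Fin r) ℝ) (s : Fin r → ℝ)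
      (W : Matrix (Fin q) (Fin r) ℝ), IsTopSVD M V s W := by
  obtain ⟨U, hU, hU', hM⟩ := exists_right_singular_basis M
  set s : Fin r → ℝ := fun k => singVal M k with hs
  set J : Matrix (Fin q) (Fin r) ℝ := (1 : Matrix (Fin q) (Fin q) ℝ).submatrix id (Fin.castLE hrq)
    with hJ
  set W := U * J with hW
  have hJJ : J.transpose * J = 1 := by
    ext i j
    simp [hJ, Matrix.mul_apply, Matrix.one_apply]
  have hDJ : (Matrix.diagonal fun k : Fin q => singVal M k ^ 2) * J
      = J * Matrix.diagonal (fun k => s k ^ 2) := by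
    ext i j
    by_cases h : i = Fin.castLE hrq j
    · simp [hJ, Matrix.one_apply, hs, h]
    · simp [hJ, h]
  have hWW : W.transpose * W = 1 := by
    rw [hW, Matrix.transpose_mul, Matrix.mul_assoc, ← Matrix.mul_assoc U.transpose, hU,
      Matrix.one_mul, hJJ]
  have hMMW : M.transpose * (M * W) = W * Matrix.diagonal (fun k => s k ^ 2) := by
    have : M.transpose * (M * U) = U * Matrix.diagonal fun k : Fin q => singVal M k ^ 2 := by
      rw [← hM, Matrix.transpose_mul, Matrix.mul_assoc, ← Matrix.mul_assoc U, hU', Matrix.one_mul]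
    rw [hW, ← Matrix.mul_assoc M, ← Matrix.mul_assoc, this, Matrix.mul_assoc, hDJ, Matrix.mul_assoc]
  have hs0 : ∀ k, s k ≠ 0 := fun k => (hr k k.2).ne'
  have d1 : Matrix.diagonal (fun k => s k ^ 2) * Matrix.diagonal (fun k => (s k)⁻¹)
      = Matrix.diagonal s := by
    rw [Matrix.diagonal_mul_diagonal]
    congr 1; ext k; field_simp [hs0 k]
  have d2 : Matrix.diagonal (fun k => (s k)⁻¹) * Matrix.diagonal s = 1 := by
    rw [Matrix.diagonal_mul_diagonal, ← Matrix.diagonal_one]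
    congr 1; ext k; exact inv_mul_cancel₀ (hs0 k)
  refine ⟨M * W * Matrix.diagonal fun k => (s k)⁻¹, s, W, ⟨?_, hWW, fun k => rfl, ?_, ?_⟩⟩
  · rw [Matrix.transpose_mul, Matrix.transpose_mul, Matrix.diagonal_transpose, Matrix.mul_assoc,
      Matrix.mul_assoc, ← Matrix.mul_assoc M.transpose, hMMW, Matrix.mul_assoc W, d1,
      ← Matrix.mul_assoc W.transpose, hWW, Matrix.one_mul, d2]
  · rw [Matrix.mul_assoc, d2, Matrix.mul_one]
  · rw [← Matrix.mul_assoc, hMMW, Matrix.mul_assoc, d1]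

end Target

/-! ### The smallest nonzero singular value. -/

section SigmaMin

variable {p q r : ℕ} {Xs : Matrix (Fin p) (Fin q) ℝ} {V : Matrix (Fin p) (Fin r) ℝ} {s : Fin r → ℝ}
  {W : Matrix (Fin q) (Fin r) ℝ}

theorem IsCompactSVD.exists_singVal_eq (h : IsCompactSVD Xs V s W) (k : Fin r) :
    ∃ i, singVal Xs i = s k := by
  set T := Matrix.toEuclideanLin Xs with hT
  have hn : Module.finrank ℝ (EuclideanSpace ℝ (Fin q)) = q := by simp
  set w : EuclideanSpace ℝ (Fin q) := WithLp.toLp 2 (W.col k) with hw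
  have hw0 : w ≠ 0 := by
    intro h0
    have h1 : W.col k = 0 := by simpa [hw] using h0
    have h2 := congrFun (congrFun h.right_orthonormal k) k
    rw [Matrix.mul_apply] at h2
    have h3 : ∀ j, W j k = 0 := fun j => congrFun h1 j
    simp [h3] at h2
  have hadj : LinearMap.adjoint T = Matrix.toEuclideanLin Xs.transpose := by
    rw [← Matrix.conjTranspose_eq_transpose_of_trivial, Matrix.toEuclideanLin_conjTranspose_eq_adjoint]
  have hev : (LinearMap.adjoint T ∘ₗ T) w = (s k ^ 2) • w := by
    rw [LinearMap.comp_apply, hadj, hT, Matrix.toLpLin_apply, Matrix.toLpLin_apply]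
    have e : Xs.transpose * Xs * W = W * Matrix.diagonal (fun k => s k ^ 2) := by
      have : W * Matrix.diagonal s * (V.transpose * V) * Matrix.diagonal s * (W.transpose * W)
          = W * Matrix.diagonal (fun k => s k ^ 2) := by
        rw [h.left_orthonormal, h.right_orthonormal, Matrix.mul_one, Matrix.mul_one,
          Matrix.mul_assoc, Matrix.diagonal_mul_diagonal]
        simp only [sq]
      rw [← this, h.eq_mul]
      simp only [Matrix.transpose_mul, Matrix.transpose_transpose, Matrix.diagonal_transpose,
        Matrix.mul_assoc]
    ext i
    have e' := congrFun (congrFun e i) k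
    simp only [hw, Matrix.mulVec_mulVec, PiLp.smul_apply, smul_eq_mul]
    rw [Matrix.mul_diagonal] at e'
    simpa [Matrix.mulVec, dotProduct, Matrix.mul_apply, mul_comm] using e'
  obtain ⟨i, hi⟩ := T.isSymmetric_adjoint_comp_self.exists_eigenvalues_eq hn (μ := s k ^ 2)
    (Module.End.hasEigenvalue_of_hasEigenvector
      (Module.End.hasEigenvector_iff.2 ⟨Module.End.mem_eigenspace_iff.2 hev, hw0⟩))
  refine ⟨i, ?_⟩
  rw [singVal, T.singularValues_fin hn i]
  have : T.isSymmetric_adjoint_comp_self.eigenvalues hn i = s k ^ 2 := by exact_mod_cast hi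
  rw [this, Real.sqrt_sq (h.pos k).le]

/-- The set of nonzero singular values is finite, and nonempty as r ≥ 1, so its infimum is attained
and positive. It lies below each s k because the columns of W are eigenvectors of XᵀX with
eigenvalues (s k)². -/
theorem IsCompactSVD.isTarget (h : IsCompactSVD Xs V s W) (hr : 1 ≤ r) :
    IsTarget Xs V s W (sigmaMin Xs) := by
  set S := {x : ℝ | x ≠ 0 ∧ ∃ k : ℕ, singVal Xs k = x} with hS
  have hmem : ∀ k, s k ∈ S := fun k => ⟨(h.pos k).ne', h.exists_singVal_eq k⟩
  have hnn : ∀ x ∈ S, 0 ≤ x := by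
    rintro x ⟨-, k, rfl⟩; exact singVal_nonneg _ _
  have hfin : S.Finite := by
    refine ((Finset.image (singVal Xs) (Matrix.toEuclideanLin Xs).singularValues.support)
      |>.finite_toSet).subset ?_
    rintro x ⟨hx, k, rfl⟩
    simp only [Finset.coe_image]
    exact ⟨k, Finsupp.mem_support_iff.2 hx, rfl⟩
  have hin : sigmaMin Xs ∈ S := Set.Nonempty.csInf_mem ⟨_, hmem ⟨0, hr⟩⟩ hfin
  exact ⟨h.left_orthonormal, h.right_orthonormal, h.eq_mul, (hnn _ hin).lt_of_ne' hin.1,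
    fun k => csInf_le ⟨0, hnn⟩ (hmem k)⟩

end SigmaMin

/-! ### Rank inequalities and factorization of low-rank matrices. -/

section Rank

variable {p q k : ℕ}

theorem rank_add_le' (A B : Matrix (Fin p) (Fin q) ℝ) : (A + B).rank ≤ A.rank + B.rank := by
  unfold Matrix.rank
  rw [Matrix.mulVecLin_add]
  exact (Submodule.finrank_mono (LinearMap.range_add_le _ _)).trans
    (Submodule.finrank_add_le_finrank_add_finrank _ _)

theorem rank_smul_le (c : ℝ) (A : Matrix (Fin p) (Fin q) ℝ) : (c • A).rank ≤ A.rank := by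
  have : c • A = A * (c • (1 : Matrix (Fin q) (Fin q) ℝ)) := by simp
  rw [this]
  exact Matrix.rank_mul_le_left _ _

theorem rank_sub_le (A B : Matrix (Fin p) (Fin q) ℝ) : (A - B).rank ≤ A.rank + B.rank := by
  have : A - B = A + (-1 : ℝ) • B := by module
  rw [this]
  exact (rank_add_le' _ _).trans (by gcongr; exact rank_smul_le _ _)

theorem rank_mul_transpose_le (L : Matrix (Fin p) (Fin k) ℝ) (R : Matrix (Fin q) (Fin k) ℝ) :
    (L * R.transpose).rank ≤ k :=
  (Matrix.rank_mul_le_left _ _).trans (Matrix.rank_le_width L)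

/-- A matrix of rank at most `k` factors through a contraction to `ℝᵏ`. -/
theorem exists_contraction_factor {X : Matrix (Fin p) (Fin q) ℝ} (hX : X.rank ≤ k) :
    ∃ R : Matrix (Fin q) (Fin k) ℝ, specNorm R ≤ 1 ∧ X = X * R * R.transpose := by
  obtain ⟨U, hU, hU', hM⟩ := exists_right_singular_basis X
  -- A truncated identity selecting the first k right singular vectors; it has zero columns when k >
  -- q, so that case needs no separate treatment.
  set J : Matrix (Fin q) (Fin k) ℝ := Matrix.of fun i l => if (i : ℕ) = l then 1 else 0 with hJ
  have hs : ∀ i : ℕ, k ≤ i → singVal X i = 0 := by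
    intro i hi
    rw [singVal, LinearMap.singularValues_eq_zero_iff_le_finrank_range]
    refine le_trans (le_of_eq ?_) (hX.trans hi)
    rw [Matrix.rank_eq_finrank_range_toLin X (EuclideanSpace.basisFun (Fin p) ℝ).toBasis
      (EuclideanSpace.basisFun (Fin q) ℝ).toBasis, Matrix.toEuclideanLin_eq_toLin_orthonormal]
  have hcol : ∀ (i : Fin q), k ≤ i → ∀ l, (X * U) l i = 0 := by
    intro i hi l
    have h1 := congrFun (congrFun hM i) i
    rw [Matrix.diagonal_apply_eq, hs i hi, Matrix.mul_apply, zero_pow two_ne_zero] at h1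
    have h2 := (Finset.sum_eq_zero_iff_of_nonneg fun j _ => by
      rw [Matrix.transpose_apply]; exact mul_self_nonneg _).1 h1 l (Finset.mem_univ l)
    exact mul_self_eq_zero.1 (by rwa [Matrix.transpose_apply] at h2)
  have hJJ : J * J.transpose =
      Matrix.diagonal fun i : Fin q => if (i : ℕ) < k then (1 : ℝ) else 0 := by
    ext i j
    rw [Matrix.mul_apply, Matrix.diagonal_apply]
    simp only [hJ, Matrix.of_apply, Matrix.transpose_apply, mul_ite, mul_one, mul_zero]
    by_cases hi : (i : ℕ) < k
    · rw [Finset.sum_eq_single ⟨i, hi⟩]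
      · simp [hi, Fin.ext_iff, eq_comm]
      · intro l _ hl
        have : (i : ℕ) ≠ l := fun h => hl (Fin.ext h.symm)
        simp [this]
      · simp
    · rw [Finset.sum_eq_zero]
      · simp [hi]
      · intro l _
        have : (i : ℕ) ≠ l := fun h => hi (h ▸ l.2)
        simp [this]
  have hXJ : X * U * (J * J.transpose) = X * U := by
    rw [hJJ]
    ext l i
    rw [Matrix.mul_diagonal]
    split_ifs with h
    · rw [mul_one]
    · rw [mul_zero, hcol i (not_lt.1 h)]
  have hJn : specNorm J ≤ 1 := by
    rw [← specNorm_transpose]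
    refine specNorm_le_of_mulVec zero_le_one fun v => ?_
    rw [Matrix.dotProduct_mulVec, Matrix.vecMul_mulVec, Matrix.transpose_transpose, hJJ]
    simp only [dotProduct, Matrix.vecMul_diagonal, one_pow, one_mul]
    refine Finset.sum_le_sum fun i _ => ?_
    split_ifs
    · simp
    · simp [mul_self_nonneg]
  refine ⟨U * J, ?_, ?_⟩
  · exact (specNorm_mul_le _ _).trans (mul_le_one₀ (specNorm_le_one_of_transpose_mul_self hU)
      (specNorm_nonneg _) hJn)
  · rw [Matrix.transpose_mul, ← Matrix.mul_assoc, ← Matrix.mul_assoc X, Matrix.mul_assoc (X * U),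
      hXJ, Matrix.mul_assoc, hU', Matrix.mul_one]

theorem frobNorm_sq_le_of_width (R : Matrix (Fin q) (Fin k) ℝ) :
    frobNorm R ^ 2 ≤ k * specNorm R ^ 2 := by
  rw [frobNorm_sq_eq_sum_col]
  have : ∀ j ∈ Finset.univ, (R.col j) ⬝ᵥ (R.col j) ≤ specNorm R ^ 2 := by
    intro j _
    have h := mulVec_dot_self_le R (Pi.single j 1)
    simpa using h
  refine (Finset.sum_le_card_nsmul _ _ _ this).trans ?_
  simp

/-- The contraction R through which X factors has k columns of norm at most 1, hence Frobenius norm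
at most √k. -/
theorem frobNorm_le_sqrt_mul_specNorm {X : Matrix (Fin p) (Fin q) ℝ} (hX : X.rank ≤ k) :
    frobNorm X ≤ Real.sqrt k * specNorm X := by
  obtain ⟨R, hR, hXR⟩ := exists_contraction_factor hX
  have h1 : frobNorm R ≤ Real.sqrt k := by
    refine Real.le_sqrt_of_sq_le ((frobNorm_sq_le_of_width R).trans ?_)
    have := pow_le_one₀ (specNorm_nonneg R) hR (n := 2)
    exact mul_le_of_le_one_right (Nat.cast_nonneg k) this
  rw [hXR]
  calc frobNorm (X * R * R.transpose) ≤ frobNorm (X * R) * specNorm R.transpose :=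
        frobNorm_mul_le_right _ _
    _ ≤ frobNorm (X * R) := mul_le_of_le_one_right (frobNorm_nonneg _)
        (by rwa [specNorm_transpose])
    _ ≤ specNorm X * frobNorm R := frobNorm_mul_le_left _ _
    _ ≤ specNorm X * Real.sqrt k := mul_le_mul_of_nonneg_left h1 (specNorm_nonneg _)
    _ = Real.sqrt k * specNorm (X * R * R.transpose) := by rw [← hXR, mul_comm]

end Rank

/-! ### From factors to products and back. -/

section Factors

variable {p q r : ℕ}

/-- The pseudo-inverse of `L Rᵀ` when `L` and `R` have full column rank. -/
noncomputable def factorPinv (L : Matrix (Fin p) (Fin r) ℝ) (R : Matrix (Fin q) (Fin r) ℝ) :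
    Matrix (Fin q) (Fin p) ℝ :=
  R * (R.transpose * R)⁻¹ * ((L.transpose * L)⁻¹ * L.transpose)

variable {L : Matrix (Fin p) (Fin r) ℝ} {R : Matrix (Fin q) (Fin r) ℝ}

theorem inv_mul_of_isUnit {C : Matrix (Fin r) (Fin r) ℝ} (h : IsUnit C) : C⁻¹ * C = 1 :=
  Matrix.nonsing_inv_mul C ((Matrix.isUnit_iff_isUnit_det C).1 h)

theorem mul_inv_of_isUnit {C : Matrix (Fin r) (Fin r) ℝ} (h : IsUnit C) : C * C⁻¹ = 1 :=
  Matrix.mul_nonsing_inv C ((Matrix.isUnit_iff_isUnit_det C).1 h)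

theorem factorPinv_mul_left (hL : IsUnit (L.transpose * L)) :
    factorPinv L R * L = R * (R.transpose * R)⁻¹ := by
  rw [factorPinv, Matrix.mul_assoc, Matrix.mul_assoc (L.transpose * L)⁻¹, inv_mul_of_isUnit hL,
    Matrix.mul_one]

theorem transpose_mul_factorPinv (hR : IsUnit (R.transpose * R)) :
    R.transpose * factorPinv L R = (L.transpose * L)⁻¹ * L.transpose := by
  rw [factorPinv, ← Matrix.mul_assoc, ← Matrix.mul_assoc R.transpose R, mul_inv_of_isUnit hR,
    Matrix.one_mul]

theorem isPinv_factorPinv (hL : IsUnit (L.transpose * L)) (hR : IsUnit (R.transpose * R)) :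
    IsPinv (L * R.transpose) (factorPinv L R) := by
  have e1 : L * R.transpose * factorPinv L R = L * ((L.transpose * L)⁻¹ * L.transpose) := by
    rw [Matrix.mul_assoc, transpose_mul_factorPinv hR]
  have e2 : factorPinv L R * (L * R.transpose) = R * (R.transpose * R)⁻¹ * R.transpose := by
    rw [← Matrix.mul_assoc, factorPinv_mul_left hL]
  refine ⟨?_, ?_, ?_, ?_⟩
  · rw [e1, ← Matrix.mul_assoc, Matrix.mul_assoc L, Matrix.mul_assoc (L.transpose * L)⁻¹,
      inv_mul_of_isUnit hL, Matrix.mul_one]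
  · rw [e2, Matrix.mul_assoc, transpose_mul_factorPinv hR, factorPinv]
  · rw [e1]
    simp only [Matrix.transpose_mul, Matrix.transpose_transpose, Matrix.transpose_nonsing_inv,
      Matrix.mul_assoc]
  · rw [e2]
    simp only [Matrix.transpose_mul, Matrix.transpose_transpose, Matrix.transpose_nonsing_inv,
      Matrix.mul_assoc]

/-- The scaling by inverse Gram matrices is multiplication by the pseudo-inverse: R(RᵀR)⁻¹ = Z L,
and similarly on the other side. Hence the updated product depends on the factors only through L Rᵀ.
-/
theorem stepMap_factor (hL : IsUnit (L.transpose * L)) (hR : IsUnit (R.transpose * R)) (μ : ℝ)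
    (G : Matrix (Fin p) (Fin q) ℝ) :
    (L + μ • (G * R * (R.transpose * R)⁻¹)) *
      (R + μ • (G.transpose * L * (L.transpose * L)⁻¹)).transpose
      = stepMap μ (L * R.transpose) (factorPinv L R) G := by
  have e1 : (1 + μ • (G * factorPinv L R)) * L = L + μ • (G * R * (R.transpose * R)⁻¹) := by
    rw [Matrix.add_mul, Matrix.one_mul, Matrix.smul_mul, Matrix.mul_assoc, factorPinv_mul_left hL,
      Matrix.mul_assoc]
  have e2 : R.transpose * (1 + μ • (factorPinv L R * G)) =
      (R + μ • (G.transpose * L * (L.transpose * L)⁻¹)).transpose := by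
    rw [Matrix.mul_add, Matrix.mul_one, Matrix.mul_smul, ← Matrix.mul_assoc,
      transpose_mul_factorPinv hR]
    simp only [Matrix.transpose_add, Matrix.transpose_smul, Matrix.transpose_mul,
      Matrix.transpose_transpose, Matrix.transpose_nonsing_inv, Matrix.mul_assoc]
  rw [stepMap, ← Matrix.mul_assoc, e1, Matrix.mul_assoc _ R.transpose, e2]

variable {Xs : Matrix (Fin p) (Fin q) ℝ} {V : Matrix (Fin p) (Fin r) ℝ} {s : Fin r → ℝ}
  {W : Matrix (Fin q) (Fin r) ℝ} {σ : ℝ}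

/-- The compression of Y to the singular spaces of the target is diag(s) plus a perturbation of norm
less than σ. -/
theorem IsTarget.isUnit_core (h : IsTarget Xs V s W σ) {Y : Matrix (Fin p) (Fin q) ℝ}
    (hY : specNorm (Y - Xs) < σ) : IsUnit (V.transpose * Y * W) := by
  refine isUnit_of_mulVec_eq_zero fun a ha => ?_
  have e : V.transpose * Y * W = Matrix.diagonal s + V.transpose * ((Y - Xs) * W) := by
    rw [Matrix.sub_mul, Matrix.mul_sub, h.mul_W, ← Matrix.mul_assoc V.transpose V,
      h.left_orthonormal, Matrix.one_mul, Matrix.mul_assoc]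
    abel
  rw [e, Matrix.add_mulVec] at ha
  have h1 := le_vnorm_diagonal_mulVec h.pos.le h.le a
  have h2 : vnorm ((V.transpose * ((Y - Xs) * W)).mulVec a) ≤ specNorm (Y - Xs) * vnorm a := by
    refine (vnorm_mulVec_le _ _).trans (mul_le_mul_of_nonneg_right ?_ (vnorm_nonneg a))
    refine (specNorm_mul_le _ _).trans ?_
    rw [specNorm_transpose]
    refine (mul_le_of_le_one_left (specNorm_nonneg _)
      (specNorm_le_one_of_transpose_mul_self h.left_orthonormal)).trans ?_
    exact (specNorm_mul_le _ _).trans (mul_le_of_le_one_right (specNorm_nonneg _)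
      (specNorm_le_one_of_transpose_mul_self h.right_orthonormal))
  have h3 : (Matrix.diagonal s).mulVec a = -((V.transpose * ((Y - Xs) * W)).mulVec a) :=
    eq_neg_of_add_eq_zero_left ha
  have h4 := vnorm_sub_le 0 ((V.transpose * ((Y - Xs) * W)).mulVec a)
  rw [zero_sub, ← h3, vnorm_eq_zero.2 rfl, zero_add] at h4
  rw [← vnorm_eq_zero]
  nlinarith [vnorm_nonneg a]

theorem IsTarget.isUnit_factors (h : IsTarget Xs V s W σ)
    (hY : specNorm (L * R.transpose - Xs) < σ) :
    IsUnit (V.transpose * L) ∧ IsUnit (R.transpose * W) := by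
  have hu := h.isUnit_core hY
  have e : V.transpose * (L * R.transpose) * W = (V.transpose * L) * (R.transpose * W) := by
    simp only [Matrix.mul_assoc]
  rw [e, Matrix.isUnit_iff_isUnit_det, Matrix.det_mul, IsUnit.mul_iff] at hu
  exact ⟨(Matrix.isUnit_iff_isUnit_det _).2 hu.1, (Matrix.isUnit_iff_isUnit_det _).2 hu.2⟩

theorem IsTarget.isUnit_gram (h : IsTarget Xs V s W σ)
    (hY : specNorm (L * R.transpose - Xs) < σ) :
    IsUnit (L.transpose * L) ∧ IsUnit (R.transpose * R) := by
  obtain ⟨h1, h2⟩ := h.isUnit_factors hY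
  constructor
  · refine isUnit_transpose_mul_self fun a ha => ?_
    have : (V.transpose * L).mulVec a = 0 := by
      rw [← Matrix.mulVec_mulVec, ha, Matrix.mulVec_zero]
    exact (Matrix.mulVec_injective_iff_isUnit.2 h1) (by rw [this, Matrix.mulVec_zero])
  · refine isUnit_transpose_mul_self fun a ha => ?_
    have h2' : IsUnit (W.transpose * R) := by
      have := (Matrix.isUnit_transpose (A := R.transpose * W)).2 h2
      simpa using this
    have : (W.transpose * R).mulVec a = 0 := by
      rw [← Matrix.mulVec_mulVec, ha, Matrix.mulVec_zero]
    exact (Matrix.mulVec_injective_iff_isUnit.2 h2') (by rw [this, Matrix.mulVec_zero])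

/-- Since RᵀW is invertible, X Z u = X W a for some a, whence Z u = Z X W a and ‖Zu‖ ≤ ‖a‖. On the
range of W, X stretches by at least σ/2, so ‖a‖ ≤ 2‖XZu‖/σ ≤ 2‖u‖/σ. -/
theorem IsTarget.specNorm_pinv_le (h : IsTarget Xs V s W σ)
    (hY : 2 * specNorm (L * R.transpose - Xs) ≤ σ) {Z : Matrix (Fin q) (Fin p) ℝ}
    (hZ : IsPinv (L * R.transpose) Z) : specNorm Z ≤ 2 / σ := by
  have hσ := h.pos
  have hn := specNorm_nonneg (L * R.transpose - Xs)
  obtain ⟨-, hb⟩ := h.isUnit_factors (L := L) (R := R) (by linarith)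
  refine specNorm_le_of_vnorm (by positivity) fun u => ?_
  set a := (R.transpose * W)⁻¹.mulVec (R.transpose.mulVec (Z.mulVec u)) with ha
  have e1 : (L * R.transpose).mulVec (W.mulVec a) = (L * R.transpose * Z).mulVec u := by
    rw [ha, Matrix.mulVec_mulVec, Matrix.mulVec_mulVec, Matrix.mulVec_mulVec, Matrix.mulVec_mulVec]
    congr 1
    calc _ = L * ((R.transpose * W) * (R.transpose * W)⁻¹) * R.transpose * Z := by
          simp only [Matrix.mul_assoc]
      _ = _ := by rw [mul_inv_of_isUnit hb, Matrix.mul_one]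
  have e2 : Z.mulVec u = (Z * (L * R.transpose)).mulVec (W.mulVec a) := by
    rw [← Matrix.mulVec_mulVec, e1, Matrix.mulVec_mulVec, ← Matrix.mul_assoc, hZ.self_mul_mul]
  have h1 : vnorm (Z.mulVec u) ≤ vnorm a := by
    rw [e2, ← vnorm_mulVec_of_orthonormal h.right_orthonormal a]
    exact (vnorm_mulVec_le _ _).trans (mul_le_of_le_one_left (vnorm_nonneg _)
      hZ.projR.specNorm_le_one)
  have h2 := h.le_vnorm_of_near (L * R.transpose) a
  have h3 : vnorm ((L * R.transpose * Z).mulVec u) ≤ vnorm u :=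
    (vnorm_mulVec_le _ _).trans (mul_le_of_le_one_left (vnorm_nonneg _) hZ.projL.specNorm_le_one)
  rw [e1] at h2
  rw [div_mul_eq_mul_div, le_div_iff₀ hσ]
  nlinarith [vnorm_nonneg a]

/-- An explicit formula for the pseudo-inverse of a rank-`r` matrix close to `V diag(s) Wᵀ`. -/
noncomputable def pinvFn (V : Matrix (Fin p) (Fin r) ℝ) (W : Matrix (Fin q) (Fin r) ℝ)
    (Y : Matrix (Fin p) (Fin q) ℝ) : Matrix (Fin q) (Fin p) ℝ :=
  factorPinv (Y * W) ((V.transpose * Y * W)⁻¹ * (V.transpose * Y)).transpose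

/-- The skeleton decomposition Y = (YW)(VᵀYW)⁻¹(VᵀY) recovers a rank-r matrix from its core. It
gives factors, and so a pseudo-inverse, as an explicit and therefore measurable function of Y. -/
theorem IsTarget.isPinv_pinvFn (h : IsTarget Xs V s W σ)
    (hY : specNorm (L * R.transpose - Xs) < σ) :
    IsPinv (L * R.transpose) (pinvFn V W (L * R.transpose)) := by
  obtain ⟨ha, hb⟩ := h.isUnit_factors hY
  set Y := L * R.transpose with hYdef
  have e : Y = (Y * W) * ((V.transpose * Y * W)⁻¹ * (V.transpose * Y)).transpose.transpose := by
    have : V.transpose * Y * W = (V.transpose * L) * (R.transpose * W) := by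
      rw [hYdef]; simp only [Matrix.mul_assoc]
    rw [Matrix.transpose_transpose, this, Matrix.mul_inv_rev]
    calc Y = L * ((R.transpose * W) * (R.transpose * W)⁻¹) *
          ((V.transpose * L)⁻¹ * (V.transpose * L)) * R.transpose := by
            rw [mul_inv_of_isUnit hb, inv_mul_of_isUnit ha, Matrix.mul_one, Matrix.mul_one]
      _ = _ := by rw [hYdef]; simp only [Matrix.mul_assoc]
  have hY' := hY
  rw [e] at hY'
  obtain ⟨h1, h2⟩ := h.isUnit_gram hY'
  have := isPinv_factorPinv h1 h2
  rw [← e] at this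
  exact this

/-- The distance between factors is controlled by the Frobenius distance of the products. -/
theorem IsTarget.factorDist_le (h : IsTarget Xs V s W σ)
    (hY : 2 * specNorm (L * R.transpose - Xs) ≤ σ) :
    factorDist L R V s W ≤ 3 * frobNorm (L * R.transpose - Xs) := by
  have hσ := h.pos
  have hn := specNorm_nonneg (L * R.transpose - Xs)
  obtain ⟨-, hb⟩ := h.isUnit_factors (L := L) (R := R) (by linarith)
  set D := L * R.transpose - Xs with hD
  set b := R.transpose * W with hbdef
  have hs : ∀ k, 0 < s k := fun k => hσ.trans_le (h.le k)
  have hsq : sqrtDiag s * sqrtDiag s = Matrix.diagonal s := by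
    rw [sqrtDiag, Matrix.diagonal_mul_diagonal]
    congr 1; ext k; exact Real.mul_self_sqrt (hs k).le
  set B : Matrix (Fin r) (Fin r) ℝ := Matrix.diagonal fun k => (Real.sqrt (s k))⁻¹ with hB
  have hB1 : B * sqrtDiag s = 1 := by
    rw [hB, sqrtDiag, Matrix.diagonal_mul_diagonal, ← Matrix.diagonal_one]
    congr 1; ext k; exact inv_mul_cancel₀ (Real.sqrt_pos.2 (hs k)).ne'
  have hB2 : sqrtDiag s * B = 1 := mul_eq_one_comm.1 hB1
  -- The choice Q = RᵀW Σ^(−1/2) gives L Q Σ^(1/2) = X W, while V Σ = X⋆W; the first block of the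
  -- distance becomes exactly (X − X⋆)W.
  set Q : GL (Fin r) ℝ := ⟨b * B, sqrtDiag s * b⁻¹,
    by rw [Matrix.mul_assoc, ← Matrix.mul_assoc B, hB1, Matrix.one_mul, mul_inv_of_isUnit hb],
    by rw [Matrix.mul_assoc, ← Matrix.mul_assoc b⁻¹, inv_mul_of_isUnit hb, Matrix.one_mul, hB2]⟩
    with hQ
  have hQ1 : (Q : Matrix (Fin r) (Fin r) ℝ) = b * B := rfl
  have hQ2 : ((Q⁻¹ : GL (Fin r) ℝ) : Matrix (Fin r) (Fin r) ℝ) = sqrtDiag s * b⁻¹ := rfl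
  have hWn := specNorm_le_one_of_transpose_mul_self h.right_orthonormal
  have hVn := specNorm_le_one_of_transpose_mul_self h.left_orthonormal
  have e1 : (L * (Q : Matrix (Fin r) (Fin r) ℝ) - V * sqrtDiag s) * sqrtDiag s = D * W := by
    rw [hQ1, Matrix.sub_mul, Matrix.mul_assoc V, hsq, ← h.mul_W, Matrix.mul_assoc L,
      Matrix.mul_assoc b, hB1, Matrix.mul_one, hD, Matrix.sub_mul, hbdef, Matrix.mul_assoc]
  have t1 : frobNorm ((L * (Q : Matrix (Fin r) (Fin r) ℝ) - V * sqrtDiag s) * sqrtDiag s)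
      ≤ frobNorm D := by
    rw [e1]
    exact (frobNorm_mul_le_right _ _).trans (mul_le_of_le_one_right (frobNorm_nonneg _) hWn)
  set J := b⁻¹ * R.transpose with hJ
  have e2 : (R * ((Q⁻¹ : GL (Fin r) ℝ) : Matrix (Fin r) (Fin r) ℝ).transpose - W * sqrtDiag s)
      * sqrtDiag s = (Matrix.diagonal s * (J - W.transpose)).transpose := by
    rw [hQ2, hJ]
    have : (sqrtDiag s).transpose = sqrtDiag s := Matrix.diagonal_transpose _
    simp only [Matrix.transpose_mul, Matrix.transpose_sub, Matrix.transpose_transpose,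
      Matrix.diagonal_transpose, this, Matrix.sub_mul, Matrix.mul_assoc, hsq]
  have hJW : J * W = 1 := by rw [hJ, Matrix.mul_assoc, ← hbdef, inv_mul_of_isUnit hb]
  -- A fixed-point identity for the second block. Its last term is at most half of the left side
  -- because ‖X − X⋆‖ ≤ σ/2, so it is absorbed at the cost of a factor 2; the two blocks then add up
  -- to √5 ≤ 3.
  have e3 : Matrix.diagonal s * (J - W.transpose) =
      V.transpose * (D * (1 - W * W.transpose)) - V.transpose * (D * W * (J - W.transpose)) := by
    have hXW : Xs * (1 - W * W.transpose) = 0 := by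
      rw [Matrix.mul_sub, Matrix.mul_one, ← Matrix.mul_assoc, h.mul_W, h.eq_mul, sub_self]
    have f1 : D * (1 - W * W.transpose) = L * b * (J - W.transpose) := by
      rw [hD, Matrix.sub_mul, hXW, sub_zero, Matrix.mul_sub (L * b), hJ, Matrix.mul_assoc L b,
        ← Matrix.mul_assoc b, mul_inv_of_isUnit hb, Matrix.one_mul, Matrix.mul_sub, Matrix.mul_one,
        hbdef]
      simp only [Matrix.mul_assoc]
    have f2 : L * b = V * Matrix.diagonal s + D * W := by
      rw [hD, Matrix.sub_mul, h.mul_W, hbdef, Matrix.mul_assoc]; abel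
    rw [f1, f2, ← Matrix.mul_sub, ← Matrix.sub_mul, add_sub_cancel_right, Matrix.mul_assoc,
      ← Matrix.mul_assoc V.transpose, h.left_orthonormal, Matrix.one_mul]
  set τ := frobNorm (Matrix.diagonal s * (J - W.transpose)) with hτ
  have t2 : frobNorm (J - W.transpose) ≤ σ⁻¹ * τ := by
    have : J - W.transpose = (Matrix.diagonal fun k => (s k)⁻¹) *
        (Matrix.diagonal s * (J - W.transpose)) := by
      rw [← Matrix.mul_assoc, Matrix.diagonal_mul_diagonal]
      have : (fun k => (s k)⁻¹ * s k) = fun _ => 1 := by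
        ext k; exact inv_mul_cancel₀ (hs k).ne'
      rw [this, Matrix.diagonal_one, Matrix.one_mul]
    rw [this]
    exact (frobNorm_mul_le_left _ _).trans (mul_le_mul_of_nonneg_right
      (specNorm_diagonal_inv_le hσ h.le) (frobNorm_nonneg _))
  have hP : IsProj (W * W.transpose) :=
    ⟨by rw [Matrix.transpose_mul, Matrix.transpose_transpose],
      by rw [← Matrix.mul_assoc, Matrix.mul_assoc W, h.right_orthonormal, Matrix.mul_one]⟩
  have hVt : ∀ {l : ℕ} (M : Matrix (Fin p) (Fin l) ℝ),
      frobNorm (V.transpose * M) ≤ frobNorm M := fun M =>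
    (frobNorm_mul_le_left _ _).trans (mul_le_of_le_one_left (frobNorm_nonneg _)
      (by rwa [specNorm_transpose]))
  have t3 : τ ≤ frobNorm D + specNorm D * frobNorm (J - W.transpose) := by
    rw [hτ, e3]
    refine (frobNorm_sub_le _ _).trans (add_le_add ((hVt _).trans ?_) ((hVt _).trans ?_))
    · exact (frobNorm_mul_le_right _ _).trans (mul_le_of_le_one_right (frobNorm_nonneg _)
        hP.compl.specNorm_le_one)
    · refine (frobNorm_mul_le_left _ _).trans (mul_le_mul_of_nonneg_right ?_ (frobNorm_nonneg _))
      exact (specNorm_mul_le _ _).trans (mul_le_of_le_one_right (specNorm_nonneg _) hWn)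
  have t4 : τ ≤ 2 * frobNorm D := by
    have hτ0 : 0 ≤ τ := frobNorm_nonneg _
    have : specNorm D * frobNorm (J - W.transpose) ≤ 1 / 2 * τ := by
      calc _ ≤ (σ / 2) * (σ⁻¹ * τ) := mul_le_mul (by linarith) t2 (frobNorm_nonneg _) (by positivity)
        _ = 1 / 2 * τ := by field_simp
    linarith
  have d0 := frobNorm_nonneg D
  unfold factorDist
  refine Real.sqrt_le_iff.2 ⟨by positivity, ?_⟩
  refine (ciInf_le ⟨0, ?_⟩ Q).trans ?_
  · rintro _ ⟨Q, rfl⟩; positivity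
  · rw [e2, frobNorm_transpose]
    have a1 := pow_le_pow_left₀ (frobNorm_nonneg _) t1 2
    have a2 := pow_le_pow_left₀ (frobNorm_nonneg _) t4 2
    nlinarith

end Factors

/-! ### Smallness of an operator on low-rank matrices. -/

section RestrictedIsometry

variable {p q : ℕ}

/-- `E` is small as a bilinear form on matrices of rank at most `k`. -/
def RestrictedSmall (E : Matrix (Fin p) (Fin q) ℝ →ₗ[ℝ] Matrix (Fin p) (Fin q) ℝ) (k : ℕ)
    (δ : ℝ) : Prop :=
  ∀ X Y : Matrix (Fin p) (Fin q) ℝ, X.rank ≤ k → Y.rank ≤ k →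
    |ip (E X) Y| ≤ δ * frobNorm X * frobNorm Y

variable {E : Matrix (Fin p) (Fin q) ℝ →ₗ[ℝ] Matrix (Fin p) (Fin q) ℝ} {k : ℕ} {δ : ℝ}

theorem RestrictedSmall.mono (h : RestrictedSmall E k δ) {l : ℕ} (hl : l ≤ k) :
    RestrictedSmall E l δ := fun X Y hX hY => h X Y (hX.trans hl) (hY.trans hl)

/-- Test H against T = PH, which has rank at most k and satisfies ⟨H, PH⟩ = ‖PH‖_F². -/
theorem frobNorm_proj_mul_le_of_forall {P : Matrix (Fin p) (Fin p) ℝ} (hP : IsProj P)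
    (hPk : P.rank ≤ k) {H : Matrix (Fin p) (Fin q) ℝ} {a : ℝ} (ha : 0 ≤ a)
    (hH : ∀ T : Matrix (Fin p) (Fin q) ℝ, T.rank ≤ k → |ip H T| ≤ a * frobNorm T) :
    frobNorm (P * H) ≤ a := by
  have h1 := hH (P * H) ((Matrix.rank_mul_le_left _ _).trans hPk)
  have h2 : ip H (P * H) = frobNorm (P * H) ^ 2 := by
    rw [← ip_self, ip_mul_left, hP.symm, ← Matrix.mul_assoc, hP.idem]
  rw [h2, abs_of_nonneg (sq_nonneg _)] at h1
  rcases (frobNorm_nonneg (P * H)).eq_or_lt with h0 | h0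
  · rw [← h0]; exact ha
  · nlinarith

theorem frobNorm_mul_proj_le_of_forall {R : Matrix (Fin q) (Fin q) ℝ} (hR : IsProj R)
    (hRk : R.rank ≤ k) {H : Matrix (Fin p) (Fin q) ℝ} {a : ℝ} (ha : 0 ≤ a)
    (hH : ∀ T : Matrix (Fin p) (Fin q) ℝ, T.rank ≤ k → |ip H T| ≤ a * frobNorm T) :
    frobNorm (H * R) ≤ a := by
  have h1 := hH (H * R) ((Matrix.rank_mul_le_right _ _).trans hRk)
  have h2 : ip H (H * R) = frobNorm (H * R) ^ 2 := by
    rw [← ip_self, ip_mul_right, hR.symm, Matrix.mul_assoc, hR.idem]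
  rw [h2, abs_of_nonneg (sq_nonneg _)] at h1
  rcases (frobNorm_nonneg (H * R)).eq_or_lt with h0 | h0
  · rw [← h0]; exact ha
  · nlinarith

theorem RestrictedSmall.specNorm_le (h : RestrictedSmall E k δ) (hk : 1 ≤ k) (hδ : 0 ≤ δ)
    {X : Matrix (Fin p) (Fin q) ℝ} (hX : X.rank ≤ k) : specNorm (E X) ≤ δ * frobNorm X := by
  refine specNorm_le_of_forall_outer (mul_nonneg hδ (frobNorm_nonneg _)) fun w z hw hz => ?_
  have := h X (outer w z) hX ((rank_outer_le w z).trans hk)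
  rwa [frobNorm_outer_unit hw hz, mul_one, ip_comm] at this

end RestrictedIsometry

/-! ### Projecting out one rank-one direction. -/

section Probe

variable {p q : ℕ}

/-- The projection onto the orthogonal complement of a unit-norm matrix `B`. -/
noncomputable def removeProbe (B : Matrix (Fin p) (Fin q) ℝ) :
    Matrix (Fin p) (Fin q) ℝ →ₗ[ℝ] Matrix (Fin p) (Fin q) ℝ where
  toFun X := X - ip B X • B
  map_add' X Y := by rw [ip_add_right]; module
  map_smul' c X := by simp only [ip_smul_right, RingHom.id_apply]; module

theorem removeProbe_apply (B X : Matrix (Fin p) (Fin q) ℝ) :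
    removeProbe B X = X - ip B X • B := rfl

theorem ip_removeProbe (B X Y : Matrix (Fin p) (Fin q) ℝ) :
    ip (removeProbe B X) Y = ip X (removeProbe B Y) := by
  simp only [removeProbe_apply, ip_sub_left, ip_sub_right, ip_smul_left, ip_smul_right, ip_comm X B]
  ring

variable {B : Matrix (Fin p) (Fin q) ℝ}

theorem ip_removeProbe_self (hB : ip B B = 1) (X : Matrix (Fin p) (Fin q) ℝ) :
    ip (removeProbe B X) B = 0 := by
  rw [removeProbe_apply, ip_sub_left, ip_smul_left, hB, ip_comm]; ring

theorem frobNorm_removeProbe_le (hB : ip B B = 1) (X : Matrix (Fin p) (Fin q) ℝ) :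
    frobNorm (removeProbe B X) ≤ frobNorm X := by
  refine le_of_sq_le_sq ?_ (frobNorm_nonneg _)
  rw [← ip_self, ← ip_self, ip_comm, removeProbe_apply, ip_sub_left, ip_smul_left, ip_comm B (_ - _),
    ← removeProbe_apply, ip_removeProbe_self hB, removeProbe_apply, ip_sub_right, ip_smul_right,
    ip_comm X B]
  nlinarith [mul_self_nonneg (ip B X)]

theorem rank_removeProbe_le (hB : B.rank ≤ 1) (X : Matrix (Fin p) (Fin q) ℝ) :
    (removeProbe B X).rank ≤ X.rank + 1 := by
  rw [removeProbe_apply]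
  exact (rank_sub_le _ _).trans (by gcongr; exact (rank_smul_le _ _).trans hB)

/-- The operator `E` with the direction `B` decoupled. -/
noncomputable def decoupled (E : Matrix (Fin p) (Fin q) ℝ →ₗ[ℝ] Matrix (Fin p) (Fin q) ℝ)
    (B : Matrix (Fin p) (Fin q) ℝ) : Matrix (Fin p) (Fin q) ℝ →ₗ[ℝ] Matrix (Fin p) (Fin q) ℝ :=
  removeProbe B ∘ₗ E ∘ₗ removeProbe B

theorem decoupled_apply (E : Matrix (Fin p) (Fin q) ℝ →ₗ[ℝ] Matrix (Fin p) (Fin q) ℝ)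
    (B X : Matrix (Fin p) (Fin q) ℝ) :
    decoupled E B X = removeProbe B (E (removeProbe B X)) := rfl

variable {E : Matrix (Fin p) (Fin q) ℝ →ₗ[ℝ] Matrix (Fin p) (Fin q) ℝ} {k : ℕ} {δ : ℝ}

/-- Removing B raises the rank by at most one and does not increase the Frobenius norm. -/
theorem RestrictedSmall.decouple (h : RestrictedSmall E (k + 1) δ) (hδ : 0 ≤ δ)
    (hB : ip B B = 1) (hB1 : B.rank ≤ 1) : RestrictedSmall (decoupled E B) k δ := by
  intro X Y hX hY
  rw [decoupled_apply, ip_removeProbe]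
  refine (h _ _ ((rank_removeProbe_le hB1 X).trans (by omega))
    ((rank_removeProbe_le hB1 Y).trans (by omega))).trans ?_
  have h1 := frobNorm_removeProbe_le hB X
  have h2 := frobNorm_removeProbe_le hB Y
  exact mul_le_mul (mul_le_mul_of_nonneg_left h1 hδ) h2 (frobNorm_nonneg _)
    (mul_nonneg hδ (frobNorm_nonneg _))

/-- The effect of decoupling is controlled by the component along `B` and by the interaction of `B`
with its complement. -/
theorem RestrictedSmall.abs_ip_sub_decoupled_le (h : RestrictedSmall E k δ) (hk : 1 ≤ k)
    (hB : ip B B = 1) (hB1 : B.rank ≤ 1) (Y : Matrix (Fin p) (Fin q) ℝ)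
    {T : Matrix (Fin p) (Fin q) ℝ} (hT : T.rank ≤ k) :
    |ip (E Y - decoupled E B Y) T| ≤
      (|ip B Y| * δ + |ip (E (removeProbe B Y)) B|) * frobNorm T := by
  have hBF : frobNorm B = 1 := by
    have := ip_self B
    rw [hB] at this
    exact (pow_eq_one_iff_of_nonneg (frobNorm_nonneg _) two_ne_zero).1 this.symm
  -- Splitting Y and T along B leaves a term with ⟨B, Y⟩, handled by restricted smallness, and one
  -- with ⟨E ΠY, B⟩, the quantity that the Gaussian tail bounds control.
  have e : ip (E Y - decoupled E B Y) T
      = ip B Y * ip (E B) T + ip B T * ip (E (removeProbe B Y)) B := by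
    have hY : E Y = E (removeProbe B Y) + ip B Y • E B := by
      rw [← map_smul, ← map_add, removeProbe_apply, sub_add_cancel]
    rw [ip_sub_left, decoupled_apply, ip_removeProbe, hY, ip_add_left, ip_smul_left,
      removeProbe_apply B T, ip_sub_right, ip_smul_right]
    ring
  have h1 := h B T (hB1.trans hk) hT
  have h2 := abs_ip_le B T
  rw [hBF, mul_one] at h1
  rw [hBF, one_mul] at h2
  rw [e]
  refine (abs_add_le _ _).trans ?_
  rw [abs_mul, abs_mul]
  have h3 := mul_le_mul_of_nonneg_left h1 (abs_nonneg (ip B Y))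
  have h4 := mul_le_mul_of_nonneg_right h2 (abs_nonneg (ip (E (removeProbe B Y)) B))
  linarith

end Probe

/-! ### Contraction and stability of the step near the target. -/

section LocalSteps

variable {p q r : ℕ}

/-- `X` is a product `L Rᵀ` of factors with `r` columns. -/
def HasWidth (r : ℕ) (X : Matrix (Fin p) (Fin q) ℝ) : Prop :=
  ∃ (L : Matrix (Fin p) (Fin r) ℝ) (R : Matrix (Fin q) (Fin r) ℝ), X = L * R.transpose

theorem HasWidth.rank_le {X : Matrix (Fin p) (Fin q) ℝ} (h : HasWidth r X) : X.rank ≤ r := by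
  obtain ⟨L, R, rfl⟩ := h
  exact rank_mul_transpose_le L R

theorem HasWidth.step {X : Matrix (Fin p) (Fin q) ℝ} (h : HasWidth r X) (μ : ℝ)
    (Z : Matrix (Fin q) (Fin p) ℝ) (G : Matrix (Fin p) (Fin q) ℝ) :
    HasWidth r (stepMap μ X Z G) := by
  obtain ⟨L, R, rfl⟩ := h
  refine ⟨(1 + μ • (G * Z) : Matrix (Fin p) (Fin p) ℝ) * L, (1 + μ • (Z * G) : Matrix (Fin q) (Fin q) ℝ).transpose * R, ?_⟩
  rw [stepMap, Matrix.transpose_mul, Matrix.transpose_transpose]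
  simp only [Matrix.mul_assoc]

variable {Xs : Matrix (Fin p) (Fin q) ℝ} {V : Matrix (Fin p) (Fin r) ℝ} {s : Fin r → ℝ}
  {W : Matrix (Fin q) (Fin r) ℝ} {σ : ℝ}

theorem IsTarget.hasWidth (h : IsTarget Xs V s W σ) : HasWidth r Xs :=
  ⟨V * Matrix.diagonal s, W, h.eq_mul⟩

theorem IsTarget.pinv_of_near (h : IsTarget Xs V s W σ) {X : Matrix (Fin p) (Fin q) ℝ}
    (hX : HasWidth r X) (hn : 2 * specNorm (X - Xs) ≤ σ) :
    IsPinv X (pinvFn V W X) ∧ specNorm (pinvFn V W X) ≤ 2 / σ := by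
  obtain ⟨L, R, rfl⟩ := hX
  have hσ := h.pos
  have h0 := specNorm_nonneg (L * R.transpose - Xs)
  have h1 := h.isPinv_pinvFn (L := L) (R := R) (by linarith)
  exact ⟨h1, h.specNorm_pinv_le hn h1⟩

theorem IsTarget.exists_pinv (h : IsTarget Xs V s W σ) :
    ∃ Zs : Matrix (Fin q) (Fin p) ℝ, Xs * Zs * Xs = Xs ∧ specNorm Zs ≤ 2 / σ := by
  obtain ⟨h1, h2⟩ := h.pinv_of_near h.hasWidth (by
    rw [sub_self, specNorm_eq_zero.2 rfl]; linarith [h.pos])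
  exact ⟨_, h1.mul_mul_self, h2⟩

theorem HasWidth.rank_sub_le {X Y : Matrix (Fin p) (Fin q) ℝ} (hX : HasWidth r X)
    (hY : HasWidth r Y) : (X - Y).rank ≤ 2 * r :=
  (MatrixSensing.rank_sub_le _ _).trans (by linarith [hX.rank_le, hY.rank_le])

variable {E : Matrix (Fin p) (Fin q) ℝ →ₗ[ℝ] Matrix (Fin p) (Fin q) ℝ} {δ c μ : ℝ}
  {X : Matrix (Fin p) (Fin q) ℝ}

/-- The scaled gradient step on the product, with gradient operator `1 + E`. -/
noncomputable def gdStep (E : Matrix (Fin p) (Fin q) ℝ →ₗ[ℝ] Matrix (Fin p) (Fin q) ℝ) (μ : ℝ)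
    (Xs : Matrix (Fin p) (Fin q) ℝ) (V : Matrix (Fin p) (Fin r) ℝ) (W : Matrix (Fin q) (Fin r) ℝ)
    (X : Matrix (Fin p) (Fin q) ℝ) : Matrix (Fin p) (Fin q) ℝ :=
  stepMap μ X (pinvFn V W X) (-((X - Xs) + E (X - Xs)))

/-- Linear convergence of the Frobenius error in a spectral neighbourhood of the target. -/
theorem IsTarget.frobNorm_gdStep_le (h : IsTarget Xs V s W σ) (hX : HasWidth r X)
    (hE : RestrictedSmall E (2 * r) δ) (hδ0 : 0 ≤ δ) (hδ : δ ≤ 1 / 10000) (hc0 : 0 < c)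
    (hc : c ≤ 1 / 1000) (hμ0 : 0 ≤ μ) (hμ : μ ≤ 1 / 32) (h1 : specNorm (X - Xs) ≤ 2 * c * σ)
    (h2 : specNorm (E (X - Xs)) ≤ c * σ) :
    frobNorm (gdStep E μ Xs V W X - Xs) ≤ (1 - μ / 2) * frobNorm (X - Xs) := by
  have hσ := h.pos
  obtain ⟨hZ, hZn⟩ := h.pinv_of_near hX (by nlinarith)
  obtain ⟨Zs, hZs, hZsn⟩ := h.exists_pinv
  have key := isIdealNorm_frobNorm.error_step (H := E (X - Xs)) hZ hZs hμ0 (by linarith)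
  set d := frobNorm (X - Xs)
  have d0 : 0 ≤ d := frobNorm_nonneg _
  have hr : (X - Xs).rank ≤ 2 * r := hX.rank_sub_le h.hasWidth
  -- X − X⋆ has rank at most 2r, and the step sees E(X − X⋆) in Frobenius norm only through rank-r
  -- projections, so its contribution is δ times the error itself.
  have hT : ∀ T : Matrix (Fin p) (Fin q) ℝ, T.rank ≤ 2 * r →
      |ip (E (X - Xs)) T| ≤ δ * d * frobNorm T := fun T hT => hE _ _ hr hT
  have hXr := hX.rank_le
  have t1 := frobNorm_proj_mul_le_of_forall hZ.projL
    ((Matrix.rank_mul_le_left _ _).trans (by omega)) (mul_nonneg hδ0 d0) hT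
  have t2 := frobNorm_mul_proj_le_of_forall hZ.projR
    ((Matrix.rank_mul_le_right _ _).trans (by omega)) (mul_nonneg hδ0 d0) hT
  have t3 : specNorm Zs * specNorm (X - Xs) ≤ 4 * c := by
    calc _ ≤ (2 / σ) * (2 * c * σ) := mul_le_mul hZsn h1 (specNorm_nonneg _) (by positivity)
      _ = 4 * c := by field_simp; ring
  have t4 : specNorm (pinvFn V W X) * (specNorm (X - Xs) + specNorm (E (X - Xs))) ≤ 6 * c := by
    calc _ ≤ (2 / σ) * (2 * c * σ + c * σ) := mul_le_mul hZn (add_le_add h1 h2)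
          (add_nonneg (specNorm_nonneg _) (specNorm_nonneg _)) (by positivity)
      _ = 6 * c := by field_simp; ring
  have t5 : (d + frobNorm (E (X - Xs) * (pinvFn V W X * X))) *
      (specNorm (pinvFn V W X) * (specNorm (X - Xs) + specNorm (E (X - Xs)))) ≤
      (d + δ * d) * (6 * c) :=
    mul_le_mul (by linarith) t4 (mul_nonneg (specNorm_nonneg _)
      (add_nonneg (specNorm_nonneg _) (specNorm_nonneg _))) (by positivity)
  refine key.trans ?_
  have u1 := mul_le_mul_of_nonneg_left (mul_le_mul_of_nonneg_left t3 d0)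
    (by linarith : 0 ≤ 2 * μ)
  have u2 := mul_le_mul_of_nonneg_left (add_le_add t1 t2) hμ0
  have u3 := mul_le_mul_of_nonneg_left t5 (sq_nonneg μ)
  have hμd : 0 ≤ μ * d := mul_nonneg hμ0 d0
  have v1 : 2 * μ * (d * (4 * c)) ≤ 8 / 1000 * (μ * d) := by nlinarith
  have v2 : μ * (δ * d + δ * d) ≤ 2 / 10000 * (μ * d) := by nlinarith
  have v3 : μ ^ 2 * ((d + δ * d) * (6 * c)) ≤ 1 / 32 * (μ * d) := by
    have a1 : (1 + δ) * (6 * c) ≤ 1 := by nlinarith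
    have a2 : μ * ((1 + δ) * (6 * c)) ≤ 1 / 32 := by
      have : 0 ≤ (1 + δ) * (6 * c) := by positivity
      nlinarith
    calc _ = (μ * ((1 + δ) * (6 * c))) * (μ * d) := by ring
      _ ≤ _ := mul_le_mul_of_nonneg_right a2 hμd
  linarith

/-- The spectral error does not leave a neighbourhood of the target. -/
theorem IsTarget.specNorm_gdStep_le (h : IsTarget Xs V s W σ) (hX : HasWidth r X) (hc0 : 0 < c)
    (hc : c ≤ 1 / 1000) (hμ0 : 0 ≤ μ) (hμ : μ ≤ 1 / 32) (h1 : specNorm (X - Xs) ≤ c * σ)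
    (h2 : specNorm (E (X - Xs)) ≤ c * σ / 100) :
    specNorm (gdStep E μ Xs V W X - Xs) ≤ c * σ := by
  have hσ := h.pos
  obtain ⟨hZ, hZn⟩ := h.pinv_of_near hX (by nlinarith)
  obtain ⟨Zs, hZs, hZsn⟩ := h.exists_pinv
  have key := isIdealNorm_specNorm.error_step (H := E (X - Xs)) hZ hZs hμ0 (by linarith)
  set d := specNorm (X - Xs)
  have d0 : 0 ≤ d := specNorm_nonneg _
  set a := c * σ with ha
  have a0 : 0 < a := mul_pos hc0 hσ
  have t1 : specNorm (X * pinvFn V W X * E (X - Xs)) ≤ a / 100 :=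
    (specNorm_mul_le _ _).trans ((mul_le_of_le_one_left (specNorm_nonneg _)
      hZ.projL.specNorm_le_one).trans h2)
  have t2 : specNorm (E (X - Xs) * (pinvFn V W X * X)) ≤ a / 100 :=
    (specNorm_mul_le _ _).trans ((mul_le_of_le_one_right (specNorm_nonneg _)
      hZ.projR.specNorm_le_one).trans h2)
  have t3 : specNorm Zs * d ≤ 2 * c := by
    calc _ ≤ (2 / σ) * (c * σ) := mul_le_mul hZsn h1 d0 (by positivity)
      _ = 2 * c := by field_simp
  have t4 : specNorm (pinvFn V W X) * (d + specNorm (E (X - Xs))) ≤ 4 * c := by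
    calc _ ≤ (2 / σ) * (c * σ + c * σ) := mul_le_mul hZn (by linarith)
          (add_nonneg d0 (specNorm_nonneg _)) (by positivity)
      _ = 4 * c := by field_simp; ring
  have t5 : (d + specNorm (E (X - Xs) * (pinvFn V W X * X))) *
      (specNorm (pinvFn V W X) * (d + specNorm (E (X - Xs)))) ≤ (2 * a) * (4 * c) :=
    mul_le_mul (by linarith) t4 (mul_nonneg (specNorm_nonneg _)
      (add_nonneg d0 (specNorm_nonneg _))) (by positivity)
  refine key.trans ?_
  have u0 : (1 - μ) * d ≤ (1 - μ) * a := mul_le_mul_of_nonneg_left h1 (by linarith)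
  have u1 := mul_le_mul_of_nonneg_left (mul_le_mul h1 t3 (mul_nonneg (specNorm_nonneg _) d0)
    a0.le) (by linarith : 0 ≤ 2 * μ)
  have u2 := mul_le_mul_of_nonneg_left (add_le_add t1 t2) hμ0
  have u3 := mul_le_mul_of_nonneg_left t5 (sq_nonneg μ)
  have hμa : 0 ≤ μ * a := mul_nonneg hμ0 a0.le
  have v1 : 2 * μ * (a * (2 * c)) ≤ 4 / 1000 * (μ * a) := by nlinarith
  have v3 : μ ^ 2 * ((2 * a) * (4 * c)) ≤ 1 / 32 * (μ * a) := by
    have a2 : μ * (8 * c) ≤ 1 / 32 := by nlinarith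
    calc _ = (μ * (8 * c)) * (μ * a) := by ring
      _ ≤ _ := mul_le_mul_of_nonneg_right a2 hμa
  linarith

/-- The coefficients of μd beyond the contraction sum to less than 1/10. This leaves d(1 − 9μ/10)
plus a forcing of 7μa/10000, so the level a/100 is invariant. -/
theorem stability_scalar_bound {d a c μ k x : ℝ} (d0 : 0 ≤ d) (a0 : 0 ≤ a) (hc0 : 0 < c)
    (hc : c ≤ 1 / 1000) (hμ0 : 0 ≤ μ) (hμ : μ ≤ 1 / 32) (k0 : 0 ≤ k)
    (hk : k ≤ d / 10000 + 3 / 10000 * a) (hd : d ≤ a / 100) (hx : x ≤ 2 / 100 * c) :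
    (1 - μ) * d + 2 * μ * (d * x) + μ * (2 * k) + μ * (24 * c * d) +
      μ ^ 2 * (2 * ((d + k) * (6 * c)) + 108 * c ^ 2 * d) ≤ a / 100 := by
  have hμd : 0 ≤ μ * d := mul_nonneg hμ0 d0
  have hμa : 0 ≤ μ * a := mul_nonneg hμ0 a0
  have v1 : 2 * μ * (d * x) ≤ 1 / 1000 * (μ * d) := by
    have h1 : x ≤ 1 / 2000 := by linarith
    have h2 := mul_le_mul_of_nonneg_left h1 hμd
    linarith
  have v2 : μ * (2 * k) ≤ 2 / 10000 * (μ * d) + 6 / 10000 * (μ * a) := by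
    have := mul_le_mul_of_nonneg_left hk hμ0
    linarith
  have v3 : μ * (24 * c * d) ≤ 24 / 1000 * (μ * d) := by
    have := mul_le_mul_of_nonneg_right hc hμd
    linarith
  have v4 : μ ^ 2 * (2 * ((d + k) * (6 * c)) + 108 * c ^ 2 * d) ≤
      1 / 32 * (μ * d) + 1 / 10000 * (μ * a) := by
    have c2 : c ^ 2 ≤ 1 / 1000 * c := by nlinarith
    have b0 : 108 * c ^ 2 * d ≤ 1 / 2 * d := mul_le_mul_of_nonneg_right (by linarith) d0
    have b1 : 2 * ((d + k) * (6 * c)) + 108 * c ^ 2 * d ≤ d + 1 / 10000 * a := by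
      have : (d + k) * (6 * c) ≤ (2 * d + 3 / 10000 * a) * (6 / 1000) :=
        mul_le_mul (by linarith) (by linarith) (by positivity) (by positivity)
      linarith
    have b2 : μ ^ 2 ≤ 1 / 32 * μ := by nlinarith
    have b3 : 0 ≤ 2 * ((d + k) * (6 * c)) + 108 * c ^ 2 * d := by positivity
    calc _ ≤ (1 / 32 * μ) * (d + 1 / 10000 * a) := mul_le_mul b2 b1 b3 (by positivity)
      _ ≤ _ := by linarith
  have v6 : (1 - 9 / 10 * μ) * d ≤ (1 - 9 / 10 * μ) * (a / 100) :=
    mul_le_mul_of_nonneg_left hd (by linarith)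
  linarith

/-- Two scaled gradient sequences driven by nearby operators stay close. -/
theorem IsTarget.frobNorm_gdStep_sub_le (h : IsTarget Xs V s W σ) (hX : HasWidth r X)
    {Y : Matrix (Fin p) (Fin q) ℝ} (hY : HasWidth r Y)
    {E' : Matrix (Fin p) (Fin q) ℝ →ₗ[ℝ] Matrix (Fin p) (Fin q) ℝ}
    (hE : RestrictedSmall E (2 * r) δ) (hδ0 : 0 ≤ δ) (hδ : δ ≤ 1 / 10000) (hc0 : 0 < c)
    (hc : c ≤ 1 / 1000) (hμ0 : 0 ≤ μ) (hμ : μ ≤ 1 / 32) (h1 : specNorm (X - Xs) ≤ c * σ)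
    (h2 : specNorm (E (X - Xs)) ≤ c * σ) (h3 : specNorm (Y - Xs) ≤ 2 * c * σ)
    (h4 : specNorm (E' (Y - Xs)) ≤ c * σ) (hd : frobNorm (X - Y) ≤ c * σ / 100)
    (hφ : ∀ T : Matrix (Fin p) (Fin q) ℝ, T.rank ≤ 2 * r →
      |ip (E (Y - Xs) - E' (Y - Xs)) T| ≤ 3 / 10000 * (c * σ) * frobNorm T) :
    frobNorm (gdStep E μ Xs V W X - gdStep E' μ Xs V W Y) ≤ c * σ / 100 := by
  have hσ := h.pos
  obtain ⟨hZ, hZn⟩ := h.pinv_of_near hX (by nlinarith)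
  obtain ⟨hZy, hZyn⟩ := h.pinv_of_near hY (by nlinarith)
  set a := c * σ with ha
  have a0 : 0 < a := mul_pos hc0 hσ
  set d := frobNorm (X - Y) with hddef
  have d0 : 0 ≤ d := frobNorm_nonneg _
  set k := δ * d + 3 / 10000 * a with hk
  have k0 : 0 ≤ k := by positivity
  -- The gradient mismatch: E on the low-rank difference X − Y, which is δ-small, plus the two
  -- operators compared at the same point, which is the decoupling error.
  set K := E (X - Y) + (E (Y - Xs) - E' (Y - Xs)) with hK
  have hKT : ∀ T : Matrix (Fin p) (Fin q) ℝ, T.rank ≤ 2 * r → |ip K T| ≤ k * frobNorm T := by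
    intro T hT
    rw [hK, ip_add_left, hk, add_mul]
    exact (abs_add_le _ _).trans (add_le_add (hE _ _ (hX.rank_sub_le hY) hT) (hφ T hT))
  have hG : -((X - Xs) + E (X - Xs)) - -((Y - Xs) + E' (Y - Xs)) = -((X - Y) + K) := by
    have : E (X - Xs) = E (X - Y) + E (Y - Xs) := by rw [← map_add]; congr 1; abel
    rw [hK, this]; abel
  have hXr := hX.rank_le
  have hYr := hY.rank_le
  have key := hZ.stepMap_sub_le hZy hG hμ0 (by linarith) hZn hZyn (g := 3 * a)
    (by rw [specNorm_neg]; exact (specNorm_add_le _ _).trans (by linarith))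
    (by rw [specNorm_neg]; exact (specNorm_add_le _ _).trans (by linarith))
    (frobNorm_proj_mul_le_of_forall hZ.projL
      ((Matrix.rank_mul_le_left _ _).trans (by omega)) k0 hKT)
    (frobNorm_mul_proj_le_of_forall hZ.projR
      ((Matrix.rank_mul_le_right _ _).trans (by omega)) k0 hKT)
    (frobNorm_proj_mul_le_of_forall hZy.projL
      ((Matrix.rank_mul_le_left _ _).trans (by omega)) k0 hKT)
  rw [← hddef] at key
  refine key.trans ?_
  have e1 : 2 / σ * (3 * a) = 6 * c := by rw [ha]; field_simp; ring
  have e2 : 4 * (2 / σ) * d * (3 * a) = 24 * c * d := by rw [ha]; field_simp; ring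
  have e3 : 3 * (2 / σ) ^ 2 * d * (3 * a) ^ 2 = 108 * c ^ 2 * d := by rw [ha]; field_simp; ring
  have e4 : 2 / σ * d ≤ 2 / 100 * c := by
    calc 2 / σ * d ≤ 2 / σ * (c * σ / 100) := mul_le_mul_of_nonneg_left hd (by positivity)
      _ = 2 / 100 * c := by field_simp
  rw [e1, e2, e3]
  have hkk : k ≤ d / 10000 + 3 / 10000 * a := by rw [hk]; nlinarith
  exact stability_scalar_bound d0 a0.le hc0 hc hμ0 hμ k0 hkk hd e4

end LocalSteps

/-! ### The deterministic induction. -/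

section Induction

variable {p q r : ℕ} {Xs : Matrix (Fin p) (Fin q) ℝ} {V : Matrix (Fin p) (Fin r) ℝ}
  {s : Fin r → ℝ} {W : Matrix (Fin q) (Fin r) ℝ} {σ : ℝ}

theorem IsTarget.topSVD_trunc (h : IsTarget Xs V s W σ) {M : Matrix (Fin p) (Fin q) ℝ}
    {V' : Matrix (Fin p) (Fin r) ℝ} {s' : Fin r → ℝ} {W' : Matrix (Fin q) (Fin r) ℝ}
    (hM : IsTopSVD M V' s' W') (hε : 4 * specNorm (M - Xs) ≤ σ) :
    ∃ Z, IsTrunc M (V' * Matrix.diagonal s' * W'.transpose) Z ∧ specNorm Z ≤ 2 / σ ∧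
      specNorm (M - V' * Matrix.diagonal s' * W'.transpose) ≤ specNorm (M - Xs) := by
  have hσ := h.pos
  have hs : ∀ k, σ / 2 ≤ s' k := fun k => by
    have := h.sub_le_singVal M k.2
    rw [hM.singVal_eq]; linarith
  refine ⟨_, hM.isTrunc fun k => (by positivity : 0 < σ / 2).trans_le (hs k), ?_,
    hM.specNorm_residual_le h (by linarith)⟩
  have := hM.specNorm_pinv_le (by positivity) hs
  rwa [inv_div] at this

/-- `Y` is a truncated singular value decomposition of `M` with rank `r`, well conditioned at
scale `σ`, and as close to `M` as `Xs`. -/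
def IsGoodTrunc (r : ℕ) (σ : ℝ) (Xs M Y : Matrix (Fin p) (Fin q) ℝ) : Prop :=
  HasWidth r Y ∧ ∃ Z, IsTrunc M Y Z ∧ specNorm Z ≤ 2 / σ ∧ specNorm (M - Y) ≤ specNorm (M - Xs)

theorem IsTarget.isGoodTrunc (h : IsTarget Xs V s W σ) {M : Matrix (Fin p) (Fin q) ℝ}
    {V' : Matrix (Fin p) (Fin r) ℝ} {s' : Fin r → ℝ} {W' : Matrix (Fin q) (Fin r) ℝ}
    (hM : IsTopSVD M V' s' W') (hε : 4 * specNorm (M - Xs) ≤ σ) :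
    IsGoodTrunc r σ Xs M (V' * Matrix.diagonal s' * W'.transpose) :=
  ⟨⟨_, _, rfl⟩, h.topSVD_trunc hM hε⟩

theorem IsGoodTrunc.specNorm_sub_le {M Y : Matrix (Fin p) (Fin q) ℝ}
    (h : IsGoodTrunc r σ Xs M Y) : specNorm (Y - Xs) ≤ 2 * specNorm (M - Xs) := by
  obtain ⟨-, Z, -, -, h1⟩ := h
  have : Y - Xs = (M - Xs) - (M - Y) := by abel
  rw [this]
  exact (MatrixSensing.specNorm_sub_le _ _).trans (by linarith)

/-- The stability bound for truncations with ζ = 2/σ and residual e = σ/8, so that ζe = 1/4. The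
perturbation M − M' enters only through its pairing with low-rank matrices. -/
theorem IsGoodTrunc.frobNorm_sub_le {M M' X Y : Matrix (Fin p) (Fin q) ℝ} {k : ℕ}
    (h : IsGoodTrunc r σ Xs M X) (h' : IsGoodTrunc r σ Xs M' Y) (hσ : 0 < σ)
    (hM : 8 * specNorm (M - Xs) ≤ σ) (hM' : 8 * specNorm (M' - Xs) ≤ σ) (hrk : r ≤ k) {b : ℝ}
    (hb : 0 ≤ b) (hH : ∀ T : Matrix (Fin p) (Fin q) ℝ, T.rank ≤ k →
      |ip (M - M') T| ≤ b * frobNorm T) : frobNorm (X - Y) ≤ 5 * b := by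
  obtain ⟨hX, Z, hZ, hZn, hZr⟩ := h
  obtain ⟨hY, Zy, hZy, hZyn, hZyr⟩ := h'
  have hXr := hX.rank_le
  have hYr := hY.rank_le
  refine hZ.frobNorm_trunc_sub_le hZy hZn hZyn (e := σ / 8) (by linarith) (by linarith)
    (by rw [div_mul_div_comm, div_le_div_iff₀ (by positivity) (by norm_num)]; linarith) ?_ ?_ ?_ ?_
  · exact frobNorm_mul_proj_le_of_forall hZy.pinv.projR
      ((Matrix.rank_mul_le_right _ _).trans (by omega)) hb hH
  · exact frobNorm_proj_mul_le_of_forall hZy.pinv.projL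
      ((Matrix.rank_mul_le_left _ _).trans (by omega)) hb hH
  · exact frobNorm_mul_proj_le_of_forall hZ.pinv.projR
      ((Matrix.rank_mul_le_right _ _).trans (by omega)) hb hH
  · exact frobNorm_proj_mul_le_of_forall hZ.pinv.projL
      ((Matrix.rank_mul_le_left _ _).trans (by omega)) hb hH

variable {ι : Type*} {E : Matrix (Fin p) (Fin q) ℝ →ₗ[ℝ] Matrix (Fin p) (Fin q) ℝ}
  {δ c μ : ℝ} {B : ι → Matrix (Fin p) (Fin q) ℝ}

theorem specNorm_removeProbe_le {B : Matrix (Fin p) (Fin q) ℝ} (hB : ip B B = 1)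
    (hBs : ∀ M, |ip B M| ≤ specNorm M) (M : Matrix (Fin p) (Fin q) ℝ) :
    specNorm (removeProbe B M) ≤ 2 * specNorm M := by
  have hBF : frobNorm B = 1 := by
    have := ip_self B
    rw [hB] at this
    exact (pow_eq_one_iff_of_nonneg (frobNorm_nonneg _) two_ne_zero).1 this.symm
  rw [removeProbe_apply]
  refine (specNorm_sub_le _ _).trans ?_
  rw [specNorm_smul]
  have h1 := hBs M
  have h2 := (specNorm_le_frobNorm B).trans hBF.le
  nlinarith [abs_nonneg (ip B M), specNorm_nonneg B, specNorm_nonneg M]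

/-- The error operator applied to `Y` is controlled along `B` by its decoupled part. -/
theorem RestrictedSmall.abs_ip_probe_le {k : ℕ} (hE : RestrictedSmall E k δ) (hk : 1 ≤ k)
    {B : Matrix (Fin p) (Fin q) ℝ} (hB : ip B B = 1) (hB1 : B.rank ≤ 1)
    (Y : Matrix (Fin p) (Fin q) ℝ) :
    |ip (E Y) B| ≤ |ip (E (removeProbe B Y)) B| + |ip B Y| * δ := by
  have hBF : frobNorm B = 1 := by
    have := ip_self B
    rw [hB] at this
    exact (pow_eq_one_iff_of_nonneg (frobNorm_nonneg _) two_ne_zero).1 this.symm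
  have hY : E Y = E (removeProbe B Y) + ip B Y • E B := by
    rw [← map_smul, ← map_add, removeProbe_apply, sub_add_cancel]
  have h1 := hE B B (hB1.trans hk) (hB1.trans hk)
  rw [hBF, mul_one, mul_one] at h1
  rw [hY, ip_add_left, ip_smul_left]
  refine (abs_add_le _ _).trans ?_
  rw [abs_mul]
  gcongr

theorem RestrictedSmall.specNorm_decoupled_le {k : ℕ} (hE : RestrictedSmall E k δ) (hk : 1 ≤ k)
    (hδ : 0 ≤ δ) {B : Matrix (Fin p) (Fin q) ℝ} (hB : ip B B = 1) (hB1 : B.rank ≤ 1)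
    (hBs : ∀ M, |ip B M| ≤ specNorm M) (Y : Matrix (Fin p) (Fin q) ℝ) :
    specNorm (decoupled E B Y) ≤ 2 * (specNorm (E Y) + specNorm Y * δ) := by
  have hBF : frobNorm B = 1 := by
    have := ip_self B
    rw [hB] at this
    exact (pow_eq_one_iff_of_nonneg (frobNorm_nonneg _) two_ne_zero).1 this.symm
  rw [decoupled_apply]
  refine (specNorm_removeProbe_le hB hBs _).trans ?_
  have hY : E (removeProbe B Y) = E Y - ip B Y • E B := by
    rw [← map_smul, ← map_sub, removeProbe_apply]
  have h1 := hE.specNorm_le hk hδ (hB1.trans hk)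
  rw [hBF, mul_one] at h1
  have h2 : specNorm (E (removeProbe B Y)) ≤ specNorm (E Y) + specNorm Y * δ := by
    rw [hY]
    refine (specNorm_sub_le _ _).trans ?_
    rw [specNorm_smul]
    have := mul_le_mul (hBs Y) h1 (specNorm_nonneg _) (specNorm_nonneg _)
    linarith
  linarith

/-- Deterministic convergence of scaled gradient descent: if the error operator is small on
low-rank matrices and decouples from a family of auxiliary sequences along probing directions that
determine the spectral norm, then the error converges linearly. -/
theorem IsTarget.convergence (h : IsTarget Xs V s W σ) (hr : 1 ≤ r)
    (hE : RestrictedSmall E (3 * r) δ) (hδ0 : 0 ≤ δ) (hδ : δ ≤ 1 / 10000) (hc0 : 0 < c)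
    (hc : c ≤ 1 / 1000) (hμ0 : 0 ≤ μ) (hμ : μ ≤ 1 / 32)
    (hκ : δ * specNorm Xs ≤ c * σ / 10000)
    (hB : ∀ i, ip (B i) (B i) = 1) (hB1 : ∀ i, (B i).rank ≤ 1)
    (hBs : ∀ i M, |ip (B i) M| ≤ specNorm M)
    (hnet : ∀ (M : Matrix (Fin p) (Fin q) ℝ) (a : ℝ), 0 ≤ a → (∀ i, |ip (B i) M| ≤ a) →
      specNorm M ≤ 4 * a)
    {X : ℕ → Matrix (Fin p) (Fin q) ℝ} {Y : ι → ℕ → Matrix (Fin p) (Fin q) ℝ}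
    (hX0 : 4 * specNorm (E Xs) ≤ σ → IsGoodTrunc r σ Xs (Xs + E Xs) (X 0))
    (hXt : ∀ t, HasWidth r (X t) → 2 * specNorm (X t - Xs) ≤ σ →
      X (t + 1) = gdStep E μ Xs V W (X t))
    (hY0 : ∀ i, 8 * specNorm (decoupled E (B i) Xs) ≤ σ →
      IsGoodTrunc r σ Xs (Xs + decoupled E (B i) Xs) (Y i 0))
    (hYt : ∀ i t, Y i (t + 1) = gdStep (decoupled E (B i)) μ Xs V W (Y i t))
    (hψ0 : ∀ i, |ip (E (removeProbe (B i) Xs)) (B i)| ≤ c * σ / 10000)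
    (hψ : ∀ i t, HasWidth r (Y i t) →
      frobNorm (Y i t - Xs) ≤ 4 * Real.sqrt r * c * (1 - μ / 2) ^ t * σ →
      |ip (E (removeProbe (B i) (Y i t - Xs))) (B i)| ≤ c * σ / 10000) (t : ℕ) :
    HasWidth r (X t) ∧ specNorm (X t - Xs) ≤ c * σ ∧
      frobNorm (X t - Xs) ≤ 2 * Real.sqrt r * c * (1 - μ / 2) ^ t * σ := by
  have hσ := h.pos
  set a := c * σ with ha
  have a0 : 0 < a := mul_pos hc0 hσ
  have haσ : a ≤ σ / 1000 := by rw [ha]; nlinarith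
  have hk1 : 1 ≤ 3 * r := by omega
  have hE2 : RestrictedSmall E (2 * r) δ := hE.mono (by omega)
  -- Rank 3r is assumed so that 2r + 1 ≤ 3r leaves room for the direction removed; this uses r ≥ 1.
  have hEw : ∀ i, RestrictedSmall (decoupled E (B i)) (2 * r) δ := fun i =>
    (hE.mono (by omega) : RestrictedSmall E (2 * r + 1) δ).decouple hδ0 (hB i) (hB1 i)
  have hrank : ∀ {Z : Matrix (Fin p) (Fin q) ℝ}, HasWidth r Z →
      frobNorm (Z - Xs) ≤ 2 * Real.sqrt r * specNorm (Z - Xs) := by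
    intro Z hZ
    refine (frobNorm_le_sqrt_mul_specNorm (hZ.rank_sub_le h.hasWidth)).trans
      (mul_le_mul_of_nonneg_right ?_ (specNorm_nonneg _))
    push_cast
    rw [Real.sqrt_mul (by norm_num)]
    refine mul_le_mul_of_nonneg_right ?_ (Real.sqrt_nonneg _)
    rw [Real.sqrt_le_left (by norm_num)]
    norm_num
  -- The auxiliary sequences join the induction. Their Frobenius constant is 4 instead of 2, because
  -- their initial spectral error is only bounded by 2a.
  suffices H : HasWidth r (X t) ∧ specNorm (X t - Xs) ≤ a ∧
      frobNorm (X t - Xs) ≤ 2 * Real.sqrt r * c * (1 - μ / 2) ^ t * σ ∧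
      ∀ i, HasWidth r (Y i t) ∧ frobNorm (X t - Y i t) ≤ a / 100 ∧
        frobNorm (Y i t - Xs) ≤ 4 * Real.sqrt r * c * (1 - μ / 2) ^ t * σ from
    ⟨H.1, H.2.1, H.2.2.1⟩
  induction t with
  | zero =>
    -- The component along a probe needs δ‖X⋆‖ to be small against cσ; this forces δ of order 1/κ.
    have hEXs : specNorm (E Xs) ≤ 4 * (a / 10000 + a / 10000) := by
      refine hnet _ _ (by positivity) fun i => ?_
      rw [ip_comm]
      refine (hE.abs_ip_probe_le hk1 (hB i) (hB1 i) Xs).trans (add_le_add (hψ0 i) ?_)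
      refine (mul_le_mul_of_nonneg_right (hBs i Xs) hδ0).trans ?_
      linarith
    have hM : specNorm (Xs + E Xs - Xs) = specNorm (E Xs) := by rw [add_sub_cancel_left]
    have hX0' := hX0 (by linarith)
    have hXn := hX0'.specNorm_sub_le
    rw [hM] at hXn
    refine ⟨hX0'.1, by linarith, ?_, fun i => ?_⟩
    · refine (hrank hX0'.1).trans ?_
      rw [pow_zero, mul_one, mul_assoc _ c σ, ← ha]
      exact mul_le_mul_of_nonneg_left (by linarith) (by positivity)
    · have hEwXs : specNorm (decoupled E (B i) Xs) ≤ 2 * (8 * a / 10000 + a / 10000) := by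
        refine (hE.specNorm_decoupled_le hk1 hδ0 (hB i) (hB1 i) (hBs i) Xs).trans ?_
        linarith
      have hM' : specNorm (Xs + decoupled E (B i) Xs - Xs) = specNorm (decoupled E (B i) Xs) := by
        rw [add_sub_cancel_left]
      have hY0' := hY0 i (by linarith)
      have hYn := hY0'.specNorm_sub_le
      rw [hM'] at hYn
      refine ⟨hY0'.1, ?_, ?_⟩
      · have := hX0'.frobNorm_sub_le hY0' hσ (by linarith) (by linarith) (k := 3 * r) (by omega)
          (b := a / 10000 + a / 10000) (by positivity) (fun T hT => by
            rw [add_sub_add_left_eq_sub]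
            refine (hE.abs_ip_sub_decoupled_le hk1 (hB i) (hB1 i) Xs hT).trans
              (mul_le_mul_of_nonneg_right ?_ (frobNorm_nonneg _))
            have h1 := mul_le_mul_of_nonneg_right (hBs i Xs) hδ0
            have h2 := hψ0 i
            linarith)
        linarith
      · refine (hrank hY0'.1).trans ?_
        rw [pow_zero, mul_one, mul_assoc _ c σ, ← ha]
        have : (0 : ℝ) ≤ Real.sqrt r := Real.sqrt_nonneg _
        calc 2 * Real.sqrt r * specNorm (Y i 0 - Xs) ≤ 2 * Real.sqrt r * (2 * a) :=
              mul_le_mul_of_nonneg_left (by linarith) (by positivity)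
          _ = _ := by ring
  | succ t ih =>
    obtain ⟨hXw, hXn, hXF, hY⟩ := ih
    have hρ0 : 0 ≤ 1 - μ / 2 := by linarith
    have hYn : ∀ i, specNorm (Y i t - Xs) ≤ 2 * a := fun i => by
      have e : Y i t - Xs = (X t - Xs) - (X t - Y i t) := by abel
      rw [e]
      have h1 := specNorm_le_frobNorm (X t - Y i t)
      have h2 := (hY i).2.1
      exact (specNorm_sub_le _ _).trans (by linarith)
    have hψi : ∀ i, |ip (E (removeProbe (B i) (Y i t - Xs))) (B i)| ≤ a / 10000 := fun i =>
      hψ i t (hY i).1 (hY i).2.2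
    have hBY : ∀ i, |ip (B i) (Y i t - Xs)| * δ ≤ 2 * a * (1 / 10000) := fun i =>
      mul_le_mul ((hBs i _).trans (hYn i)) hδ hδ0 (by positivity)
    have hED : ∀ i, specNorm (E (X t - Y i t)) ≤ a / 100 * (1 / 10000) := fun i => by
      refine (hE2.specNorm_le (by omega) hδ0 (hXw.rank_sub_le (hY i).1)).trans ?_
      rw [mul_comm]
      exact mul_le_mul (hY i).2.1 hδ hδ0 (by positivity)
    have hEsplit : ∀ i, E (X t - Xs) = E (X t - Y i t) + E (Y i t - Xs) := fun i => by
      rw [← map_add]; congr 1; abel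
    -- The step that avoids a factor √r: against each probe, replace X by its own auxiliary iterate
    -- at cost δ‖X − Y‖_F, then use the tail bound for that iterate. Each probe is paired with a
    -- different sequence, and the net turns these bounds into a spectral norm.
    have hEX : specNorm (E (X t - Xs)) ≤ a / 100 := by
      have : specNorm (E (X t - Xs)) ≤ 4 * (a / 400) := by
        refine hnet _ _ (by positivity) fun i => ?_
        rw [hEsplit i, ip_add_right]
        refine (abs_add_le _ _).trans ?_
        have h1 := (hBs i _).trans (hED i)
        have h2 := hE.abs_ip_probe_le hk1 (hB i) (hB1 i) (Y i t - Xs)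
        rw [ip_comm] at h2
        linarith [hψi i, hBY i]
      linarith
    have hEY : ∀ i, specNorm (E (Y i t - Xs)) ≤ a / 50 := fun i => by
      have e : E (Y i t - Xs) = E (X t - Xs) - E (X t - Y i t) := by rw [hEsplit i]; abel
      rw [e]
      exact (specNorm_sub_le _ _).trans (by linarith [hED i])
    have hEwY : ∀ i, specNorm (decoupled E (B i) (Y i t - Xs)) ≤ a := fun i => by
      refine (hE.specNorm_decoupled_le hk1 hδ0 (hB i) (hB1 i) (hBs i) _).trans ?_
      have := mul_le_mul (hYn i) hδ hδ0 (by positivity)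
      linarith [hEY i]
    have hpow : ∀ x d : ℝ, d ≤ x * (1 - μ / 2) ^ t * σ →
        (1 - μ / 2) * d ≤ x * (1 - μ / 2) ^ (t + 1) * σ := fun x d hd => by
      have := mul_le_mul_of_nonneg_left hd hρ0
      calc _ ≤ _ := this
        _ = _ := by ring
    rw [hXt t hXw (by linarith)]
    refine ⟨hXw.step _ _ _, h.specNorm_gdStep_le hXw hc0 hc hμ0 hμ hXn hEX, ?_, fun i => ?_⟩
    · exact (h.frobNorm_gdStep_le hXw hE2 hδ0 hδ hc0 hc hμ0 hμ (by linarith)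
        (by linarith)).trans (hpow _ _ hXF)
    · rw [hYt i t]
      obtain ⟨hYw, hYD, hYF⟩ := hY i
      have hYn' : specNorm (Y i t - Xs) ≤ 2 * c * σ := by rw [mul_assoc]; exact hYn i
      refine ⟨hYw.step _ _ _, ?_, ?_⟩
      · refine h.frobNorm_gdStep_sub_le hXw hYw hE2 hδ0 hδ hc0 hc hμ0 hμ hXn (by linarith)
          hYn' (hEwY i) hYD fun T hT => ?_
        refine (hE.abs_ip_sub_decoupled_le hk1 (hB i) (hB1 i) (Y i t - Xs)
          (hT.trans (by omega))).trans (mul_le_mul_of_nonneg_right ?_ (frobNorm_nonneg _))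
        linarith [hψi i, hBY i]
      · exact (h.frobNorm_gdStep_le hYw (hEw i) hδ0 hδ hc0 hc hμ0 hμ hYn' (hEwY i)).trans
          (hpow _ _ hYF)

end Induction

/-! ### Nets for spheres, probes and low-rank matrices. -/

section Nets

/-- The unit sphere of a finite-dimensional normed space has a `1/2`-net of cardinality at most
`5 ^ dim`, on which linear functionals attain half of their norm. -/
theorem exists_sphere_net (E : Type*) [NormedAddCommGroup E] [NormedSpace ℝ E]
    [FiniteDimensional ℝ E] :
    ∃ N : Finset E, (∀ x ∈ N, ‖x‖ = 1) ∧ N.card ≤ 5 ^ Module.finrank ℝ E ∧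
      ∀ (f : E →ₗ[ℝ] ℝ) (c : ℝ), 0 ≤ c → (∀ x ∈ N, |f x| ≤ c) → ∀ x, |f x| ≤ 2 * c * ‖x‖ := by
  classical
  set S : Set (Finset E) := {s | (∀ x ∈ s, ‖x‖ = 1) ∧ ∀ x ∈ s, ∀ y ∈ s, x ≠ y → 1 / 2 ≤ ‖x - y‖}
    with hS
  have hcard : ∀ s ∈ S, s.card ≤ 5 ^ Module.finrank ℝ E := by
    rintro s ⟨h1, h2⟩
    -- The Besicovitch bound 5^dim concerns 1-separated points in the ball of radius 2; doubling
    -- brings a 1/2-separated subset of the unit sphere into that form.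
    have hinj : Function.Injective fun x : E => (2 : ℝ) • x := smul_right_injective E two_ne_zero
    rw [← Finset.card_image_of_injective s hinj]
    refine Besicovitch.card_le_of_separated _ ?_ ?_
    · simp only [Finset.mem_image]
      rintro _ ⟨x, hx, rfl⟩
      rw [norm_smul, h1 x hx]; simp
    · simp only [Finset.mem_image]
      rintro _ ⟨x, hx, rfl⟩ _ ⟨y, hy, rfl⟩ hxy
      have := h2 x hx y hy fun h => hxy (by rw [h])
      rw [← smul_sub, norm_smul, Real.norm_two]; linarith
  obtain ⟨N, hN, hmax⟩ : ∃ N ∈ S, ∀ s ∈ S, s.card ≤ N.card := by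
    set T : Set ℕ := {n | ∃ s ∈ S, s.card = n} with hT
    have hne : T.Nonempty := ⟨0, ∅, by simp [hS], rfl⟩
    have hbdd : BddAbove T := ⟨5 ^ Module.finrank ℝ E, by rintro _ ⟨s, hs, rfl⟩; exact hcard s hs⟩
    obtain ⟨N, hN, hNc⟩ := Nat.sSup_mem hne hbdd
    exact ⟨N, hN, fun s hs => by rw [hNc]; exact le_csSup hbdd ⟨s, hs, rfl⟩⟩
  refine ⟨N, hN.1, hcard N hN, fun f c hc hf => ?_⟩
  have hclose : ∀ x : E, ‖x‖ = 1 → ∃ y ∈ N, ‖x - y‖ ≤ 1 / 2 := by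
    intro x hx
    by_contra! hfar
    have hxN : x ∉ N := fun h => by
      have := hfar x h
      rw [sub_self, norm_zero] at this; linarith
    have := hmax (insert x N) ⟨fun y hy => ?_, fun y hy z hz hyz => ?_⟩
    · rw [Finset.card_insert_of_notMem hxN] at this; omega
    · rcases Finset.mem_insert.1 hy with rfl | hy
      · exact hx
      · exact hN.1 y hy
    · rcases Finset.mem_insert.1 hy with hy' | hy' <;>
        rcases Finset.mem_insert.1 hz with hz' | hz'
      · exact absurd (hy'.trans hz'.symm) hyz
      · rw [hy']; exact (hfar z hz').le
      · rw [hz', norm_sub_rev]; exact (hfar y hy').le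
      · exact hN.2 y hy' z hz' hyz
  set F := LinearMap.toContinuousLinearMap f with hF
  have hFf : ∀ x, F x = f x := fun x => rfl
  -- A point of the net within 1/2 of a unit vector loses at most half of the dual norm, so ‖F‖ ≤
  -- 2c.
  have hbound : ‖F‖ ≤ c + ‖F‖ / 2 := by
    refine ContinuousLinearMap.opNorm_le_bound _ (by positivity) fun x => ?_
    rcases eq_or_ne x 0 with rfl | hx
    · simp
    have hx0 : 0 < ‖x‖ := norm_pos_iff.2 hx
    obtain ⟨y, hy, hxy⟩ := hclose (‖x‖⁻¹ • x) (by
      rw [norm_smul, norm_inv, norm_norm, inv_mul_cancel₀ hx0.ne'])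
    have h1 : ‖F (‖x‖⁻¹ • x)‖ ≤ c + ‖F‖ / 2 := by
      have e : F (‖x‖⁻¹ • x) = F y + F (‖x‖⁻¹ • x - y) := by rw [← map_add]; congr 1; abel
      rw [e]
      refine (norm_add_le _ _).trans (add_le_add (hf y hy) ?_)
      refine (F.le_opNorm _).trans ?_
      have := mul_le_mul_of_nonneg_left hxy (norm_nonneg F)
      linarith
    rw [map_smul, norm_smul, norm_inv, norm_norm, inv_mul_le_iff₀ hx0] at h1
    linarith
  intro x
  have h1 := F.le_opNorm x
  rw [hFf, Real.norm_eq_abs] at h1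
  exact h1.trans (mul_le_mul_of_nonneg_right (by linarith) (norm_nonneg x))

theorem exists_vector_net (q : ℕ) :
    ∃ N : Finset (Fin q → ℝ), (∀ x ∈ N, x ⬝ᵥ x = 1) ∧ N.card ≤ 5 ^ q ∧
      ∀ (f : (Fin q → ℝ) →ₗ[ℝ] ℝ) (c : ℝ), 0 ≤ c → (∀ x ∈ N, |f x| ≤ c) →
        ∀ x, |f x| ≤ 2 * c * vnorm x := by
  classical
  obtain ⟨N, h1, h2, h3⟩ := exists_sphere_net (EuclideanSpace ℝ (Fin q))
  refine ⟨N.image WithLp.ofLp, ?_, ?_, fun f c hc hf x => ?_⟩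
  · simp only [Finset.mem_image]
    rintro _ ⟨x, hx, rfl⟩
    rw [← vnorm_sq, vnorm, WithLp.toLp_ofLp, h1 x hx, one_pow]
  · refine Finset.card_image_le.trans (h2.trans (le_of_eq ?_))
    simp
  · exact h3 (f ∘ₗ (WithLp.linearEquiv 2 ℝ (Fin q → ℝ)).toLinearMap) c hc
      (fun y hy => hf _ (Finset.mem_image_of_mem _ hy)) (WithLp.toLp 2 x)

open scoped Matrix.Norms.Frobenius in
theorem exists_frobNorm_net (p q : ℕ) :
    ∃ N : Finset (Matrix (Fin p) (Fin q) ℝ), (∀ X ∈ N, frobNorm X = 1) ∧ N.card ≤ 5 ^ (p * q) ∧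
      ∀ (f : Matrix (Fin p) (Fin q) ℝ →ₗ[ℝ] ℝ) (c : ℝ), 0 ≤ c → (∀ X ∈ N, |f X| ≤ c) →
        ∀ X, |f X| ≤ 2 * c * frobNorm X := by
  have := exists_sphere_net (Matrix (Fin p) (Fin q) ℝ)
  simp only [Module.finrank_matrix, Fintype.card_fin, Module.finrank_self, mul_one] at this
  exact this

open scoped Matrix.Norms.L2Operator in
theorem exists_specNorm_net (p q : ℕ) :
    ∃ N : Finset (Matrix (Fin p) (Fin q) ℝ), (∀ X ∈ N, specNorm X = 1) ∧ N.card ≤ 5 ^ (p * q) ∧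
      ∀ (f : Matrix (Fin p) (Fin q) ℝ →ₗ[ℝ] ℝ) (c : ℝ), 0 ≤ c → (∀ X ∈ N, |f X| ≤ c) →
        ∀ X, |f X| ≤ 2 * c * specNorm X := by
  have := exists_sphere_net (Matrix (Fin p) (Fin q) ℝ)
  simp only [Module.finrank_matrix, Fintype.card_fin, Module.finrank_self, mul_one] at this
  exact this

/-- Finitely many unit rank-one probes determine the spectral norm up to a factor `4`. -/
theorem exists_probe_net (p q : ℕ) :
    ∃ N : Finset ((Fin p → ℝ) × (Fin q → ℝ)), (∀ x ∈ N, x.1 ⬝ᵥ x.1 = 1 ∧ x.2 ⬝ᵥ x.2 = 1) ∧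
      N.card ≤ 5 ^ (p + q) ∧
      ∀ (M : Matrix (Fin p) (Fin q) ℝ) (a : ℝ), 0 ≤ a →
        (∀ x ∈ N, |ip (outer x.1 x.2) M| ≤ a) → specNorm M ≤ 4 * a := by
  obtain ⟨N₁, h1, c1, f1⟩ := exists_vector_net p
  obtain ⟨N₂, h2, c2, f2⟩ := exists_vector_net q
  refine ⟨N₁ ×ˢ N₂, fun x hx => ?_, ?_, fun M a ha hM => ?_⟩
  · rw [Finset.mem_product] at hx
    exact ⟨h1 _ hx.1, h2 _ hx.2⟩
  · rw [Finset.card_product, pow_add]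
    exact Nat.mul_le_mul c1 c2
  · refine specNorm_le_of_forall_outer (by positivity) fun w z hw hz => ?_
    have hvw : vnorm w = 1 := by
      have := vnorm_sq w
      rw [hw] at this
      exact (pow_eq_one_iff_of_nonneg (vnorm_nonneg _) two_ne_zero).1 this
    have hvz : vnorm z = 1 := by
      have := vnorm_sq z
      rw [hz] at this
      exact (pow_eq_one_iff_of_nonneg (vnorm_nonneg _) two_ne_zero).1 this
    have s1 : ∀ w' ∈ N₁, |w' ⬝ᵥ M.mulVec z| ≤ 2 * a := fun w' hw' => by
      have := f2 (dotProductBilin ℝ ℝ w' ∘ₗ M.mulVecLin) a ha (fun z' hz' => by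
        have := hM (w', z') (Finset.mem_product.2 ⟨hw', hz'⟩)
        rwa [ip_outer] at this) z
      rwa [hvz, mul_one] at this
    have := f1 ((dotProductBilin ℝ ℝ).flip (M.mulVec z)) (2 * a) (by positivity) s1 w
    rw [hvw, mul_one] at this
    rw [ip_outer]
    refine le_trans this (by linarith)

/-- The linear map `R ↦ L Rᵀ`. -/
def mulLeftTranspose {p q k : ℕ} (L : Matrix (Fin p) (Fin k) ℝ) :
    Matrix (Fin q) (Fin k) ℝ →ₗ[ℝ] Matrix (Fin p) (Fin q) ℝ where
  toFun R := L * R.transpose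
  map_add' R R' := by rw [Matrix.transpose_add, Matrix.mul_add]
  map_smul' c R := by rw [Matrix.transpose_smul, Matrix.mul_smul, RingHom.id_apply]

/-- The linear map `L ↦ L Rᵀ`. -/
def mulRightTranspose {p q k : ℕ} (R : Matrix (Fin q) (Fin k) ℝ) :
    Matrix (Fin p) (Fin k) ℝ →ₗ[ℝ] Matrix (Fin p) (Fin q) ℝ where
  toFun L := L * R.transpose
  map_add' L L' := Matrix.add_mul _ _ _
  map_smul' c L := by rw [Matrix.smul_mul, RingHom.id_apply]

/-- A finite net for the matrices of rank at most `k`. -/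
theorem exists_lowRank_net (p q k : ℕ) :
    ∃ N : Finset (Matrix (Fin p) (Fin q) ℝ), (∀ X ∈ N, frobNorm X ≤ 1) ∧
      N.card ≤ 5 ^ (k * (p + q)) ∧
      ∀ (f : Matrix (Fin p) (Fin q) ℝ →ₗ[ℝ] ℝ) (c : ℝ), 0 ≤ c → (∀ X ∈ N, |f X| ≤ c) →
        ∀ X, X.rank ≤ k → |f X| ≤ 4 * c * frobNorm X := by
  classical
  obtain ⟨N₁, h1, c1, f1⟩ := exists_frobNorm_net p k
  obtain ⟨N₂, h2, c2, f2⟩ := exists_specNorm_net q k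
  refine ⟨(N₁ ×ˢ N₂).image fun x => x.1 * x.2.transpose, ?_, ?_, fun f c hc hf X hX => ?_⟩
  · simp only [Finset.mem_image, Finset.mem_product]
    rintro _ ⟨x, hx, rfl⟩
    refine (frobNorm_mul_le_right _ _).trans ?_
    rw [specNorm_transpose, h1 _ hx.1, h2 _ hx.2, mul_one]
  · refine Finset.card_image_le.trans ?_
    rw [Finset.card_product]
    refine (Nat.mul_le_mul c1 c2).trans (le_of_eq ?_)
    rw [← pow_add]; congr 1; ring
  -- Write X = (XR)Rᵀ and replace first Rᵀ, then XR, by net points. Each replacement costs a factor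
  -- 2.
  · obtain ⟨R, hR, hXR⟩ := exists_contraction_factor hX
    have hL : frobNorm (X * R) ≤ frobNorm X :=
      (frobNorm_mul_le_right _ _).trans (mul_le_of_le_one_right (frobNorm_nonneg _) hR)
    have s1 : ∀ L' ∈ N₁, |f (L' * R.transpose)| ≤ 2 * c := fun L' hL' => by
      have := f2 (f ∘ₗ (mulLeftTranspose L')) c hc (fun R' hR' =>
        hf _ (Finset.mem_image.2 ⟨(L', R'), Finset.mem_product.2 ⟨hL', hR'⟩, rfl⟩)) R
      exact this.trans (mul_le_of_le_one_right (by positivity) hR)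
    have := f1 (f ∘ₗ (mulRightTranspose R)) (2 * c) (by positivity) s1 (X * R)
    have e : (f ∘ₗ (mulRightTranspose R)) (X * R) = f X := by
      conv_rhs => rw [hXR]
      rfl
    rw [e] at this
    refine this.trans ?_
    nlinarith

end Nets

/-! ### Linear forms in independent standard Gaussians. -/

section GaussianForms

/-- The law of a family of independent standard Gaussian variables. -/
noncomputable def gaussianProd (ι : Type*) [Fintype ι] : Measure (ι → ℝ) :=
  Measure.pi fun _ : ι => gaussianReal 0 1

instance {ι : Type*} [Fintype ι] : IsProbabilityMeasure (gaussianProd ι) := by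
  unfold gaussianProd; infer_instance

variable {ι κ κ' : Type*} [Fintype ι] [Fintype κ] [Fintype κ']

theorem hasLaw_eval_gaussianProd (e : ι) :
    HasLaw (fun x : ι → ℝ => x e) (gaussianReal 0 1) (gaussianProd ι) :=
  ⟨(measurable_pi_apply e).aemeasurable, (measurePreserving_eval (fun _ => gaussianReal 0 1) e).map_eq⟩

theorem iIndepFun_eval_gaussianProd :
    iIndepFun (fun (e : ι) (x : ι → ℝ) => x e) (gaussianProd ι) :=
  iIndepFun_pi (X := fun _ => id) fun _ => aemeasurable_id

theorem hasGaussianLaw_id_gaussianProd :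
    HasGaussianLaw (fun x : ι → ℝ => fun e => x e) (gaussianProd ι) :=
  iIndepFun_eval_gaussianProd.hasGaussianLaw fun e => (hasLaw_eval_gaussianProd e).hasGaussianLaw

theorem memLp_eval_gaussianProd (e : ι) :
    MemLp (fun x : ι → ℝ => x e) 2 (gaussianProd ι) :=
  (hasLaw_eval_gaussianProd e).hasGaussianLaw.memLp_two

theorem integral_eval_gaussianProd (e : ι) : ∫ x, x e ∂(gaussianProd ι) = 0 := by
  rw [(hasLaw_eval_gaussianProd e).integral_eq, integral_id_gaussianReal]

theorem covariance_eval_gaussianProd [DecidableEq ι] (e f : ι) :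
    cov[fun x : ι → ℝ => x e, fun x : ι → ℝ => x f; gaussianProd ι] = if e = f then 1 else 0 := by
  split_ifs with h
  · subst h
    rw [covariance_self (hasLaw_eval_gaussianProd e).aemeasurable, (hasLaw_eval_gaussianProd e).variance_eq,
      variance_id_gaussianReal]
    rfl
  · exact (iIndepFun_eval_gaussianProd.indepFun h).covariance_eq_zero (memLp_eval_gaussianProd e)
      (memLp_eval_gaussianProd f)

theorem integral_dotProduct_gaussianProd (u : ι → ℝ) :
    ∫ x, u ⬝ᵥ x ∂(gaussianProd ι) = 0 := by
  simp only [dotProduct]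
  rw [integral_finsetSum _ fun e _ =>
    ((memLp_eval_gaussianProd e).integrable (by norm_num)).const_mul _]
  refine Finset.sum_eq_zero fun e _ => ?_
  rw [integral_const_mul, integral_eval_gaussianProd, mul_zero]

theorem covariance_dotProduct_gaussianProd (u v : ι → ℝ) :
    cov[fun x => u ⬝ᵥ x, fun x => v ⬝ᵥ x; gaussianProd ι] = u ⬝ᵥ v := by
  classical
  simp only [dotProduct]
  rw [covariance_fun_sum_fun_sum (fun e => (memLp_eval_gaussianProd e).const_mul _)
    fun e => (memLp_eval_gaussianProd e).const_mul _]
  refine Finset.sum_congr rfl fun e _ => ?_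
  rw [Finset.sum_eq_single e]
  · rw [covariance_const_mul_left, covariance_const_mul_right, covariance_eval_gaussianProd,
      if_pos rfl, mul_one]
  · intro f _ hf
    rw [covariance_const_mul_left, covariance_const_mul_right, covariance_eval_gaussianProd,
      if_neg hf.symm, mul_zero, mul_zero]
  · simp

/-- The continuous linear map with rows `u`. -/
noncomputable def formsCLM (u : κ → ι → ℝ) : (ι → ℝ) →L[ℝ] (κ → ℝ) :=
  LinearMap.toContinuousLinearMap (Matrix.mulVecLin (Matrix.of u))

theorem hasGaussianLaw_forms (u : κ → ι → ℝ) :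
    HasGaussianLaw (fun x a => u a ⬝ᵥ x) (gaussianProd ι) :=
  hasGaussianLaw_id_gaussianProd.map_fun (formsCLM u)

theorem hasLaw_dotProduct_gaussianProd (u : ι → ℝ) :
    HasLaw (fun x => u ⬝ᵥ x) (gaussianReal 0 (u ⬝ᵥ u).toNNReal) (gaussianProd ι) := by
  have h : HasGaussianLaw (fun x => u ⬝ᵥ x) (gaussianProd ι) :=
    (hasGaussianLaw_forms fun _ : Unit => u).map_fun (ContinuousLinearMap.proj ())
  refine ⟨h.aemeasurable, ?_⟩
  rw [h.map_eq_gaussianReal, integral_dotProduct_gaussianProd, ← covariance_self h.aemeasurable,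
    covariance_dotProduct_gaussianProd]

/-- Linear forms with orthonormal coefficient vectors are independent standard Gaussians. -/
theorem map_forms_gaussianProd [DecidableEq κ] {u : κ → ι → ℝ}
    (hu : ∀ a b, u a ⬝ᵥ u b = if a = b then 1 else 0) :
    (gaussianProd ι).map (fun x a => u a ⬝ᵥ x) = gaussianProd κ := by
  have hi : iIndepFun (fun a x => u a ⬝ᵥ x) (gaussianProd ι) :=
    (hasGaussianLaw_forms u).iIndepFun_of_covariance_eq_zero fun a b hab => by
      rw [covariance_dotProduct_gaussianProd, hu, if_neg hab]
  rw [(iIndepFun_iff_map_fun_eq_pi_map fun a =>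
    (hasLaw_dotProduct_gaussianProd (u a)).aemeasurable).1 hi]
  unfold gaussianProd
  congr 1
  funext a
  rw [← gaussianProd, (hasLaw_dotProduct_gaussianProd (u a)).map_eq, hu, if_pos rfl,
    Real.toNNReal_one]

/-- Families of linear forms with orthogonal coefficient vectors are independent. -/
theorem indepFun_forms_gaussianProd {u : κ → ι → ℝ} {v : κ' → ι → ℝ}
    (huv : ∀ a b, u a ⬝ᵥ v b = 0) :
    IndepFun (fun x a => u a ⬝ᵥ x) (fun x b => v b ⬝ᵥ x) (gaussianProd ι) := by
  have h : HasGaussianLaw (fun x : ι → ℝ => ((fun a => u a ⬝ᵥ x), fun b => v b ⬝ᵥ x))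
      (gaussianProd ι) :=
    hasGaussianLaw_id_gaussianProd.map_fun ((formsCLM u).prod (formsCLM v))
  exact h.indepFun_of_covariance_eval fun a b => by
    rw [covariance_dotProduct_gaussianProd, huv]

end GaussianForms

/-! ### Tail bounds for Gaussian linear forms and sums of squares. -/

section GaussianTails

variable {κ : Type*} [Fintype κ]

theorem gaussianReal_real_abs_ge_le {a s : ℝ} (v : NNReal) (ha : 0 ≤ a)
    (has : s * v ≤ a ^ 2) (hv : v ≠ 0) :
    (gaussianReal 0 v).real {x | a ≤ |x|} ≤ 2 * Real.exp (-s / 2) := by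
  have hsub : HasSubgaussianMGF id v (gaussianReal 0 v) := by
    refine ⟨fun t => ?_, fun t => ?_⟩
    · exact integrable_exp_mul_gaussianReal t
    · rw [mgf_gaussianReal (Measure.map_id)]; simp
  have h1 := hsub.measure_ge_le ha
  have h2 := hsub.neg.measure_ge_le ha
  have hle : Real.exp (-a ^ 2 / (2 * v)) ≤ Real.exp (-s / 2) := by
    refine Real.exp_le_exp.2 ?_
    have hv' : (0 : ℝ) < v := by positivity
    rw [div_le_div_iff₀ (by positivity) (by norm_num)]
    nlinarith
  have hsub : {x : ℝ | a ≤ |x|} ⊆ {x | a ≤ id x} ∪ {x | a ≤ (-id) x} := fun x hx => by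
    rcases le_abs.1 (show a ≤ |x| from hx) with h | h
    · exact Or.inl h
    · exact Or.inr h
  refine (measureReal_mono hsub).trans ((measureReal_union_le _ _).trans ?_)
  linarith

/-- Tail bound for a fixed linear combination of independent standard Gaussians. -/
theorem gaussianProd_linear_tail (h : κ → ℝ) {s : ℝ} (hs : 0 ≤ s) :
    (gaussianProd κ).real {g | s * (h ⬝ᵥ h) < (h ⬝ᵥ g) ^ 2} ≤ 2 * Real.exp (-s / 2) := by
  rcases (Finset.sum_nonneg fun i _ => mul_self_nonneg (h i) : 0 ≤ h ⬝ᵥ h).eq_or_lt with h0 | h0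
  · have hz : h = 0 := dotProduct_self_eq_zero.1 h0.symm
    subst hz
    simp only [zero_dotProduct, mul_zero, ne_eq, OfNat.ofNat_ne_zero, not_false_eq_true, zero_pow,
      lt_self_iff_false, Set.ofPred_false, measureReal_empty]
    positivity
  · have hl := hasLaw_dotProduct_gaussianProd h
    set v : NNReal := (h ⬝ᵥ h).toNNReal with hv
    have hvc : (v : ℝ) = h ⬝ᵥ h := Real.coe_toNNReal _ h0.le
    have hv0 : v ≠ 0 := by intro h'; rw [h', NNReal.coe_zero] at hvc; exact h0.ne hvc
    have key := gaussianReal_real_abs_ge_le (a := Real.sqrt (s * v)) v (Real.sqrt_nonneg _)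
      (by rw [Real.sq_sqrt (by positivity)]) hv0
    rw [← hl.map_eq, map_measureReal_apply_of_aemeasurable hl.aemeasurable
      (measurableSet_le measurable_const (by fun_prop))] at key
    refine (measureReal_mono fun g hg => ?_).trans key
    simp only [Set.mem_preimage, Set.mem_ofPred_eq] at hg ⊢
    rw [← hvc] at hg
    rw [← Real.sqrt_sq_eq_abs]
    exact Real.sqrt_le_sqrt hg.le

theorem integral_exp_mul_sq_gaussianReal {t : ℝ} (ht : t < 1 / 2) :
    ∫ x, Real.exp (t * x ^ 2) ∂(gaussianReal 0 1) = Real.sqrt (1 / (1 - 2 * t)) := by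
  rw [integral_gaussianReal_eq_integral_smul one_ne_zero]
  have h1 : ∀ x : ℝ, gaussianPDFReal 0 1 x • Real.exp (t * x ^ 2)
      = (Real.sqrt (2 * Real.pi))⁻¹ * Real.exp (-(1 / 2 - t) * x ^ 2) := fun x => by
    rw [gaussianPDFReal, smul_eq_mul, mul_assoc, ← Real.exp_add]
    simp only [NNReal.coe_one, mul_one, sub_zero]
    congr 2; ring
  simp_rw [h1]
  rw [integral_const_mul, integral_gaussian, ← Real.sqrt_inv, ← Real.sqrt_mul (by positivity)]
  congr 1
  have : 1 - 2 * t ≠ 0 := by linarith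
  have : 1 / 2 - t ≠ 0 := by linarith
  have := Real.pi_pos.ne'
  field_simp

theorem integrable_exp_mul_sq_gaussianReal {t : ℝ} (ht : t < 1 / 2) :
    Integrable (fun x => Real.exp (t * x ^ 2)) (gaussianReal 0 1) := by
  refine Integrable.of_integral_ne_zero ?_
  rw [integral_exp_mul_sq_gaussianReal ht]
  have : 0 < 1 - 2 * t := by linarith
  positivity

/-- Squared, this is exp(2t + 4t²)(1 − 2t) ≥ 1. For t ≤ 0 the linear bound on exp suffices, since (1
+ 2t + 4t²)(1 − 2t) = 1 − 8t³; for t ≥ 0 the quadratic one is needed. -/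
theorem sqrt_inv_one_sub_le {t : ℝ} (ht : |t| ≤ 1 / 4) :
    Real.sqrt (1 / (1 - 2 * t)) ≤ Real.exp (t + 2 * t ^ 2) := by
  obtain ⟨h1, h2⟩ := abs_le.1 ht
  have h0 : 0 < 1 - 2 * t := by linarith
  rw [Real.sqrt_le_left (Real.exp_pos _).le, ← Real.exp_nat_mul, div_le_iff₀ h0]
  push_cast
  rcases le_total 0 t with hp | hn
  · have := Real.quadratic_le_exp_of_nonneg (x := 2 * (t + 2 * t ^ 2)) (by positivity)
    refine le_trans ?_ (mul_le_mul_of_nonneg_right this h0.le)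
    nlinarith [pow_nonneg hp 3, pow_nonneg hp 4, pow_nonneg hp 2, mul_nonneg hp hp,
      mul_nonneg (pow_nonneg hp 2) (by linarith : 0 ≤ 1 / 4 - t),
      mul_nonneg (pow_nonneg hp 3) (by linarith : 0 ≤ 1 / 4 - t),
      mul_nonneg (pow_nonneg hp 4) (by linarith : 0 ≤ 1 / 4 - t)]
  · have := Real.add_one_le_exp (2 * (t + 2 * t ^ 2))
    refine le_trans ?_ (mul_le_mul_of_nonneg_right this h0.le)
    nlinarith [pow_nonneg (neg_nonneg.2 hn) 3]

theorem integral_exp_sum_sq_gaussianProd (t : ℝ) :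
    ∫ g, Real.exp (t * ∑ i, g i ^ 2) ∂(gaussianProd κ)
      = (∫ x, Real.exp (t * x ^ 2) ∂(gaussianReal 0 1)) ^ Fintype.card κ := by
  simp_rw [Finset.mul_sum, Real.exp_sum]
  rw [gaussianProd, integral_fintype_prod_eq_prod (fun _ : κ => fun x : ℝ => Real.exp (t * x ^ 2)),
    Finset.prod_const, Finset.card_univ]

theorem integrable_exp_sum_sq_gaussianProd {t : ℝ} (ht : t < 1 / 2) :
    Integrable (fun g : κ → ℝ => Real.exp (t * ∑ i, g i ^ 2)) (gaussianProd κ) := by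
  simp_rw [Finset.mul_sum, Real.exp_sum]
  exact Integrable.fintype_prod fun _ => integrable_exp_mul_sq_gaussianReal ht

theorem mgf_sum_sq_gaussianProd_le {t : ℝ} (ht : |t| ≤ 1 / 4) :
    mgf (fun g : κ → ℝ => ∑ i, g i ^ 2) (gaussianProd κ) t
      ≤ Real.exp (Fintype.card κ * (t + 2 * t ^ 2)) := by
  have ht' : t < 1 / 2 := by linarith [(abs_le.1 ht).2]
  rw [mgf, integral_exp_sum_sq_gaussianProd, integral_exp_mul_sq_gaussianReal ht', Real.exp_nat_mul]
  exact pow_le_pow_left₀ (Real.sqrt_nonneg _) (sqrt_inv_one_sub_le ht) _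

/-- Concentration of the squared norm of a standard Gaussian vector. -/
theorem gaussianProd_sum_sq_tail {s : ℝ} (hs0 : 0 ≤ s) (hs1 : s ≤ 1) :
    (gaussianProd κ).real {g | s * Fintype.card κ ≤ |∑ i, g i ^ 2 - Fintype.card κ|}
      ≤ 2 * Real.exp (-(Fintype.card κ * s ^ 2 / 8)) := by
  set m : ℝ := (Fintype.card κ : ℝ) with hm
  set f : (κ → ℝ) → ℝ := fun g => ∑ i, g i ^ 2 with hf
  have h1 : (gaussianProd κ).real {g | m * (1 + s) ≤ f g} ≤ Real.exp (-(m * s ^ 2 / 8)) := by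
    -- Chernoff with t = s/4: the exponent −t·ms + 2mt² equals −ms²/8 there.
    have ht : |s / 4| ≤ 1 / 4 := by rw [abs_of_nonneg (by positivity)]; linarith
    refine (measure_ge_le_exp_mul_mgf _ (by positivity : 0 ≤ s / 4)
      (integrable_exp_sum_sq_gaussianProd (by linarith))).trans ?_
    refine (mul_le_mul_of_nonneg_left (mgf_sum_sq_gaussianProd_le ht) (Real.exp_pos _).le).trans ?_
    rw [← Real.exp_add, Real.exp_le_exp]
    linarith
  have h2 : (gaussianProd κ).real {g | f g ≤ m * (1 - s)} ≤ Real.exp (-(m * s ^ 2 / 8)) := by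
    have ht : |-(s / 4)| ≤ 1 / 4 := by rw [abs_neg, abs_of_nonneg (by positivity)]; linarith
    refine (measure_le_le_exp_mul_mgf _ (by linarith : -(s / 4) ≤ 0)
      (integrable_exp_sum_sq_gaussianProd (by linarith))).trans ?_
    refine (mul_le_mul_of_nonneg_left (mgf_sum_sq_gaussianProd_le ht) (Real.exp_pos _).le).trans ?_
    rw [← Real.exp_add, Real.exp_le_exp]
    linarith
  have hsub : {g : κ → ℝ | s * m ≤ |∑ i, g i ^ 2 - m|} ⊆
      {g | m * (1 + s) ≤ f g} ∪ {g | f g ≤ m * (1 - s)} := fun g hg => by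
    rcases le_abs.1 (show s * m ≤ |∑ i, g i ^ 2 - m| from hg) with h | h
    · left; simp only [Set.mem_ofPred_eq, hf]; linarith
    · right; simp only [Set.mem_ofPred_eq, hf]; linarith
  refine (measureReal_mono hsub).trans ((measureReal_union_le _ _).trans ?_)
  linarith

/-- Tail bound for a random linear combination of independent standard Gaussians whose coefficients
are independent of them. -/
theorem measureReal_linear_tail_of_indepFun {Ω Ω' : Type*} [MeasurableSpace Ω] [MeasurableSpace Ω']
    {P : Measure Ω} [IsProbabilityMeasure P] {W : Ω → Ω'} {g : Ω → κ → ℝ} (hW : Measurable W)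
    (hg : Measurable g) (hgl : P.map g = gaussianProd κ) (hWg : IndepFun W g P)
    {h : Ω' → κ → ℝ} (hh : Measurable h) {s : ℝ} (hs : 0 ≤ s) :
    P.real {ω | s * (h (W ω) ⬝ᵥ h (W ω)) < (h (W ω) ⬝ᵥ g ω) ^ 2} ≤ 2 * Real.exp (-s / 2) := by
  set S : Set (Ω' × (κ → ℝ)) := {z | s * (h z.1 ⬝ᵥ h z.1) < (h z.1 ⬝ᵥ z.2) ^ 2} with hS
  have hSm : MeasurableSet S := by
    simp only [hS, dotProduct]
    refine measurableSet_lt ?_ ?_ <;> fun_prop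
  have hprod := (indepFun_iff_map_prod_eq_prod_map_map hW.aemeasurable hg.aemeasurable).1 hWg
  have : IsProbabilityMeasure (P.map W) := Measure.isProbabilityMeasure_map hW.aemeasurable
  have e : P {ω | s * (h (W ω) ⬝ᵥ h (W ω)) < (h (W ω) ⬝ᵥ g ω) ^ 2}
      = ((P.map W).prod (gaussianProd κ)) S := by
    rw [← hgl, ← hprod, Measure.map_apply (hW.prodMk hg) hSm]
    rfl
  refine ENNReal.toReal_le_of_le_ofReal (by positivity) ?_
  -- Independence makes the joint law a product, so the coefficients can be frozen and the
  -- fixed-coefficient bound applied fibrewise.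
  rw [e, Measure.prod_apply hSm]
  calc ∫⁻ w, gaussianProd κ (Prod.mk w ⁻¹' S) ∂(P.map W)
      ≤ ∫⁻ _, ENNReal.ofReal (2 * Real.exp (-s / 2)) ∂(P.map W) := by
        refine lintegral_mono fun w => ?_
        rw [ENNReal.le_ofReal_iff_toReal_le (measure_ne_top _ _) (by positivity)]
        exact gaussianProd_linear_tail (h w) hs
    _ = _ := by simp

end GaussianTails

/-! ### The deviation of the normal operator from the identity. -/

section DesignError

variable {p q m : ℕ}

theorem measOp_apply (A : Fin m → Matrix (Fin p) (Fin q) ℝ) (X : Matrix (Fin p) (Fin q) ℝ)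
    (i : Fin m) : measOp A X i = (Real.sqrt m)⁻¹ * ip (A i) X := rfl

theorem measOp_add (A : Fin m → Matrix (Fin p) (Fin q) ℝ) (X Y : Matrix (Fin p) (Fin q) ℝ) :
    measOp A (X + Y) = measOp A X + measOp A Y := by
  funext i
  rw [Pi.add_apply, measOp_apply, measOp_apply, measOp_apply, ip_add_right, mul_add]

theorem measOp_smul (A : Fin m → Matrix (Fin p) (Fin q) ℝ) (c : ℝ) (X : Matrix (Fin p) (Fin q) ℝ) :
    measOp A (c • X) = c • measOp A X := by
  funext i
  rw [Pi.smul_apply, measOp_apply, measOp_apply, ip_smul_right, smul_eq_mul]; ring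

theorem measAdj_add (A : Fin m → Matrix (Fin p) (Fin q) ℝ) (v w : Fin m → ℝ) :
    measAdj A (v + w) = measAdj A v + measAdj A w := by
  simp only [measAdj, Pi.add_apply, add_smul, Finset.sum_add_distrib, smul_add]

theorem measAdj_smul (A : Fin m → Matrix (Fin p) (Fin q) ℝ) (c : ℝ) (v : Fin m → ℝ) :
    measAdj A (c • v) = c • measAdj A v := by
  simp only [measAdj, Pi.smul_apply, smul_eq_mul, mul_smul, Finset.smul_sum, smul_comm c]

/-- The deviation `𝒜*𝒜 - id` of the normal operator of a design from the identity. -/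
noncomputable def designError (A : Fin m → Matrix (Fin p) (Fin q) ℝ) :
    Matrix (Fin p) (Fin q) ℝ →ₗ[ℝ] Matrix (Fin p) (Fin q) ℝ where
  toFun X := measAdj A (measOp A X) - X
  map_add' X Y := by rw [measOp_add, measAdj_add]; abel
  map_smul' c X := by
    simp only [measOp_smul, measAdj_smul, RingHom.id_apply, smul_sub]

theorem measAdj_measOp (A : Fin m → Matrix (Fin p) (Fin q) ℝ) (X : Matrix (Fin p) (Fin q) ℝ) :
    measAdj A (measOp A X) = X + designError A X := by
  change _ = X + (measAdj A (measOp A X) - X); abel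

theorem ip_sum_left {ι : Type*} (s : Finset ι) (f : ι → Matrix (Fin p) (Fin q) ℝ)
    (Y : Matrix (Fin p) (Fin q) ℝ) : ip (∑ i ∈ s, f i) Y = ∑ i ∈ s, ip (f i) Y := by
  classical
  induction s using Finset.induction_on with
  | empty => simp [ip_zero_left]
  | insert a s ha ih => rw [Finset.sum_insert ha, Finset.sum_insert ha, ip_add_left, ih]

theorem ip_designError (A : Fin m → Matrix (Fin p) (Fin q) ℝ) (X Y : Matrix (Fin p) (Fin q) ℝ) :
    ip (designError A X) Y = (m : ℝ)⁻¹ * ∑ i, ip (A i) X * ip (A i) Y - ip X Y := by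
  change ip (measAdj A (measOp A X) - X) Y = _
  rw [ip_sub_left, measAdj, ip_smul_left, ip_sum_left, Finset.mul_sum, Finset.mul_sum]
  congr 1
  refine Finset.sum_congr rfl fun i _ => ?_
  rw [ip_smul_left, measOp_apply]
  have : (Real.sqrt m)⁻¹ * (Real.sqrt m)⁻¹ = (m : ℝ)⁻¹ := by
    rw [← mul_inv, Real.mul_self_sqrt (Nat.cast_nonneg m)]
  rw [← this]; ring

theorem ip_designError_comm (A : Fin m → Matrix (Fin p) (Fin q) ℝ)
    (X Y : Matrix (Fin p) (Fin q) ℝ) : ip (designError A X) Y = ip (designError A Y) X := by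
  rw [ip_designError, ip_designError, ip_comm X Y]
  simp_rw [mul_comm]

theorem four_mul_ip_designError (A : Fin m → Matrix (Fin p) (Fin q) ℝ)
    (X Y : Matrix (Fin p) (Fin q) ℝ) :
    4 * ip (designError A X) Y
      = ip (designError A (X + Y)) (X + Y) - ip (designError A (X - Y)) (X - Y) := by
  simp only [map_add, map_sub, ip_add_left, ip_add_right, ip_sub_left, ip_sub_right,
    ip_designError_comm A Y X]
  ring

/-- The net is used once in each argument of the symmetric bilinear form; 16 = 4 · 4. -/
theorem RestrictedSmall.of_net {E : Matrix (Fin p) (Fin q) ℝ →ₗ[ℝ] Matrix (Fin p) (Fin q) ℝ}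
    {k : ℕ} {N : Finset (Matrix (Fin p) (Fin q) ℝ)} (hE : ∀ X Y, ip (E X) Y = ip (E Y) X)
    (hN : ∀ (f : Matrix (Fin p) (Fin q) ℝ →ₗ[ℝ] ℝ) (c : ℝ), 0 ≤ c → (∀ X ∈ N, |f X| ≤ c) →
      ∀ X, X.rank ≤ k → |f X| ≤ 4 * c * frobNorm X)
    {s : ℝ} (hs : 0 ≤ s) (h : ∀ X ∈ N, ∀ Y ∈ N, |ip (E X) Y| ≤ s) :
    RestrictedSmall E k (16 * s) := by
  have key : ∀ (Z : Matrix (Fin p) (Fin q) ℝ) (c : ℝ), 0 ≤ c →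
      (∀ X ∈ N, |ip (E Z) X| ≤ c) → ∀ X, X.rank ≤ k → |ip (E Z) X| ≤ 4 * c * frobNorm X :=
    fun Z => hN ⟨⟨fun X => ip (E Z) X, fun X Y => ip_add_right _ _ _⟩,
      fun a X => ip_smul_right _ _ _⟩
  intro X Y hX hY
  have h1 : ∀ Z ∈ N, |ip (E Z) X| ≤ 4 * s * frobNorm X := fun Z hZ => key Z s hs (h Z hZ) X hX
  have h2 := key X (4 * s * frobNorm X) (mul_nonneg (by positivity) (frobNorm_nonneg _))
    (fun Z hZ => by rw [hE]; exact h1 Z hZ) Y hY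
  linarith

/-- Polarization together with the parallelogram law, reducing the bilinear form to the quadratic
one. -/
theorem abs_ip_designError_le {A : Fin m → Matrix (Fin p) (Fin q) ℝ}
    {X Y : Matrix (Fin p) (Fin q) ℝ} {s : ℝ} (hs : 0 ≤ s) (hX : frobNorm X ≤ 1)
    (hY : frobNorm Y ≤ 1)
    (h1 : |ip (designError A (X + Y)) (X + Y)| ≤ s * frobNorm (X + Y) ^ 2)
    (h2 : |ip (designError A (X - Y)) (X - Y)| ≤ s * frobNorm (X - Y) ^ 2) :
    |ip (designError A X) Y| ≤ s := by
  have e := four_mul_ip_designError A X Y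
  have hpar : frobNorm (X + Y) ^ 2 + frobNorm (X - Y) ^ 2 = 2 * (frobNorm X ^ 2 + frobNorm Y ^ 2) := by
    simp only [← ip_self, ip_add_left, ip_add_right, ip_sub_left, ip_sub_right]; ring
  have hX2 : frobNorm X ^ 2 ≤ 1 := pow_le_one₀ (frobNorm_nonneg _) hX
  have hY2 : frobNorm Y ^ 2 ≤ 1 := pow_le_one₀ (frobNorm_nonneg _) hY
  have h3 := mul_le_mul_of_nonneg_left (by linarith : frobNorm (X + Y) ^ 2 + frobNorm (X - Y) ^ 2 ≤ 4) hs
  have h4 := abs_sub (ip (designError A (X + Y)) (X + Y)) (ip (designError A (X - Y)) (X - Y))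
  rw [← e, abs_mul, abs_of_pos (by norm_num : (0 : ℝ) < 4)] at h4
  linarith

end DesignError

/-! ### Restricted isometry of Gaussian designs. -/

section GaussianDesign

variable {p q m : ℕ}

/-- The measurement matrices with given entries. -/
def design (x : Fin m × Fin p × Fin q → ℝ) : Fin m → Matrix (Fin p) (Fin q) ℝ :=
  fun i => Matrix.of fun j k => x (i, j, k)

/-- The coefficient vector of the linear form `x ↦ ⟨design x i, Z⟩`. -/
def formVec (m : ℕ) (Z : Matrix (Fin p) (Fin q) ℝ) (i : Fin m) : Fin m × Fin p × Fin q → ℝ :=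
  fun e => if i = e.1 then Z e.2.1 e.2.2 else 0

theorem formVec_dotProduct (Z : Matrix (Fin p) (Fin q) ℝ) (i : Fin m)
    (x : Fin m × Fin p × Fin q → ℝ) : formVec m Z i ⬝ᵥ x = ip (design x i) Z := by
  rw [ip_eq_sum, dotProduct, Fintype.sum_prod_type, Finset.sum_eq_single i]
  · rw [Fintype.sum_prod_type]
    simp only [formVec, if_true, design, Matrix.of_apply]
    exact Finset.sum_congr rfl fun _ _ => Finset.sum_congr rfl fun _ _ => mul_comm _ _
  · intro b _ hb
    simp [formVec, hb.symm]
  · simp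

theorem formVec_dotProduct_formVec (Z Z' : Matrix (Fin p) (Fin q) ℝ) (i j : Fin m) :
    formVec m Z i ⬝ᵥ formVec m Z' j = if i = j then ip Z Z' else 0 := by
  rw [formVec_dotProduct]
  split_ifs with h
  · subst h
    rw [ip_comm]
    congr 1
    ext a b
    simp [design, formVec]
  · have : design (formVec m Z' j) i = 0 := by
      ext a b
      simp [design, formVec, Ne.symm h]
    rw [this, ip_zero_left]

theorem map_ip_design {Z : Matrix (Fin p) (Fin q) ℝ} (hZ : ip Z Z = 1) :
    (gaussianProd (Fin m × Fin p × Fin q)).map (fun x i => ip (design x i) Z)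
      = gaussianProd (Fin m) := by
  simp_rw [← formVec_dotProduct]
  exact map_forms_gaussianProd fun a b => by rw [formVec_dotProduct_formVec, hZ]

theorem measurable_ip_design (Z : Matrix (Fin p) (Fin q) ℝ) :
    Measurable fun (x : Fin m × Fin p × Fin q → ℝ) i => ip (design x i) Z := by
  simp_rw [← formVec_dotProduct, dotProduct]
  fun_prop

/-- After normalizing Z, the numbers ⟨Aᵢ, Z⟩ are independent standard Gaussians, and the quadratic
form is their centred mean square. -/
theorem designError_tail {s : ℝ} (hs0 : 0 ≤ s) (hs1 : s ≤ 1) (hm : 0 < m)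
    (Z : Matrix (Fin p) (Fin q) ℝ) :
    (gaussianProd (Fin m × Fin p × Fin q)).real
      {x | s * frobNorm Z ^ 2 < |ip (designError (design x) Z) Z|}
      ≤ 2 * Real.exp (-(m * s ^ 2 / 8)) := by
  have hm' : (0 : ℝ) < m := Nat.cast_pos.2 hm
  rcases (frobNorm_nonneg Z).eq_or_lt with h0 | h0
  · have : Z = 0 := frobNorm_eq_zero.1 h0.symm
    subst this
    simp only [ip_zero_right, abs_zero, ← h0]
    simp
    positivity
  · set U := (frobNorm Z)⁻¹ • Z with hU
    have hUU : ip U U = 1 := by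
      rw [hU, ip_smul_left, ip_smul_right, ip_self]; field_simp
    have hZU : Z = frobNorm Z • U := by rw [hU, smul_smul, mul_inv_cancel₀ h0.ne', one_smul]
    have key := gaussianProd_sum_sq_tail (κ := Fin m) hs0 hs1
    rw [Fintype.card_fin, ← map_ip_design hUU, map_measureReal_apply (measurable_ip_design U)
      (measurableSet_le (by fun_prop) (by fun_prop))] at key
    refine (measureReal_mono fun x hx => ?_).trans key
    simp only [Set.mem_preimage, Set.mem_ofPred_eq] at hx ⊢
    have e : ip (designError (design x) Z) Z
        = frobNorm Z ^ 2 * ((m : ℝ)⁻¹ * (∑ i, ip (design x i) U ^ 2 - m)) := by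
      conv_lhs => rw [hZU]
      rw [map_smul, ip_smul_left, ip_smul_right, ip_designError, hUU]
      simp_rw [← pow_two]
      field_simp
    rw [e, abs_mul, abs_of_pos (by positivity : 0 < frobNorm Z ^ 2), mul_comm s,
      mul_lt_mul_iff_right₀ (by positivity), abs_mul, abs_of_pos (by positivity : 0 < (m : ℝ)⁻¹),
      inv_mul_eq_div, lt_div_iff₀ hm'] at hx
    exact hx.le

/-- The restricted isometry property of Gaussian designs. -/
theorem gaussianProd_not_restrictedSmall_le {s : ℝ} (hs0 : 0 ≤ s) (hs1 : s ≤ 1) (hm : 0 < m)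
    (k : ℕ) :
    (gaussianProd (Fin m × Fin p × Fin q)).real
      {x | ¬ RestrictedSmall (designError (design x)) k (16 * s)}
      ≤ (5 ^ (k * (p + q))) ^ 2 * (4 * Real.exp (-(m * s ^ 2 / 8))) := by
  obtain ⟨N, hN1, hN2, hN3⟩ := exists_lowRank_net p q k
  set bad : Matrix (Fin p) (Fin q) ℝ → Set (Fin m × Fin p × Fin q → ℝ) :=
    fun Z => {x | s * frobNorm Z ^ 2 < |ip (designError (design x) Z) Z|} with hbad
  have hsub : {x : Fin m × Fin p × Fin q → ℝ |
      ¬ RestrictedSmall (designError (design x)) k (16 * s)} ⊆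
      ⋃ z ∈ N ×ˢ N, (bad (z.1 + z.2) ∪ bad (z.1 - z.2)) := by
    intro x hx
    by_contra hcon
    refine hx (RestrictedSmall.of_net (ip_designError_comm _) hN3 hs0 fun X hX Y hY => ?_)
    simp only [Set.mem_iUnion, not_exists, Set.mem_union, not_or] at hcon
    have := hcon (X, Y) (Finset.mk_mem_product hX hY)
    exact abs_ip_designError_le hs0 (hN1 X hX) (hN1 Y hY) (not_lt.1 this.1) (not_lt.1 this.2)
  have hcard : ((N ×ˢ N).card : ℝ) ≤ (5 ^ (k * (p + q))) ^ 2 := by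
    rw [Finset.card_product, ← pow_two]
    exact_mod_cast Nat.pow_le_pow_left hN2 2
  refine (measureReal_mono hsub (measure_ne_top _ _)).trans ((measureReal_biUnion_finset_le _ _).trans ?_)
  refine (Finset.sum_le_card_nsmul _ _ (4 * Real.exp (-(m * s ^ 2 / 8))) fun z _ => ?_).trans ?_
  · refine (measureReal_union_le _ _).trans ?_
    have h1 := designError_tail hs0 hs1 hm (z.1 + z.2)
    have h2 := designError_tail hs0 hs1 hm (z.1 - z.2)
    linarith
  · rw [nsmul_eq_mul]
    exact mul_le_mul_of_nonneg_right hcard (by positivity)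

end GaussianDesign

/-! ### Measurability of matrix operations. -/

section Measurability

variable {p q k r m : ℕ}

instance : MeasurableSpace (Matrix (Fin p) (Fin q) ℝ) :=
  inferInstanceAs (MeasurableSpace (Fin p → Fin q → ℝ))

instance : BorelSpace (Matrix (Fin p) (Fin q) ℝ) :=
  inferInstanceAs (BorelSpace (Fin p → Fin q → ℝ))

theorem measurable_matrix_iff {α : Type*} [MeasurableSpace α] {f : α → Matrix (Fin p) (Fin q) ℝ} :
    Measurable f ↔ ∀ i j, Measurable fun x => f x i j :=
  ⟨fun h i j => (measurable_pi_iff.1 (measurable_pi_iff.1 h i) j),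
    fun h => measurable_pi_iff.2 fun i => measurable_pi_iff.2 fun j => h i j⟩

variable {α : Type*} [MeasurableSpace α]

theorem _root_.Measurable.matrix_add {f g : α → Matrix (Fin p) (Fin q) ℝ} (hf : Measurable f)
    (hg : Measurable g) : Measurable fun x => f x + g x :=
  measurable_matrix_iff.2 fun i j =>
    (measurable_matrix_iff.1 hf i j).add (measurable_matrix_iff.1 hg i j)

theorem _root_.Measurable.matrix_sub {f g : α → Matrix (Fin p) (Fin q) ℝ} (hf : Measurable f)
    (hg : Measurable g) : Measurable fun x => f x - g x :=
  measurable_matrix_iff.2 fun i j =>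
    (measurable_matrix_iff.1 hf i j).sub (measurable_matrix_iff.1 hg i j)

theorem _root_.Measurable.matrix_smul {c : α → ℝ} {f : α → Matrix (Fin p) (Fin q) ℝ}
    (hc : Measurable c) (hf : Measurable f) : Measurable fun x => c x • f x :=
  measurable_matrix_iff.2 fun i j => hc.mul (measurable_matrix_iff.1 hf i j)

theorem _root_.Measurable.matrix_neg {f : α → Matrix (Fin p) (Fin q) ℝ} (hf : Measurable f) :
    Measurable fun x => -f x :=
  measurable_matrix_iff.2 fun i j => (measurable_matrix_iff.1 hf i j).neg

theorem _root_.Measurable.matrix_transpose {f : α → Matrix (Fin p) (Fin q) ℝ} (hf : Measurable f) :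
    Measurable fun x => (f x).transpose :=
  measurable_matrix_iff.2 fun i j => measurable_matrix_iff.1 hf j i

theorem _root_.Measurable.matrix_mul {f : α → Matrix (Fin p) (Fin q) ℝ}
    {g : α → Matrix (Fin q) (Fin k) ℝ} (hf : Measurable f) (hg : Measurable g) :
    Measurable fun x => f x * g x :=
  measurable_matrix_iff.2 fun i j => by
    simp only [Matrix.mul_apply]
    exact Finset.measurable_fun_sum _ fun l _ =>
      (measurable_matrix_iff.1 hf i l).mul (measurable_matrix_iff.1 hg l j)

/-- The formula det⁻¹ • adjugate remains valid at singular matrices, where both sides are 0, so no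
restriction to the invertible set is needed. -/
theorem _root_.Measurable.matrix_inv {f : α → Matrix (Fin p) (Fin p) ℝ} (hf : Measurable f) :
    Measurable fun x => (f x)⁻¹ := by
  simp only [Matrix.inv_def, Ring.inverse_eq_inv']
  have h1 : Continuous fun M : Matrix (Fin p) (Fin p) ℝ => M.det := continuous_id.matrix_det
  have h2 : Continuous fun M : Matrix (Fin p) (Fin p) ℝ => M.adjugate :=
    continuous_id.matrix_adjugate
  exact (h1.measurable.comp hf).inv.matrix_smul (h2.measurable.comp hf)

theorem _root_.Measurable.matrix_ip {f g : α → Matrix (Fin p) (Fin q) ℝ} (hf : Measurable f)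
    (hg : Measurable g) : Measurable fun x => ip (f x) (g x) := by
  simp only [ip_eq_sum]
  exact Finset.measurable_fun_sum _ fun i _ => Finset.measurable_fun_sum _ fun j _ =>
    (measurable_matrix_iff.1 hf i j).mul (measurable_matrix_iff.1 hg i j)

theorem continuous_frobNorm : Continuous fun M : Matrix (Fin p) (Fin q) ℝ => frobNorm M := by
  have : (fun M : Matrix (Fin p) (Fin q) ℝ => frobNorm M)
      = fun M => Real.sqrt (∑ i, ∑ j, M i j ^ 2) := by
    funext M
    rw [← frobNorm_sq, Real.sqrt_sq (frobNorm_nonneg _)]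
  rw [this]
  fun_prop

theorem continuous_specNorm : Continuous fun M : Matrix (Fin p) (Fin q) ℝ => specNorm M := by
  refine continuous_iff_continuousAt.2 fun M => ?_
  refine tendsto_iff_dist_tendsto_zero.2 (squeeze_zero (fun _ => dist_nonneg)
    (fun N => ?_) (g := fun N => frobNorm (N - M)) ?_)
  · rw [Real.dist_eq, abs_le]
    have h1 := specNorm_add_le (N - M) M
    have h2 := specNorm_sub_le N (N - M)
    have h3 := specNorm_le_frobNorm (N - M)
    rw [sub_add_cancel] at h1
    rw [sub_sub_cancel] at h2
    constructor <;> linarith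
  · have : Continuous fun N : Matrix (Fin p) (Fin q) ℝ => frobNorm (N - M) :=
      continuous_frobNorm.comp (continuous_id.sub continuous_const)
    have h := this.tendsto M
    rwa [sub_self, frobNorm_eq_zero.2 rfl] at h

theorem abs_apply_le_frobNorm (M : Matrix (Fin p) (Fin q) ℝ) (i : Fin p) (j : Fin q) :
    |M i j| ≤ frobNorm M := by
  refine abs_le_of_sq_le_sq ?_ (frobNorm_nonneg _)
  rw [frobNorm_sq]
  exact (Finset.single_le_sum (f := fun j => M i j ^ 2) (fun _ _ => sq_nonneg _)
    (Finset.mem_univ j)).trans (Finset.single_le_sum (f := fun i => ∑ j, M i j ^ 2)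
      (fun _ _ => Finset.sum_nonneg fun _ _ => sq_nonneg _) (Finset.mem_univ i))

theorem continuousOn_of_frobNorm_sub_le {S : Set (Matrix (Fin p) (Fin q) ℝ)} {K : ℝ}
    {f : Matrix (Fin p) (Fin q) ℝ → Matrix (Fin p) (Fin q) ℝ}
    (h : ∀ M ∈ S, ∀ M' ∈ S, frobNorm (f M - f M') ≤ K * frobNorm (M - M')) : ContinuousOn f S := by
  intro M hM
  refine tendsto_pi_nhds.2 fun i => tendsto_pi_nhds.2 fun j => ?_
  refine tendsto_iff_dist_tendsto_zero.2 (squeeze_zero' (Filter.Eventually.of_forall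
    fun _ => dist_nonneg) (g := fun N => K * frobNorm (N - M)) ?_ ?_)
  · filter_upwards [self_mem_nhdsWithin] with N hN
    rw [Real.dist_eq]
    exact (abs_apply_le_frobNorm (f N - f M) i j).trans (h N hN M hM)
  · have : Continuous fun N : Matrix (Fin p) (Fin q) ℝ => K * frobNorm (N - M) :=
      continuous_const.mul (continuous_frobNorm.comp (continuous_id.sub continuous_const))
    have h := this.tendsto M
    rw [sub_self, frobNorm_eq_zero.2 rfl, mul_zero] at h
    exact h.mono_left nhdsWithin_le_nhds

end Measurability

/-! ### The auxiliary sequences and their measurability. -/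

section AuxiliarySequence

variable {p q r m : ℕ}

/-- The perturbation associated with a design `A` all of whose members are orthogonal to `B`. -/
noncomputable def probeError (A : Fin m → Matrix (Fin p) (Fin q) ℝ) (B : Matrix (Fin p) (Fin q) ℝ) :
    Matrix (Fin p) (Fin q) ℝ →ₗ[ℝ] Matrix (Fin p) (Fin q) ℝ :=
  designError A + (LinearMap.id - removeProbe B)

/-- Projecting the normal operator on both sides amounts to projecting each Aᵢ, and Π(−id)Π = −id +
(id − Π). So the decoupled operator is a function of the projected design alone. -/
theorem decoupled_designError (A : Fin m → Matrix (Fin p) (Fin q) ℝ)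
    {B : Matrix (Fin p) (Fin q) ℝ} (hB : ip B B = 1) :
    decoupled (designError A) B = probeError (fun i => removeProbe B (A i)) B := by
  have hsep : ∀ M N : Matrix (Fin p) (Fin q) ℝ, (∀ T, ip M T = ip N T) → M = N := fun M N h => by
    have := h (M - N)
    rw [← sub_eq_zero, ← ip_sub_left, ip_self] at this
    exact sub_eq_zero.1 (frobNorm_eq_zero.1 (pow_eq_zero_iff two_ne_zero |>.1 this))
  refine LinearMap.ext fun X => hsep _ _ fun T => ?_
  have h1 : probeError (fun i => removeProbe B (A i)) B X
      = designError (fun i => removeProbe B (A i)) X + ip B X • B := by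
    change _ + (X - (X - ip B X • B)) = _
    rw [sub_sub_cancel]
  rw [decoupled_apply, ip_removeProbe, ip_designError, h1, ip_add_left, ip_designError]
  simp only [ip_removeProbe (B := B) (X := A _)]
  have h2 : ip (removeProbe B X) (removeProbe B T) = ip X T - ip B X * ip B T := by
    rw [← ip_removeProbe, removeProbe_apply, removeProbe_apply]
    simp only [ip_sub_left, ip_sub_right, ip_smul_left, ip_smul_right, hB]
    ring
  rw [h2, ip_smul_left]
  ring

open Classical in
/-- A chosen approximate rank-`r` truncation. -/
noncomputable def goodTrunc (r : ℕ) (σ : ℝ) (Xs M : Matrix (Fin p) (Fin q) ℝ) :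
    Matrix (Fin p) (Fin q) ℝ :=
  if h : 8 * specNorm (M - Xs) ≤ σ ∧ ∃ Y, IsGoodTrunc r σ Xs M Y then h.2.choose else 0

variable {Xs : Matrix (Fin p) (Fin q) ℝ} {V : Matrix (Fin p) (Fin r) ℝ} {s : Fin r → ℝ}
  {W : Matrix (Fin q) (Fin r) ℝ} {σ : ℝ}

theorem IsTarget.isGoodTrunc_goodTrunc (h : IsTarget Xs V s W σ) {M : Matrix (Fin p) (Fin q) ℝ}
    (hM : 8 * specNorm (M - Xs) ≤ σ) : IsGoodTrunc r σ Xs M (goodTrunc r σ Xs M) := by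
  have hσ := h.pos
  have hrq : r ≤ q := by
    have h1 : (1 : Matrix (Fin r) (Fin r) ℝ).rank ≤ q := by
      rw [← h.right_orthonormal]
      exact (Matrix.rank_mul_le_right _ _).trans (by simpa using Matrix.rank_le_height W)
    simpa using h1
  obtain ⟨V', s', W', hsvd⟩ := exists_isTopSVD M (fun k hk => by
    have := h.sub_le_singVal M hk
    linarith) hrq
  have hex : 8 * specNorm (M - Xs) ≤ σ ∧ ∃ Y, IsGoodTrunc r σ Xs M Y :=
    ⟨hM, _, h.isGoodTrunc hsvd (by linarith [specNorm_nonneg (M - Xs)])⟩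
  rw [goodTrunc, dif_pos hex]
  exact hex.2.choose_spec

/-- Although the truncation is an arbitrary choice, stability makes any choice 5-Lipschitz on the
closed set where M is near the target. Off that set it is 0 by definition. -/
theorem IsTarget.measurable_goodTrunc (h : IsTarget Xs V s W σ) :
    Measurable (goodTrunc r σ Xs) := by
  classical
  set S : Set (Matrix (Fin p) (Fin q) ℝ) := {M | 8 * specNorm (M - Xs) ≤ σ} with hS
  have e : goodTrunc r σ Xs = S.piecewise (goodTrunc r σ Xs) fun _ => 0 := by
    funext M
    by_cases hM : M ∈ S
    · rw [Set.piecewise_eq_of_mem _ _ _ hM]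
    · rw [Set.piecewise_eq_of_notMem _ _ _ hM, goodTrunc, dif_neg fun h => hM h.1]
  have hcl : IsClosed S := isClosed_le (continuous_const.mul
    (continuous_specNorm.comp (continuous_id.sub continuous_const))) continuous_const
  rw [e]
  refine ContinuousOn.measurable_piecewise ?_ continuousOn_const hcl.measurableSet
  refine continuousOn_of_frobNorm_sub_le (K := 5) fun M hM M' hM' => ?_
  exact (h.isGoodTrunc_goodTrunc hM).frobNorm_sub_le (h.isGoodTrunc_goodTrunc hM') h.pos hM hM'
    le_rfl (frobNorm_nonneg _) fun T _ => abs_ip_le _ _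

/-- The iterates of exact scaled gradient descent with perturbation `E`, started from a chosen
truncation. -/
noncomputable def auxSeq (E : Matrix (Fin p) (Fin q) ℝ →ₗ[ℝ] Matrix (Fin p) (Fin q) ℝ) (μ σ : ℝ)
    (Xs : Matrix (Fin p) (Fin q) ℝ) (V : Matrix (Fin p) (Fin r) ℝ) (W : Matrix (Fin q) (Fin r) ℝ) :
    ℕ → Matrix (Fin p) (Fin q) ℝ
  | 0 => goodTrunc r σ Xs (Xs + E Xs)
  | t + 1 => gdStep E μ Xs V W (auxSeq E μ σ Xs V W t)

variable {α : Type*} [MeasurableSpace α]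

theorem measurable_probeError {A : α → Fin m → Matrix (Fin p) (Fin q) ℝ} {B : Matrix (Fin p) (Fin q) ℝ}
    (hA : ∀ i, Measurable fun x => A x i) {X : α → Matrix (Fin p) (Fin q) ℝ} (hX : Measurable X) :
    Measurable fun x => probeError (A x) B (X x) := by
  have e : (fun x => probeError (A x) B (X x))
      = fun x => (measAdj (A x) (measOp (A x) (X x)) - X x) + (X x - (X x - ip B (X x) • B)) := rfl
  rw [e]
  have h1 : Measurable fun x => measAdj (A x) (measOp (A x) (X x)) := by
    refine measurable_matrix_iff.2 fun a b => ?_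
    simp only [measAdj, Matrix.smul_apply, Matrix.sum_apply, measOp_apply, smul_eq_mul]
    exact measurable_const.mul (Finset.measurable_fun_sum _ fun i _ =>
      (measurable_const.mul ((hA i).matrix_ip hX)).mul (measurable_matrix_iff.1 (hA i) a b))
  exact (h1.matrix_sub hX).matrix_add (hX.matrix_sub
    (hX.matrix_sub ((measurable_const.matrix_ip hX).matrix_smul measurable_const)))

theorem measurable_pinvFn {Y : α → Matrix (Fin p) (Fin q) ℝ} (hY : Measurable Y) :
    Measurable fun x => pinvFn V W (Y x) := by
  have hf : ∀ {L : α → Matrix (Fin p) (Fin r) ℝ} {R : α → Matrix (Fin q) (Fin r) ℝ},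
      Measurable L → Measurable R → Measurable fun x => factorPinv (L x) (R x) := fun hL hR =>
    (hR.matrix_mul (hR.matrix_transpose.matrix_mul hR).matrix_inv).matrix_mul
      ((hL.matrix_transpose.matrix_mul hL).matrix_inv.matrix_mul hL.matrix_transpose)
  have hV : Measurable fun _ : α => V.transpose := measurable_const
  have hW : Measurable fun _ : α => W := measurable_const
  exact hf (hY.matrix_mul hW)
    ((((hV.matrix_mul hY).matrix_mul hW).matrix_inv.matrix_mul (hV.matrix_mul hY)).matrix_transpose)

theorem measurable_auxSeq (h : IsTarget Xs V s W σ) {A : α → Fin m → Matrix (Fin p) (Fin q) ℝ}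
    {B : Matrix (Fin p) (Fin q) ℝ} (hA : ∀ i, Measurable fun x => A x i) (μ : ℝ) (t : ℕ) :
    Measurable fun x => auxSeq (probeError (A x) B) μ σ Xs V W t := by
  induction t with
  | zero =>
    exact h.measurable_goodTrunc.comp
      (measurable_const.matrix_add (measurable_probeError hA measurable_const))
  | succ t ih =>
    simp only [auxSeq, gdStep, stepMap]
    have hΔ : Measurable fun x => auxSeq (probeError (A x) B) μ σ Xs V W t - Xs :=
      ih.matrix_sub measurable_const
    have hG := (hΔ.matrix_add (measurable_probeError (B := B) hA hΔ)).matrix_neg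
    have hZ := measurable_pinvFn (V := V) (W := W) ih
    have hμ : Measurable fun _ : α => μ := measurable_const
    exact ((measurable_const.matrix_add (hμ.matrix_smul (hG.matrix_mul hZ))).matrix_mul
      ih).matrix_mul (measurable_const.matrix_add (hμ.matrix_smul (hZ.matrix_mul hG)))

end AuxiliarySequence

/-! ### Independence from the probed direction and the union bound. -/

section Decoupling

variable {p q m : ℕ}

/-- The entries of the design matrices after projecting out the direction `B`. -/
noncomputable def probeCoord (B : Matrix (Fin p) (Fin q) ℝ) (x : Fin m × Fin p × Fin q → ℝ) :
    Fin m × Fin p × Fin q → ℝ :=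
  fun e => removeProbe B (design x e.1) e.2.1 e.2.2

theorem design_probeCoord (B : Matrix (Fin p) (Fin q) ℝ) (x : Fin m × Fin p × Fin q → ℝ) :
    design (probeCoord B x) = fun i => removeProbe B (design x i) := rfl

theorem ip_single (X : Matrix (Fin p) (Fin q) ℝ) (i : Fin p) (j : Fin q) :
    ip X (Matrix.single i j 1) = X i j := by
  rw [ip_eq_sum, Finset.sum_eq_single i, Finset.sum_eq_single j]
  · simp
  · intro b _ hb; simp [hb.symm]
  · simp
  · intro b _ hb; simp [hb.symm]
  · simp

theorem probeCoord_eq_forms (B : Matrix (Fin p) (Fin q) ℝ) :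
    probeCoord (m := m) B = fun x e =>
      formVec m (removeProbe B (Matrix.single e.2.1 e.2.2 1)) e.1 ⬝ᵥ x := by
  funext x e
  rw [formVec_dotProduct, ← ip_removeProbe, ip_single]
  rfl

theorem measurable_probeCoord (B : Matrix (Fin p) (Fin q) ℝ) :
    Measurable (probeCoord (m := m) B) := by
  rw [probeCoord_eq_forms]
  simp only [dotProduct]
  fun_prop

/-- Both families are linear forms in the same Gaussian vector, with mutually orthogonal coefficient
vectors because the image of `removeProbe B` is orthogonal to B. -/
theorem indepFun_probeCoord {B : Matrix (Fin p) (Fin q) ℝ} (hB : ip B B = 1) :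
    IndepFun (probeCoord (m := m) B) (fun x i => ip (design x i) B)
      (gaussianProd (Fin m × Fin p × Fin q)) := by
  simp_rw [probeCoord_eq_forms, ← formVec_dotProduct]
  exact indepFun_forms_gaussianProd fun e i => by
    rw [formVec_dotProduct_formVec, ip_removeProbe_self hB, ite_self]

theorem measurable_design (i : Fin m) :
    Measurable fun x : Fin m × Fin p × Fin q → ℝ => design x i :=
  measurable_matrix_iff.2 fun _ _ => measurable_pi_apply _

/-- The coefficients ⟨ΠAᵢ, Z⟩ = ⟨Aᵢ, ΠZ⟩ depend only on the projected design, even though Z is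
random; the ⟨Aᵢ, B⟩ are Gaussians independent of them. -/
theorem decoupled_tail {B : Matrix (Fin p) (Fin q) ℝ} (hB : ip B B = 1)
    {Z : (Fin m × Fin p × Fin q → ℝ) → Matrix (Fin p) (Fin q) ℝ} (hZ : Measurable Z) {K : ℝ}
    (hK : 0 ≤ K) :
    (gaussianProd (Fin m × Fin p × Fin q)).real
      {x | K * ∑ i, ip (design x i) (removeProbe B (Z (probeCoord B x))) ^ 2 <
        (∑ i, ip (design x i) (removeProbe B (Z (probeCoord B x))) * ip (design x i) B) ^ 2}
      ≤ 2 * Real.exp (-K / 2) := by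
  have hh : Measurable fun (w : Fin m × Fin p × Fin q → ℝ) i => ip (design w i) (Z w) :=
    measurable_pi_iff.2 fun i => (measurable_design i).matrix_ip hZ
  have key := measureReal_linear_tail_of_indepFun (measurable_probeCoord B)
    (measurable_ip_design B) (map_ip_design hB) (indepFun_probeCoord hB) hh hK
  simpa only [design_probeCoord, ip_removeProbe, dotProduct, ← pow_two] using key

/-- Bound on the interaction of the perturbation with the direction `B`, from the tail event. -/
theorem RestrictedSmall.sq_ip_probe_le {A : Fin m → Matrix (Fin p) (Fin q) ℝ} {k : ℕ} {δ K : ℝ}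
    (hE : RestrictedSmall (designError A) k δ) (hδ : δ ≤ 1) (hm : 0 < m) (hK : 0 ≤ K)
    {B Z : Matrix (Fin p) (Fin q) ℝ} (hB : ip B B = 1) (hZ : (removeProbe B Z).rank ≤ k)
    (h : (∑ i, ip (A i) (removeProbe B Z) * ip (A i) B) ^ 2
      ≤ K * ∑ i, ip (A i) (removeProbe B Z) ^ 2) :
    ip (designError A (removeProbe B Z)) B ^ 2 ≤ 2 * K / m * frobNorm Z ^ 2 := by
  have hm' : (0 : ℝ) < m := Nat.cast_pos.2 hm
  set U := removeProbe B Z with hU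
  have h1 : ip (designError A U) B = (m : ℝ)⁻¹ * ∑ i, ip (A i) U * ip (A i) B := by
    rw [ip_designError, ip_removeProbe_self hB, sub_zero]
  -- Restricted isometry bounds the conditional variance, with δ ≤ 1.
  have h2 : ∑ i, ip (A i) U ^ 2 ≤ m * (2 * frobNorm Z ^ 2) := by
    have h3 := (le_abs_self _).trans (hE U U hZ hZ)
    have h4 := ip_designError A U U
    rw [ip_self] at h4
    simp_rw [← pow_two] at h4
    have h5 : frobNorm U ^ 2 ≤ frobNorm Z ^ 2 :=
      pow_le_pow_left₀ (frobNorm_nonneg _) (frobNorm_removeProbe_le hB Z) 2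
    have h6 : δ * frobNorm U * frobNorm U ≤ frobNorm U ^ 2 := by
      nlinarith [sq_nonneg (frobNorm U)]
    have h7 : (m : ℝ)⁻¹ * ∑ i, ip (A i) U ^ 2 ≤ 2 * frobNorm Z ^ 2 := by linarith
    rwa [inv_mul_le_iff₀ hm'] at h7
  rw [h1, mul_pow]
  calc (m : ℝ)⁻¹ ^ 2 * (∑ i, ip (A i) U * ip (A i) B) ^ 2
      ≤ (m : ℝ)⁻¹ ^ 2 * (K * (m * (2 * frobNorm Z ^ 2))) :=
        mul_le_mul_of_nonneg_left (h.trans (mul_le_mul_of_nonneg_left h2 hK)) (by positivity)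
    _ = _ := by field_simp

theorem measureReal_iUnion_le_of_geometric {Ω : Type*} [MeasurableSpace Ω] {P : Measure Ω}
    [IsFiniteMeasure P] {S : ℕ → Set Ω} {a b : ℝ} (ha : 0 ≤ a) (hb0 : 0 ≤ b) (hb : b < 1)
    (h : ∀ s, P.real (S s) ≤ a * b ^ s) : P.real (⋃ s, S s) ≤ a * (1 - b)⁻¹ := by
  have hs : HasSum (fun s => a * b ^ s) (a * (1 - b)⁻¹) :=
    (hasSum_geometric_of_lt_one hb0 hb).mul_left a
  refine ENNReal.toReal_le_of_le_ofReal (hs.nonneg fun s => by positivity) ?_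
  rw [← hs.tsum_eq, ENNReal.ofReal_tsum_of_nonneg (fun s => by positivity) hs.summable]
  refine (measure_iUnion_le S).trans (ENNReal.tsum_le_tsum fun s => ?_)
  rw [ENNReal.le_ofReal_iff_toReal_le (measure_ne_top _ _) (by positivity)]
  exact h s

/-- The net costs 5^n ≤ e^(2n) and the summed geometric series at most a constant 4 ≤ e^(2n),
against e^(−5n). -/
theorem two_mul_five_pow_mul_le {n : ℕ} (hn : 1 ≤ n) :
    5 ^ n * (2 * Real.exp (-(5 * n)) * (1 - Real.exp (-n))⁻¹) ≤ Real.exp (-n) := by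
  have hn' : (1 : ℝ) ≤ n := by exact_mod_cast hn
  have he : Real.exp (-n) ≤ 1 / 2 := by
    have h1 := Real.add_one_le_exp (n : ℝ)
    rw [Real.exp_neg, one_div]
    exact inv_anti₀ two_pos (by linarith)
  have h5 : (5 : ℝ) ^ n ≤ Real.exp (2 * n) := by
    have h1 := Real.quadratic_le_exp_of_nonneg (x := 2) (by norm_num)
    rw [mul_comm, Real.exp_nat_mul]
    exact pow_le_pow_left₀ (by norm_num) (by linarith) n
  have h4 : (4 : ℝ) ≤ Real.exp (2 * n) := by
    have h1 := Real.quadratic_le_exp_of_nonneg (x := 2) (by norm_num)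
    have h2 := Real.exp_le_exp.2 (by linarith : (2 : ℝ) ≤ 2 * n)
    linarith
  have hinv : (1 - Real.exp (-n))⁻¹ ≤ 2 := by
    rw [inv_le_comm₀ (by linarith) two_pos]; linarith
  calc 5 ^ n * (2 * Real.exp (-(5 * n)) * (1 - Real.exp (-n))⁻¹)
      ≤ Real.exp (2 * n) * (2 * Real.exp (-(5 * n)) * 2) :=
        mul_le_mul h5 (mul_le_mul_of_nonneg_left hinv (by positivity))
          (mul_nonneg (by positivity) (inv_nonneg.2 (by linarith))) (by positivity)
    _ = Real.exp (2 * n) * Real.exp (-(5 * n)) * 4 := by ring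
    _ ≤ Real.exp (2 * n) * Real.exp (-(5 * n)) * Real.exp (2 * n) :=
        mul_le_mul_of_nonneg_left h4 (by positivity)
    _ = Real.exp (-n) := by rw [← Real.exp_add, ← Real.exp_add]; congr 1; ring

/-- Simultaneous tail bound over a net of probing directions and a sequence of test matrices that
do not see the probing direction. -/
theorem gaussianProd_decoupled_union_le (hn : 1 ≤ p + q) {N : Finset (Matrix (Fin p) (Fin q) ℝ)}
    (hN : ∀ B ∈ N, ip B B = 1) (hcard : N.card ≤ 5 ^ (p + q))
    {Z : Matrix (Fin p) (Fin q) ℝ → ℕ → (Fin m × Fin p × Fin q → ℝ) → Matrix (Fin p) (Fin q) ℝ}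
    (hZ : ∀ B s, Measurable (Z B s)) :
    (gaussianProd (Fin m × Fin p × Fin q)).real
      {x | ∃ B ∈ N, ∃ s : ℕ, 2 * ((p + q : ℕ) : ℝ) * (5 + s) *
          ∑ i, ip (design x i) (removeProbe B (Z B s (probeCoord B x))) ^ 2 <
        (∑ i, ip (design x i) (removeProbe B (Z B s (probeCoord B x))) * ip (design x i) B) ^ 2}
      ≤ Real.exp (-((p + q : ℕ) : ℝ)) := by
  set n := p + q with hn'
  have hn1 : (1 : ℝ) ≤ n := by exact_mod_cast hn
  set S : Matrix (Fin p) (Fin q) ℝ → ℕ → Set (Fin m × Fin p × Fin q → ℝ) := fun B s =>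
    {x | 2 * (n : ℝ) * (5 + s) *
          ∑ i, ip (design x i) (removeProbe B (Z B s (probeCoord B x))) ^ 2 <
        (∑ i, ip (design x i) (removeProbe B (Z B s (probeCoord B x))) * ip (design x i) B) ^ 2}
    with hS
  have hB : ∀ B ∈ N, (gaussianProd (Fin m × Fin p × Fin q)).real (⋃ s, S B s)
      ≤ 2 * Real.exp (-(5 * n)) * (1 - Real.exp (-n))⁻¹ := fun B hBN => by
    -- The threshold 2n(5 + s) gives the tail 2e^(−5n)(e^(−n))^s, summable over all infinitely many
    -- times s.
    refine measureReal_iUnion_le_of_geometric (by positivity) (Real.exp_pos _).le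
      (Real.exp_lt_one_iff.2 (by linarith)) fun s => ?_
    refine (decoupled_tail (hN B hBN) (hZ B s) (by positivity)).trans (le_of_eq ?_)
    rw [← Real.exp_nat_mul, mul_assoc 2 (Real.exp _), ← Real.exp_add]
    congr 2; ring
  have hsub : {x : Fin m × Fin p × Fin q → ℝ | ∃ B ∈ N, ∃ s : ℕ, x ∈ S B s} ⊆
      ⋃ B ∈ N, ⋃ s, S B s := by
    rintro x ⟨B, hBN, s, hx⟩
    exact Set.mem_iUnion₂.2 ⟨B, hBN, Set.mem_iUnion.2 ⟨s, hx⟩⟩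
  refine (measureReal_mono hsub (measure_ne_top _ _)).trans
    ((measureReal_biUnion_finset_le _ _).trans ?_)
  refine (Finset.sum_le_card_nsmul _ _ _ hB).trans (le_trans ?_ (two_mul_five_pow_mul_le hn))
  rw [nsmul_eq_mul]
  refine mul_le_mul_of_nonneg_right (by exact_mod_cast hcard)
    (mul_nonneg (by positivity) (inv_nonneg.2 ?_))
  linarith [Real.exp_lt_one_iff.2 (by linarith : -(n : ℝ) < 0)]

end Decoupling

/-! ### Scaled gradient descent on the good event. -/

section ScaledGD

variable {p q r m : ℕ}

theorem exists_matrix_probe_net (p q : ℕ) :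
    ∃ N : Finset (Matrix (Fin p) (Fin q) ℝ),
      (∀ B ∈ N, ip B B = 1 ∧ B.rank ≤ 1 ∧ ∀ M, |ip B M| ≤ specNorm M) ∧ N.card ≤ 5 ^ (p + q) ∧
      ∀ (M : Matrix (Fin p) (Fin q) ℝ) (a : ℝ), 0 ≤ a → (∀ B ∈ N, |ip B M| ≤ a) →
        specNorm M ≤ 4 * a := by
  classical
  obtain ⟨N, h1, h2, h3⟩ := exists_probe_net p q
  refine ⟨N.image fun x => outer x.1 x.2, fun B hB => ?_, Finset.card_image_le.trans h2,
    fun M a ha hM => h3 M a ha fun x hx => hM _ (Finset.mem_image_of_mem _ hx)⟩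
  obtain ⟨x, hx, rfl⟩ := Finset.mem_image.1 hB
  obtain ⟨hw, hz⟩ := h1 x hx
  refine ⟨?_, rank_outer_le _ _, fun M => abs_ip_outer_le M hw hz⟩
  rw [ip_self, frobNorm_outer_unit hw hz, one_pow]

variable {A : Fin m → Matrix (Fin p) (Fin q) ℝ} {Xs : Matrix (Fin p) (Fin q) ℝ}
  {V : Matrix (Fin p) (Fin r) ℝ} {s : Fin r → ℝ} {W : Matrix (Fin q) (Fin r) ℝ} {σ μ : ℝ}
  {L : ℕ → Matrix (Fin p) (Fin r) ℝ} {R : ℕ → Matrix (Fin q) (Fin r) ℝ}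

theorem measAdj_measOp_sub (A : Fin m → Matrix (Fin p) (Fin q) ℝ) (Xs X : Matrix (Fin p) (Fin q) ℝ) :
    measAdj A (measOp A Xs - measOp A X) = -((X - Xs) + designError A (X - Xs)) := by
  have e : measOp A Xs - measOp A X = measOp A (Xs - X) := by
    rw [sub_eq_add_neg, sub_eq_add_neg, measOp_add, ← neg_one_smul ℝ X, measOp_smul, neg_one_smul]
  rw [e, measAdj_measOp, ← neg_sub X Xs, map_neg]
  abel

theorem sqrtDiag_mul_sqrtDiag {d : Fin r → ℝ} (hd : ∀ k, 0 ≤ d k) :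
    sqrtDiag d * sqrtDiag d = Matrix.diagonal d := by
  rw [sqrtDiag, Matrix.diagonal_mul_diagonal]
  congr 1
  funext k
  exact Real.mul_self_sqrt (hd k)

theorem IsScaledGD.isGoodTrunc_init (h : IsTarget Xs V s W σ)
    (hGD : IsScaledGD A (measOp A Xs) μ L R) (hE : 4 * specNorm (designError A Xs) ≤ σ) :
    IsGoodTrunc r σ Xs (Xs + designError A Xs) (L 0 * (R 0).transpose) := by
  obtain ⟨V', s', W', hsvd, hL, hR⟩ := hGD.init
  rw [measAdj_measOp] at hsvd
  have hs' : ∀ k, 0 ≤ s' k := fun k => by rw [hsvd.singVal_eq]; exact singVal_nonneg _ _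
  have e : L 0 * (R 0).transpose = V' * Matrix.diagonal s' * W'.transpose := by
    rw [hL, hR, Matrix.transpose_mul, Matrix.mul_assoc, ← Matrix.mul_assoc (sqrtDiag s'),
      show (sqrtDiag s').transpose = sqrtDiag s' from Matrix.diagonal_transpose _,
      sqrtDiag_mul_sqrtDiag hs', ← Matrix.mul_assoc]
  rw [e]
  exact h.isGoodTrunc hsvd (by rwa [add_sub_cancel_left])

/-- Uniqueness of the pseudo-inverse identifies the one built from the actual factors with the
explicit function of the product. -/
theorem IsScaledGD.mul_transpose_succ (h : IsTarget Xs V s W σ)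
    (hGD : IsScaledGD A (measOp A Xs) μ L R) (t : ℕ)
    (hn : 2 * specNorm (L t * (R t).transpose - Xs) ≤ σ) :
    L (t + 1) * (R (t + 1)).transpose
      = gdStep (designError A) μ Xs V W (L t * (R t).transpose) := by
  have hlt : specNorm (L t * (R t).transpose - Xs) < σ := by
    have := h.pos
    have := specNorm_nonneg (L t * (R t).transpose - Xs)
    linarith
  obtain ⟨hL, hR⟩ := h.isUnit_gram hlt
  rw [hGD.step_left, hGD.step_right, stepMap_factor hL hR, measAdj_measOp_sub, gdStep,
    (isPinv_factorPinv hL hR).unique (h.isPinv_pinvFn hlt)]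

/-- The test matrices of the auxiliary sequence for the direction `B`, as functions of the entries
of the projected design. -/
noncomputable def probeTest (μ σ : ℝ) (Xs : Matrix (Fin p) (Fin q) ℝ) (V : Matrix (Fin p) (Fin r) ℝ)
    (W : Matrix (Fin q) (Fin r) ℝ) (B : Matrix (Fin p) (Fin q) ℝ) :
    ℕ → (Fin m × Fin p × Fin q → ℝ) → Matrix (Fin p) (Fin q) ℝ
  | 0, _ => Xs
  | t + 1, w => auxSeq (probeError (design w) B) μ σ Xs V W t - Xs

theorem measurable_probeTest (h : IsTarget Xs V s W σ) (μ : ℝ) (B : Matrix (Fin p) (Fin q) ℝ)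
    (t : ℕ) : Measurable (probeTest (m := m) μ σ Xs V W B t) := by
  cases t with
  | zero => exact measurable_const
  | succ t => exact (measurable_auxSeq h measurable_design μ t).matrix_sub measurable_const

/-- Geometric decay of the squared error absorbs the linearly growing tail threshold. The price 2/μ
is the reason why the sample size depends on a lower bound for μ. -/
theorem add_mul_pow_sq_le {μ : ℝ} (hμ0 : 0 < μ) (hμ : μ ≤ 1) (t : ℕ) :
    (6 + t) * ((1 - μ / 2) ^ t) ^ 2 ≤ 6 + 2 / μ := by
  have hρ0 : 0 ≤ (1 - μ / 2) ^ t := pow_nonneg (by linarith) t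
  have hρ1 : (1 - μ / 2) ^ t ≤ 1 := pow_le_one₀ (by linarith) (by linarith)
  have h1 : (1 - μ / 2) ^ t ≤ Real.exp (-(t * (μ / 2))) := by
    rw [neg_mul_eq_mul_neg, Real.exp_nat_mul]
    exact pow_le_pow_left₀ (by linarith) (by linarith [Real.add_one_le_exp (-(μ / 2))]) t
  have h2 := Real.add_one_le_exp (t * (μ / 2))
  have h3 : (1 - μ / 2) ^ t * (t * (μ / 2) + 1) ≤ 1 := by
    refine (mul_le_mul h1 h2 (by positivity) (Real.exp_pos _).le).trans ?_
    rw [← Real.exp_add, neg_add_cancel, Real.exp_zero]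
  have h4 : t * (1 - μ / 2) ^ t ≤ 2 / μ := by
    rw [le_div_iff₀ hμ0]; linarith
  have ht : (0 : ℝ) ≤ t := Nat.cast_nonneg t
  have h5 : t * ((1 - μ / 2) ^ t) ^ 2 ≤ t * (1 - μ / 2) ^ t :=
    mul_le_mul_of_nonneg_left (by nlinarith) ht
  have h6 : ((1 - μ / 2) ^ t) ^ 2 ≤ 1 := pow_le_one₀ hρ0 hρ1
  linarith

/-- Otherwise the zero matrix would lie within σ of the target, and zero factors would have
invertible Gram matrices. -/
theorem IsTarget.le_specNorm (h : IsTarget Xs V s W σ) (hr : 1 ≤ r) : σ ≤ specNorm Xs := by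
  by_contra! hlt
  have : Nonempty (Fin r) := ⟨⟨0, hr⟩⟩
  have h1 := (h.isUnit_gram (L := 0) (R := 0) (by
    rwa [Matrix.zero_mul, zero_sub, specNorm_neg])).1
  rw [Matrix.mul_zero] at h1
  exact not_isUnit_zero h1

/-- Convergence of scaled gradient descent on the event where the design satisfies the restricted
isometry property and the decoupled tail bounds. -/
theorem IsTarget.scaledGD_convergence (h : IsTarget Xs V s W σ) (hr : 1 ≤ r) (hm : 0 < m)
    {x : Fin m × Fin p × Fin q → ℝ} {c κ : ℝ} (hc0 : 0 < c) (hc : c ≤ 1 / 1000)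
    (hμ0 : 0 < μ) (hμ : μ ≤ 1 / 32) (hκ1 : 1 ≤ κ) (hκ : specNorm Xs = κ * σ)
    (hE : RestrictedSmall (designError (design x)) (3 * r) (c / (10000 * κ)))
    {N : Finset (Matrix (Fin p) (Fin q) ℝ)}
    (hN : ∀ B ∈ N, ip B B = 1 ∧ B.rank ≤ 1 ∧ ∀ M, |ip B M| ≤ specNorm M)
    (hnet : ∀ (M : Matrix (Fin p) (Fin q) ℝ) (a : ℝ), 0 ≤ a → (∀ B ∈ N, |ip B M| ≤ a) →
        specNorm M ≤ 4 * a)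
    {n : ℝ} (hn : 0 ≤ n)
    (htail : ∀ B ∈ N, ∀ t : ℕ,
      (∑ i, ip (design x i) (removeProbe B (probeTest μ σ Xs V W B t (probeCoord B x))) *
        ip (design x i) B) ^ 2 ≤ 2 * n * (5 + t) *
        ∑ i, ip (design x i) (removeProbe B (probeTest μ σ Xs V W B t (probeCoord B x))) ^ 2)
    (hm1 : 2000000000 * n * r * κ ^ 2 ≤ c ^ 2 * m)
    (hm2 : 6400000000 * n * r * (6 + 2 / μ) ≤ m)
    (hGD : IsScaledGD (design x) (measOp (design x) Xs) μ L R) (t : ℕ) :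
    specNorm (L t * (R t).transpose - Xs) ≤ c * σ ∧
      frobNorm (L t * (R t).transpose - Xs) ≤ 2 * Real.sqrt r * c * (1 - μ / 2) ^ t * σ := by
  have hσ := h.pos
  have hκ0 : 0 < κ := by linarith
  have hm' : (0 : ℝ) < m := Nat.cast_pos.2 hm
  set E := designError (design x) with hEdef
  set δ := c / (10000 * κ) with hδ
  have hδ0 : 0 ≤ δ := by positivity
  have hδ1 : δ ≤ 1 / 10000 := by
    rw [hδ, div_le_div_iff₀ (by positivity) (by norm_num)]; nlinarith
  have hdec : ∀ B ∈ N, decoupled E B = probeError (design (probeCoord B x)) B := fun B hB => by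
    rw [hEdef, decoupled_designError _ (hN B hB).1, design_probeCoord]
  have hψ : ∀ B ∈ N, ∀ t : ℕ, ∀ Z, Z = probeTest μ σ Xs V W B t (probeCoord B x) →
      Z.rank + 1 ≤ 3 * r → 4 * n * (5 + t) * frobNorm Z ^ 2 ≤ (c * σ / 10000) ^ 2 * m →
      |ip (E (removeProbe B Z)) B| ≤ c * σ / 10000 := by
    intro B hB t Z hZ hrk hF
    refine abs_le_of_sq_le_sq ?_ (by positivity)
    have key := hE.sq_ip_probe_le (by linarith) hm (by positivity : 0 ≤ 2 * n * (5 + t)) (hN B hB).1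
      ((rank_removeProbe_le (hN B hB).2.1 Z).trans hrk) (by rw [hZ]; exact htail B hB t)
    refine key.trans ?_
    rw [div_mul_eq_mul_div, div_le_iff₀ hm']
    linarith
  have hr' : (0 : ℝ) ≤ r := Nat.cast_nonneg r
  have hconv := h.convergence (E := E) (δ := δ) (c := c) (μ := μ) (ι := {B // B ∈ N})
    (B := fun i => i.1) (X := fun t => L t * (R t).transpose)
    (Y := fun i t => auxSeq (decoupled E i.1) μ σ Xs V W t) hr hE hδ0 hδ1 hc0 hc hμ0.le hμ
    (by rw [hκ, hδ]; refine le_of_eq ?_; field_simp)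
    (fun i => (hN i.1 i.2).1) (fun i => (hN i.1 i.2).2.1) (fun i => (hN i.1 i.2).2.2)
    (fun M a ha hM => hnet M a ha fun B hB => hM ⟨B, hB⟩)
    (fun h0 => hGD.isGoodTrunc_init h h0) (fun t _ hn => hGD.mul_transpose_succ h t hn)
    (fun i h0 => h.isGoodTrunc_goodTrunc (by rwa [add_sub_cancel_left]))
    (fun i t => rfl)
    (fun i => by
      -- Initialization is test index 0, with threshold factor 5. The bound ‖X⋆‖_F² ≤ rκ²σ² is the
      -- source of n r κ² in the first sample-size condition.
      refine hψ i.1 i.2 0 Xs rfl (by have := h.hasWidth.rank_le; omega) ?_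
      have hF : frobNorm Xs ^ 2 ≤ r * (κ * σ) ^ 2 := by
        have := frobNorm_le_sqrt_mul_specNorm h.hasWidth.rank_le
        rw [hκ] at this
        refine (pow_le_pow_left₀ (frobNorm_nonneg _) this 2).trans ?_
        rw [mul_pow, Real.sq_sqrt hr']
      have h1 := mul_le_mul_of_nonneg_left hF (by positivity : 0 ≤ 20 * n)
      have h2 := mul_le_mul_of_nonneg_right hm1 (sq_nonneg σ)
      push_cast
      nlinarith)
    -- Iterate t is test index t + 1, hence the threshold factor 6 + t. Here ‖Y − X⋆‖_F² is of order
    -- r c²σ² with geometric decay, so c and κ drop out of the second condition.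
    (fun i t hw hYF => by
      refine hψ i.1 i.2 (t + 1) _ (by rw [hdec i.1 i.2]; rfl) (by
        have := hw.rank_sub_le h.hasWidth; omega) ?_
      have hF := pow_le_pow_left₀ (frobNorm_nonneg _) hYF 2
      have hd := add_mul_pow_sq_le hμ0 (by linarith) t
      have e : (4 * Real.sqrt r * c * (1 - μ / 2) ^ t * σ) ^ 2
          = 16 * r * c ^ 2 * σ ^ 2 * ((1 - μ / 2) ^ t) ^ 2 := by
        simp only [mul_pow, Real.sq_sqrt hr']; ring
      rw [e] at hF
      push_cast
      calc 4 * n * (5 + (t + 1)) * frobNorm (auxSeq (decoupled E i.1) μ σ Xs V W t - Xs) ^ 2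
          ≤ 4 * n * (5 + (t + 1)) * (16 * r * c ^ 2 * σ ^ 2 * ((1 - μ / 2) ^ t) ^ 2) :=
            mul_le_mul_of_nonneg_left hF (by positivity)
        _ = (64 * n * r * c ^ 2 * σ ^ 2) * ((6 + t) * ((1 - μ / 2) ^ t) ^ 2) := by ring
        _ ≤ (64 * n * r * c ^ 2 * σ ^ 2) * (6 + 2 / μ) :=
            mul_le_mul_of_nonneg_left hd (by positivity)
        _ = 6400000000 * n * r * (6 + 2 / μ) * ((c * σ / 10000) ^ 2) := by ring
        _ ≤ m * ((c * σ / 10000) ^ 2) := mul_le_mul_of_nonneg_right hm2 (by positivity)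
        _ = _ := mul_comm _ _) t
  exact hconv.2

end ScaledGD

/-! ### From the canonical Gaussian space to an arbitrary realization; numerical bounds. -/

section Transfer

variable {p q m : ℕ}

theorem IsGaussianDesign.map_entries {Ω : Type*} [MeasurableSpace Ω] {P : Measure Ω}
    [IsProbabilityMeasure P] {A : Ω → Fin m → Matrix (Fin p) (Fin q) ℝ}
    (hA : IsGaussianDesign P A) :
    AEMeasurable (fun ω (e : Fin m × Fin p × Fin q) => A ω e.1 e.2.1 e.2.2) P ∧
      P.map (fun ω (e : Fin m × Fin p × Fin q) => A ω e.1 e.2.1 e.2.2)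
        = gaussianProd (Fin m × Fin p × Fin q) := by
  have hm : ∀ e : Fin m × Fin p × Fin q, AEMeasurable (fun ω => A ω e.1 e.2.1 e.2.2) P :=
    fun e => (hA.law e.1 e.2.1 e.2.2).aemeasurable
  refine ⟨aemeasurable_pi_lambda _ hm, ?_⟩
  rw [(iIndepFun_iff_map_fun_eq_pi_map hm).1 hA.indep]
  unfold gaussianProd
  congr 1
  funext e
  exact (hA.law e.1 e.2.1 e.2.2).map_eq

/-- An event of small probability in the canonical model has a measurable complement of large
probability in any realization. -/
theorem IsGaussianDesign.exists_event {Ω : Type*} [MeasurableSpace Ω] {P : Measure Ω}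
    [IsProbabilityMeasure P] {A : Ω → Fin m → Matrix (Fin p) (Fin q) ℝ}
    (hA : IsGaussianDesign P A) {S : Set (Fin m × Fin p × Fin q → ℝ)} {a : ℝ}
    (hS : (gaussianProd (Fin m × Fin p × Fin q)).real S ≤ a) :
    ∃ G : Set Ω, MeasurableSet G ∧ 1 - a ≤ P.real G ∧
      ∀ ω ∈ G, ∃ x, design x = A ω ∧ x ∉ S := by
  obtain ⟨hm, hmap⟩ := hA.map_entries
  set f : Ω → Fin m × Fin p × Fin q → ℝ := fun ω e => A ω e.1 e.2.1 e.2.2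
  -- S is not assumed measurable and the entries are only almost everywhere measurable, so the event
  -- is the complement of a measurable hull.
  refine ⟨(toMeasurable P (f ⁻¹' S))ᶜ, (measurableSet_toMeasurable _ _).compl, ?_,
    fun ω hω => ⟨f ω, rfl, fun h => hω (subset_toMeasurable _ _ h)⟩⟩
  rw [probReal_compl_eq_one_sub (measurableSet_toMeasurable _ _)]
  have h1 : P.real (toMeasurable P (f ⁻¹' S)) ≤ a := by
    refine le_trans ?_ hS
    rw [measureReal_def, measure_toMeasurable, measureReal_def, ← hmap]
    exact ENNReal.toReal_mono (by rw [hmap]; exact measure_ne_top _ _) (Measure.le_map_apply hm S)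
  linarith

/-- The squared net cardinality is at most e^(12nr) since 5 ≤ e², the factor 4 is at most e^(2nr),
and the sample size makes the exponent at least 15nr. -/
theorem net_card_mul_exp_le {n r m : ℕ} (hn : 1 ≤ n) (hr : 1 ≤ r) {c κ : ℝ}
    (hκ : 1 ≤ κ) (hm : 4000000000000 * n * r * κ ^ 2 ≤ c ^ 2 * m) :
    (5 ^ (3 * r * n)) ^ 2 * (4 * Real.exp (-(m * (c / (160000 * κ)) ^ 2 / 8)))
      ≤ Real.exp (-(n : ℝ)) := by
  have hn' : (1 : ℝ) ≤ n := by exact_mod_cast hn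
  have hr' : (1 : ℝ) ≤ r := by exact_mod_cast hr
  have hnr : (n : ℝ) ≤ n * r := le_mul_of_one_le_right (by linarith) hr'
  have he := Real.quadratic_le_exp_of_nonneg (x := 2) (by norm_num)
  have h5 : ((5 : ℝ) ^ (3 * r * n)) ^ 2 ≤ Real.exp (12 * (n * r)) := by
    have e : Real.exp (12 * (n * r)) = (Real.exp 2 ^ (3 * r * n)) ^ 2 := by
      rw [← Real.exp_nat_mul, ← Real.exp_nat_mul]; push_cast; congr 1; ring
    rw [e]
    exact pow_le_pow_left₀ (by positivity)
      (pow_le_pow_left₀ (by norm_num) (by linarith) _) 2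
  have h4 : (4 : ℝ) ≤ Real.exp (2 * (n * r)) := by
    have := Real.exp_le_exp.2 (by linarith : (2 : ℝ) ≤ 2 * (n * r))
    linarith
  have hs : 15 * (n * r : ℝ) ≤ m * (c / (160000 * κ)) ^ 2 / 8 := by
    have hκ0 : 0 < κ := by linarith
    rw [div_pow, mul_div_assoc', div_div, le_div_iff₀ (by positivity)]
    have : (0 : ℝ) ≤ n * r * κ ^ 2 := by positivity
    nlinarith
  calc (5 ^ (3 * r * n)) ^ 2 * (4 * Real.exp (-(m * (c / (160000 * κ)) ^ 2 / 8)))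
      ≤ Real.exp (12 * (n * r)) * (Real.exp (2 * (n * r)) * Real.exp (-(15 * (n * r)))) := by
        refine mul_le_mul h5 (mul_le_mul h4 ?_ (Real.exp_pos _).le (Real.exp_pos _).le)
          (by positivity) (Real.exp_pos _).le
        exact Real.exp_le_exp.2 (neg_le_neg hs)
    _ = Real.exp (-(n * r)) := by rw [← Real.exp_add, ← Real.exp_add]; congr 1; ring
    _ ≤ _ := Real.exp_le_exp.2 (neg_le_neg hnr)

theorem sqrt_mul_pow_le {μ ε ρ : ℝ} {r t : ℕ} (hr : 1 ≤ r) (hμ : 0 < μ) (hμ1 : μ ≤ 1)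
    (hε : 0 < ε) (ht : 10 / μ * Real.log (ρ / ε) ≤ t) (hρ : ρ = Real.sqrt r) :
    ρ * (1 - μ / 10) ^ t ≤ ε := by
  have hρ0 : 0 < ρ := by
    rw [hρ]; exact Real.sqrt_pos.2 (Nat.cast_pos.2 hr)
  have h1 : (1 - μ / 10) ^ t ≤ Real.exp (-(t * (μ / 10))) := by
    rw [neg_mul_eq_mul_neg, Real.exp_nat_mul]
    exact pow_le_pow_left₀ (by linarith) (by linarith [Real.add_one_le_exp (-(μ / 10))]) t
  have h2 : Real.log (ρ / ε) ≤ t * (μ / 10) := by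
    rw [div_mul_eq_mul_div, div_le_iff₀ hμ] at ht
    linarith
  have h3 : Real.exp (-(t * (μ / 10))) ≤ ε / ρ := by
    refine (Real.exp_le_exp.2 (neg_le_neg h2)).trans (le_of_eq ?_)
    rw [Real.exp_neg, Real.exp_log (by positivity), inv_div]
  have := mul_le_mul_of_nonneg_left (h1.trans h3) hρ0.le
  rwa [mul_div_cancel₀ _ hρ0.ne'] at this

end Transfer

end MatrixSensing

/-! ### The main theorem: choice of constants and conclusion. -/

open MatrixSensing in
theorem theorem1 (c₀ : ℝ) (hc₀ : 0 < c₀) (hc₀' : c₀ ≤ 1 / 1080) (cμ : ℝ) (hcμ : 0 < cμ) :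
    ∃ C : ℝ, 0 < C ∧
      ∀ (n₁ n₂ r m : ℕ) (Xstar : Matrix (Fin n₁) (Fin n₂) ℝ)
        (Vstar : Matrix (Fin n₁) (Fin r) ℝ) (σstar : Fin r → ℝ)
        (Wstar : Matrix (Fin n₂) (Fin r) ℝ) (μ : ℝ)
        (Ω : Type*) [MeasurableSpace Ω] (P : Measure Ω) [IsProbabilityMeasure P]
        (A : Ω → Fin m → Matrix (Fin n₁) (Fin n₂) ℝ),
        1 ≤ r → Xstar.rank = r → IsCompactSVD Xstar Vstar σstar Wstar →
        cμ ≤ μ → μ ≤ 1 / 32 →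
        C * ((n₁ : ℝ) + n₂) * r * condNumber Xstar ^ 2 ≤ m →
        IsGaussianDesign P A →
        ∃ E : Set Ω, MeasurableSet E ∧
          1 - 7 * Real.exp (-((n₁ : ℝ) + n₂)) ≤ P.real E ∧
          ∀ ω ∈ E, ∀ (L : ℕ → Matrix (Fin n₁) (Fin r) ℝ) (R : ℕ → Matrix (Fin n₂) (Fin r) ℝ),
            IsScaledGD (A ω) (measOp (A ω) Xstar) μ L R →
            (∀ t : ℕ,
              IsUnit ((L t).transpose * L t) ∧ IsUnit ((R t).transpose * R t) ∧
              factorDist (L t) (R t) Vstar σstar Wstar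
                ≤ 8 * Real.sqrt r * (1 - μ / 10) ^ t * c₀ * sigmaMin Xstar ∧
              frobNorm (L t * (R t).transpose - Xstar)
                ≤ 12 * Real.sqrt r * (1 - μ / 10) ^ t * c₀ * sigmaMin Xstar) ∧
            (∀ (ε : ℝ) (t : ℕ), 0 < ε → 10 / μ * Real.log (Real.sqrt r / ε) ≤ t →
              factorDist (L t) (R t) Vstar σstar Wstar ≤ ε * sigmaMin Xstar ∧
              frobNorm (L t * (R t).transpose - Xstar) ≤ ε * sigmaMin Xstar) := by
  -- The first summand serves restricted isometry and the initialization tail, the second the tails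
  -- along the iteration, with 2/μ ≤ 2/cμ.
  refine ⟨4000000000000 / c₀ ^ 2 + 6400000000 * (6 + 2 / cμ), by positivity, ?_⟩
  intro n₁ n₂ r m Xstar Vstar σstar Wstar μ Ω _ P _ A hr hrank hsvd hcμμ hμ hm hA
  have hμ0 : 0 < μ := hcμ.trans_le hcμμ
  have hT := hsvd.isTarget hr
  set σ := sigmaMin Xstar
  have hσ : 0 < σ := hT.pos
  set κ := condNumber Xstar with hκdef
  have hκ : specNorm Xstar = κ * σ := by rw [hκdef, condNumber, div_mul_cancel₀ _ hσ.ne']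
  have hκ1 : 1 ≤ κ := by rw [hκdef, condNumber, one_le_div hσ]; exact hT.le_specNorm hr
  have hn : 1 ≤ n₁ + n₂ := by
    have := Matrix.rank_le_height Xstar
    omega
  have hncast : ((n₁ + n₂ : ℕ) : ℝ) = (n₁ : ℝ) + n₂ := by push_cast; rfl
  rw [← hncast] at hm ⊢
  set n := n₁ + n₂
  have hn' : (1 : ℝ) ≤ n := by exact_mod_cast hn
  have hr' : (1 : ℝ) ≤ r := by exact_mod_cast hr
  have hκ2 : 1 ≤ κ ^ 2 := one_le_pow₀ hκ1
  have hbase : (1 : ℝ) ≤ n * r := by nlinarith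
  have hm0 : (0 : ℝ) < m := lt_of_lt_of_le (by positivity) hm
  have hm1 : 4000000000000 * n * r * κ ^ 2 ≤ c₀ ^ 2 * m := by
    have h1 : 4000000000000 / c₀ ^ 2 * n * r * κ ^ 2 ≤ m := by
      refine le_trans ?_ hm
      gcongr
      have : 0 ≤ 6400000000 * (6 + 2 / cμ) := by positivity
      linarith
    have h2 := mul_le_mul_of_nonneg_left h1 (sq_nonneg c₀)
    refine le_trans (le_of_eq ?_) h2
    field_simp
  have hm2 : 6400000000 * n * r * (6 + 2 / μ) ≤ m := by
    have h1 : 6400000000 * (6 + 2 / cμ) * n * r * κ ^ 2 ≤ m := by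
      refine le_trans ?_ hm
      gcongr
      have : 0 ≤ 4000000000000 / c₀ ^ 2 := by positivity
      linarith
    have h2 : 2 / μ ≤ 2 / cμ := div_le_div_of_nonneg_left (by norm_num) hcμ hcμμ
    calc 6400000000 * n * r * (6 + 2 / μ) ≤ 6400000000 * n * r * (6 + 2 / cμ) := by gcongr
      _ = 6400000000 * (6 + 2 / cμ) * n * r * 1 := by ring
      _ ≤ 6400000000 * (6 + 2 / cμ) * n * r * κ ^ 2 := by gcongr
      _ ≤ m := h1
  have hmpos : 0 < m := Nat.cast_pos.1 hm0
  obtain ⟨N, hN, hNcard, hNnet⟩ := exists_matrix_probe_net n₁ n₂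
  have hbad1 := gaussianProd_not_restrictedSmall_le (p := n₁) (q := n₂)
    (s := c₀ / (160000 * κ)) (by positivity)
    (by rw [div_le_one (by positivity)]; linarith) hmpos (3 * r)
  -- The deviation level on the net is 1/16 of the required δ = c₀/(10000κ), matching the loss of
  -- passing from the net to all low-rank matrices.
  have e16 : 16 * (c₀ / (160000 * κ)) = c₀ / (10000 * κ) := by field_simp; norm_num
  rw [e16] at hbad1
  have hbad2 := gaussianProd_decoupled_union_le (m := m) hn (fun B hB => (hN B hB).1) hNcard
    (Z := probeTest μ σ Xstar Vstar Wstar) (fun B t => measurable_probeTest hT μ B t)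
  obtain ⟨G, hG, hPG, hGood⟩ := hA.exists_event ((measureReal_union_le _ _).trans
    (add_le_add (hbad1.trans (net_card_mul_exp_le hn hr hκ1 hm1)) hbad2))
  -- The failure probability obtained is 2e^(−n). The event is fixed before L and R, since the
  -- auxiliary sequences do not depend on the singular value decomposition chosen for the
  -- initialization.
  refine ⟨G, hG, by linarith [Real.exp_pos (-(n : ℝ))], fun ω hω L R hGD => ?_⟩
  obtain ⟨x, hx, hxS⟩ := hGood ω hω
  rw [← hx] at hGD
  simp only [Set.mem_union, Set.mem_ofPred_eq, not_or, not_not, not_exists, not_and, not_lt] at hxS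
  have hconv := fun t => hT.scaledGD_convergence hr hmpos hc₀ (by linarith) hμ0 hμ hκ1 hκ hxS.1 hN
    hNnet (by linarith : (0 : ℝ) ≤ n) hxS.2
    (by have : (0 : ℝ) ≤ n * r * κ ^ 2 := by positivity
        linarith) hm2 hGD t
  -- The rate proved, 1 − μ/2, and the constants 2 and 6 are better than the ones required.
  have hpow : ∀ t : ℕ, (1 - μ / 2) ^ t ≤ (1 - μ / 10) ^ t := fun t =>
    pow_le_pow_left₀ (by linarith) (by linarith) t
  have hpow0 : ∀ t : ℕ, 0 ≤ (1 - μ / 10) ^ t := fun t => pow_nonneg (by linarith) t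
  have hfrob : ∀ t, frobNorm (L t * (R t).transpose - Xstar)
      ≤ 2 * (Real.sqrt r * (1 - μ / 10) ^ t * c₀ * σ) := fun t => by
    refine (hconv t).2.trans ?_
    have := mul_le_mul_of_nonneg_left (hpow t)
      (by positivity : 0 ≤ 2 * (Real.sqrt r * c₀ * σ))
    linarith
  have hnear : ∀ t, 2 * specNorm (L t * (R t).transpose - Xstar) ≤ σ := fun t => by
    have := (hconv t).1
    nlinarith
  have hdist : ∀ t, factorDist (L t) (R t) Vstar σstar Wstar
      ≤ 6 * (Real.sqrt r * (1 - μ / 10) ^ t * c₀ * σ) := fun t => by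
    linarith [hT.factorDist_le (hnear t), hfrob t]
  have hpos : ∀ t, 0 ≤ Real.sqrt r * (1 - μ / 10) ^ t * c₀ * σ := fun t =>
    mul_nonneg (mul_nonneg (mul_nonneg (Real.sqrt_nonneg _) (hpow0 t)) hc₀.le) hσ.le
  refine ⟨fun t => ?_, fun ε t hε ht => ?_⟩
  · have hlt : specNorm (L t * (R t).transpose - Xstar) < σ := by
      have := (hconv t).1
      nlinarith
    obtain ⟨hL, hR⟩ := hT.isUnit_gram hlt
    refine ⟨hL, hR, ?_, ?_⟩
    · linarith [hdist t, hpos t]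
    · linarith [hfrob t, hpos t]
  · have h1 := sqrt_mul_pow_le hr hμ0 (by linarith) hε ht rfl
    have h2 : 6 * (Real.sqrt r * (1 - μ / 10) ^ t * c₀ * σ) ≤ ε * σ := by
      have h3 := mul_le_mul_of_nonneg_right h1 hσ.le
      have h4 : 0 ≤ Real.sqrt r * (1 - μ / 10) ^ t * σ :=
        mul_nonneg (mul_nonneg (Real.sqrt_nonneg _) (hpow0 t)) hσ.le
      have h5 := mul_le_mul_of_nonneg_right (by linarith : 6 * c₀ ≤ 1) h4
      linarith
    exact ⟨(hdist t).trans h2, (hfrob t).trans (by linarith [hpos t])⟩
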